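/- Let $0<p<1$ and let $\Pi\subset\mathbf Z_+\times\mathbf Z_+$ be a random set of marked space-time points $(x,t)$ which contains each point with probability $p$, independently for different points. Oriented digital boiling with corner initialization is the process $h_t:\mathbf Z_+\to\mathbf Z_+\cup\{-\infty\}$, $t=0,1,2,\dots$, given by $h_0(0)=0$, $h_0(x)=-\infty$ for $x\ge 1$, and (with $h_t(-1):=-\infty$) $$h_{t+1}(x)=\begin{cases} h_t(x-1) & \text{if } h_t(x-1)>h_t(x),\\ h_t(x)+1 & \text{if } h_t(x-1)\le h_t(x) \text{ and } (x,t)\in\Pi,\\ h_t(x) & \text{if } h_t(x-1)\le h_t(x)\text{ and }(x,t)\notin\Pi.\end{cases}$$ Let $H_k$ be the (physicists') Hermite polynomials, let $\varphi_k(y)=e^{-y^2/2}H_k(y)/\sqrt{2^k\,k!\,\pi^{1/2}}$, and let $K_{H,n}(y,z)=\sum_{k=0}^{n-1}\varphi_k(y)\varphi_k(z)$ be the Hermite kernel. For $n\ge1$ and $s\in\mathbf R$ let $$F_n^{GUE}(s)=\det\bigl(I-K_{H,n}\bigr)_{L^2(s/\sqrt2,\infty)}=\sum_{k\ge0}\frac{(-1)^k}{k!}\int_{(s/\sqrt2,\infty)^k}\det\bigl(K_{H,n}(y_i,y_j)\bigr)_{i,j=1}^k\,dy_1\cdots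 dy_k .$$ Fix $x\in\mathbf Z_+$ and put $n=x+1$, $m=t-x$ and $\sigma=\sqrt{p(1-p)}$. Then for every $s\in\mathbf R$ the integrals and the series that define $F_n^{GUE}(s)$ converge, $$\lim_{t\to\infty}\mathrm{Prob}\left(\frac{h_t(x)-p\,m}{\sigma\sqrt m}\le s\right)=F_n^{GUE}(s),\qquad \lim_{t\to\infty}\mathrm{Prob}\left(\frac{h_t(x)-p\,t}{\sqrt{p(1-p)\,t}}<s\right)=F_n^{GUE}(s),$$ and $F_n^{GUE}(s)$ is the probability that the largest eigenvalue of an $n\times n$ GUE matrix is at most $s$, where the GUE is the random hermitian matrix whose density is proportional to $e^{-\frac12\mathrm{tr}\,M^2}$ (diagonal entries are real standard Gaussians, entries above the diagonal are complex Gaussians whose real and imaginary parts have variance $1/2$, all independent). -/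

import Mathlib

open MeasureTheory ProbabilityTheory Filter Topology

/-- Height function of oriented digital boiling with corner initialization, run with the set `S` of
marked space-time points `(x, t)`; `⊥` stands for `-∞`, and the missing left neighbour of the site
`0` has height `-∞`.  If the left neighbour is strictly higher, its height is copied; otherwise the
height grows by one exactly if `(x, t)` is marked. -/
noncomputable def odbHeight (S : Set (ℕ × ℕ)) : ℕ → ℕ → WithBot ℕ
  | 0, x => if x = 0 then 0 else ⊥
  | t + 1, x =>
    let left : WithBot ℕ := if x = 0 then ⊥ else odbHeight S t (x - 1)
    open Classical in
    if odbHeight S t x < left then left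
    else if (x, t) ∈ S then odbHeight S t x + 1
    else odbHeight S t x

/-- The height is `-∞` exactly outside the light cone `x ≤ t`. -/
theorem odbHeight_eq_bot_iff (S : Set (ℕ × ℕ)) (t x : ℕ) : odbHeight S t x = ⊥ ↔ t < x := by
  induction t generalizing x with
  | zero =>
    rcases Nat.eq_zero_or_pos x with rfl | hx
    · simp [odbHeight]
    · simp [odbHeight, hx, hx.ne']
  | succ t ih =>
    have h1 := ih x
    have h2 := ih (x - 1)
    simp only [odbHeight]
    split_ifs with hx hlt hm hlt hm
    · simp at hlt
    · subst hx
      simp only [Nat.not_lt_zero, iff_false, WithBot.add_eq_bot, not_or] at h1 ⊢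
      exact ⟨h1, WithBot.one_ne_bot⟩
    · subst hx
      simpa using h1
    · rw [h2]; omega
    · rw [WithBot.add_eq_bot, h1]
      simp only [WithBot.one_ne_bot, or_false]
      constructor
      · intro h
        have h3 : odbHeight S t (x - 1) ≤ ⊥ := by rw [← h1.2 h]; exact not_lt.1 hlt
        have := h2.1 (le_bot_iff.1 h3)
        omega
      · omega
    · rw [h1]
      constructor
      · intro h
        have h3 : odbHeight S t (x - 1) ≤ ⊥ := by rw [← h1.2 h]; exact not_lt.1 hlt
        have := h2.1 (le_bot_iff.1 h3)
        omega
      · omega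

/-- The height as a real number; it is the true height for `x ≤ t` (and `0` where it is `-∞`). -/
noncomputable def odbHeightReal (S : Set (ℕ × ℕ)) (t x : ℕ) : ℝ :=
  ((odbHeight S t x).unbotD 0 : ℕ)

/-- The physicists' Hermite polynomial `H_k(y) = 2^{k/2} He_k(√2 y)`, where `He_k` is
Mathlib's (probabilists') Hermite polynomial. -/
noncomputable def physHermite (k : ℕ) (y : ℝ) : ℝ :=
  √2 ^ k * Polynomial.aeval (√2 * y) (Polynomial.hermite k)

/-- The oscillator wave functions `φ_k`. -/
noncomputable def oscillator (k : ℕ) (y : ℝ) : ℝ :=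
  Real.exp (-y ^ 2 / 2) * physHermite k y / √(2 ^ k * (k.factorial : ℝ) * √Real.pi)

/-- The Hermite kernel `K_{H,n}`. -/
noncomputable def hermiteKernel (n : ℕ) (y z : ℝ) : ℝ :=
  ∑ k ∈ Finset.range n, oscillator k y * oscillator k z

/-- The integrand of the `k`-th term of the Fredholm series of the kernel `K`. -/
noncomputable def fredholmIntegrand (K : ℝ → ℝ → ℝ) (k : ℕ) (y : Fin k → ℝ) : ℝ :=
  (Matrix.of fun i j : Fin k => K (y i) (y j)).det

/-- The `k`-th term of the Fredholm series of `det (I - K)` on `L²(μ)`. -/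
noncomputable def fredholmTerm (μ : Measure ℝ) (K : ℝ → ℝ → ℝ) (k : ℕ) : ℝ :=
  (-1) ^ k / (k.factorial : ℝ) *
    ∫ y : Fin k → ℝ, fredholmIntegrand K k y ∂(Measure.pi fun _ => μ)

/-- The Fredholm determinant `det (I - K)` on `L²(μ)`, as the sum of its Fredholm series. -/
noncomputable def fredholmDet (μ : Measure ℝ) (K : ℝ → ℝ → ℝ) : ℝ :=
  ∑' k, fredholmTerm μ K k

/-- The Fredholm series is well defined: its integrals exist and the series converges. -/
def FredholmConverges (μ : Measure ℝ) (K : ℝ → ℝ → ℝ) : Prop :=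
  (∀ k, Integrable (fredholmIntegrand K k) (Measure.pi fun _ : Fin k => μ)) ∧
    Summable (fredholmTerm μ K)

/-- The hermitian matrix built from real numbers `g`.  If these are independent standard Gaussians,
the diagonal entries are real standard Gaussians, and the entries above the diagonal are complex
Gaussians whose real and imaginary parts are independent with variance `1/2`. -/
noncomputable def gueMatrix {n : ℕ} (g : Fin n × Fin n → ℝ) : Matrix (Fin n) (Fin n) ℂ :=
  Matrix.of fun i j =>
    if i = j then (g (i, i) : ℂ)
    else if i < j then ((g (i, j) : ℂ) + Complex.I * (g (j, i) : ℂ)) / (√2 : ℝ)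
    else ((g (j, i) : ℂ) - Complex.I * (g (i, j) : ℂ)) / (√2 : ℝ)

theorem gueMatrix_isHermitian {n : ℕ} (g : Fin n × Fin n → ℝ) : (gueMatrix g).IsHermitian := by
  ext i j
  rw [Matrix.conjTranspose_apply]
  rcases lt_trichotomy i j with h | h | h
  · simp [gueMatrix, h, h.ne, h.ne', h.not_gt, sub_eq_add_neg]
  · subst h; simp [gueMatrix]
  · simp [gueMatrix, h, h.ne, h.ne', h.not_gt, sub_eq_add_neg]

/-- Distribution function of the largest eigenvalue of an `n × n` GUE matrix (`1 ≤ n`), the GUE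
being normalized to have density proportional to `exp (-tr M² / 2)`. -/
noncomputable def gueLargestEigenvalueCDF (n : ℕ) (s : ℝ) : ℝ :=
  (Measure.pi fun _ : Fin n × Fin n => gaussianReal 0 1).real
    {g | (⨆ i, (gueMatrix_isHermitian g).eigenvalues i) ≤ s}

/-!
Both limit laws and the eigenvalue distribution are identified with one explicit determinant,
`(truncatedGram n s).det`, whose entries are `∫ x in Iic s, He_i x * He_j x * φ x / i!` for the
probabilists' Hermite polynomials `He_i` and the standard Gaussian density `φ`.

*Fredholm determinant.* The Hermite kernel has rank `n`. By the Andréief identity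
(`integral_det_mul_det`) the Fredholm series of a kernel of finite rank is a finite sum of principal
minors, equal to the determinant of the identity minus a Gram matrix
(`fredholmDet_finite_rank`). By orthonormality of the oscillator functions, the identity minus the
Gram matrix over `(s / √2, ∞)` is the Gram matrix over the complementary half-line
(`fredholmDet_hermiteKernel`).

*Random matrices.* The Weyl integration formula for the eigenvalues (`lintegral_gueMatrix`) is
proved by induction on the size of the matrix. A hermitian matrix of size `n + 1` is a bordering of
one of size `n`; by unitary invariance the latter may be taken diagonal, and then the
eigenvalues depend only on the squared moduli of the entries of the border and on the corner entry.
The change of variables from these to the eigenvalues, which interlace those of the corner, has a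
ratio of Vandermonde determinants as its Jacobian. Integrating out the smaller eigenvalues over the
interlacing boxes reproduces a Vandermonde determinant. The Andréief identity then turns the
distribution function of the largest eigenvalue into a Hankel determinant, and hence into
`(truncatedGram n s).det` (`gueLargestEigenvalueCDF_eq_det`).

*Digital boiling.* In the time `m` since a site was reached by the light cone, the heights
`lagHeight S m j` satisfy `X (m + 1) (j + 1) = max (X (m + 1) j) (X m (j + 1) + ε)` with independent
Bernoulli variables `ε`. Hence the probability that the heights at the first `n` sites stay
below a weakly increasing barrier satisfies a free evolution equation in the barrier, and the
interaction only appears as a boundary condition where the barrier descends. The same equation,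
boundary condition and initial values hold for a determinant of Cauchy integrals, which is therefore
equal to the probability (`barrierProb_eq_det`).

*Asymptotics.* On circles of radius `exp (-1 / (σ √m))` the rescaled Cauchy integrals converge, by
dominated convergence, to Gaussian integrals over a vertical line (`tendsto_odbCoeff`). These are
repeated antiderivatives of Hermite functions (`gaussContour_eq_integral`), and row and column
operations lead to `(truncatedGram n s).det` once more (`tendsto_barrierProb`). The two
normalizations in the statement change the barrier by a bounded amount only.
-/

/-! ### Determinants under the integral sign -/

section DetIntegral

variable {ι : Type*} [Fintype ι] [DecidableEq ι] {E : Type*}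

theorem integrable_det_columns [MeasurableSpace E] (μ : ι → Measure E) [∀ i, SigmaFinite (μ i)]
    (f : ι → ι → E → ℝ)
    (hf : ∀ i j, Integrable (f i j) (μ j)) :
    Integrable (fun y : ι → E => (Matrix.of fun i j => f i j (y j)).det) (Measure.pi μ) := by
  simp only [Matrix.det_apply, Matrix.of_apply, zsmul_eq_mul, Units.smul_def]
  refine integrable_finsetSum _ fun σ _ => ?_
  exact (Integrable.fintype_prod_dep fun j => hf (σ j) j).const_mul _

/-- A determinant whose `j`-th column depends on the `j`-th variable only is integrated
columnwise. -/
theorem integral_det_columns [MeasurableSpace E] (μ : ι → Measure E) [∀ i, SigmaFinite (μ i)]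
    (f : ι → ι → E → ℝ)
    (hf : ∀ i j, Integrable (f i j) (μ j)) :
    ∫ y : ι → E, (Matrix.of fun i j => f i j (y j)).det ∂(Measure.pi μ) =
      (Matrix.of fun i j => ∫ x, f i j x ∂(μ j)).det := by
  simp only [Matrix.det_apply, Matrix.of_apply, zsmul_eq_mul, Units.smul_def]
  rw [integral_finsetSum]
  · refine Finset.sum_congr rfl fun σ _ => ?_
    rw [integral_const_mul, integral_fintype_prod_eq_prod (fun j => f (σ j) j)]
  · intro σ _
    exact (Integrable.fintype_prod_dep fun j => hf (σ j) j).const_mul _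

/-- Expanding the first determinant leaves, for each permutation, a determinant whose `j`-th column
depends on the `j`-th variable only. -/
theorem det_mul_det_eq_sum (f g : ι → E → ℝ) (y : ι → E) :
    (Matrix.of fun i j => f i (y j)).det * (Matrix.of fun i j => g i (y j)).det =
      ∑ σ : Equiv.Perm ι, ((Equiv.Perm.sign σ : ℤ) : ℝ) *
        (Matrix.of fun i j => f (σ j) (y j) * g i (y j)).det := by
  rw [Matrix.det_apply (Matrix.of fun i j => f i (y j)), Finset.sum_mul]
  refine Finset.sum_congr rfl fun σ _ => ?_
  rw [Units.smul_def, zsmul_eq_mul, mul_assoc]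
  congr 1
  exact (Matrix.det_mul_row (fun j => f (σ j) (y j)) (Matrix.of fun i j => g i (y j))).symm

theorem integrable_det_mul_det [MeasurableSpace E] (μ : Measure E) [SigmaFinite μ]
    (f g : ι → E → ℝ)
    (hfg : ∀ i j, Integrable (fun x => f i x * g j x) μ) :
    Integrable (fun y : ι → E => (Matrix.of fun i j => f i (y j)).det *
      (Matrix.of fun i j => g i (y j)).det) (Measure.pi fun _ => μ) := by
  simp only [det_mul_det_eq_sum]
  refine integrable_finsetSum _ fun σ _ => Integrable.const_mul ?_ _
  exact integrable_det_columns (fun _ => μ) (fun i j x => f (σ j) x * g i x)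
    fun i j => hfg (σ j) i

/-- **Andréief's identity.** -/
theorem integral_det_mul_det [MeasurableSpace E] (μ : Measure E) [SigmaFinite μ]
    (f g : ι → E → ℝ)
    (hfg : ∀ i j, Integrable (fun x => f i x * g j x) μ) :
    ∫ y : ι → E, (Matrix.of fun i j => f i (y j)).det * (Matrix.of fun i j => g i (y j)).det
        ∂(Measure.pi fun _ => μ) =
      ((Fintype.card ι).factorial : ℝ) * (Matrix.of fun i j => ∫ x, f i x * g j x ∂μ).det := by
  simp only [det_mul_det_eq_sum]
  rw [integral_finsetSum]
  · have key : ∀ σ : Equiv.Perm ι, ∫ y : ι → E, ((Equiv.Perm.sign σ : ℤ) : ℝ) *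
        (Matrix.of fun i j => f (σ j) (y j) * g i (y j)).det ∂(Measure.pi fun _ => μ) =
        (Matrix.of fun i j => ∫ x, f i x * g j x ∂μ).det := by
      intro σ
      rw [integral_const_mul,
        integral_det_columns (fun _ => μ) (fun i j x => f (σ j) x * g i x)
          (fun i j => hfg (σ j) i), ← Matrix.det_transpose,
        show (Matrix.of fun i j => ∫ x, f (σ j) x * g i x ∂μ).transpose =
          (Matrix.of fun i j => ∫ x, f i x * g j x ∂μ).submatrix σ id from rfl,
        Matrix.det_permute, ← mul_assoc]
      rcases Int.units_eq_one_or (Equiv.Perm.sign σ) with h | h <;> simp [h]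
    rw [Finset.sum_congr rfl fun σ _ => key σ, Finset.sum_const, Finset.card_univ,
      Fintype.card_perm, nsmul_eq_mul]
  · intro σ _
    exact (integrable_det_columns (fun _ => μ) (fun i j x => f (σ j) x * g i x)
      fun i j => hfg (σ j) i).const_mul _

end DetIntegral

/-! ### Fredholm determinants of kernels of finite rank -/

theorem sum_det_submatrix_eq_factorial_mul {n : ℕ} (G : Matrix (Fin n) (Fin n) ℝ) (k : ℕ) :
    ∑ φ : Fin k → Fin n, (G.submatrix φ φ).det =
      (k.factorial : ℝ) * ∑ s ∈ Finset.univ.powersetCard k,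
        (G.submatrix (Subtype.val : s → Fin n) (Subtype.val : s → Fin n)).det := by
  classical
  have h1 : ∑ φ : Fin k → Fin n, (G.submatrix φ φ).det =
      ∑ φ : Fin k → Fin n with Function.Injective φ, (G.submatrix φ φ).det := by
    rw [Finset.sum_filter]
    refine Finset.sum_congr rfl fun φ _ => ?_
    split_ifs with h
    · rfl
    · simp only [Function.Injective, not_forall] at h
      obtain ⟨a, b, hab, hne⟩ := h
      exact Matrix.det_zero_of_row_eq hne (by ext j; simp [hab])
  rw [h1, Finset.mul_sum, ← Finset.sum_fiberwise_of_maps_to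
    (t := Finset.univ.powersetCard k) (g := fun φ : Fin k → Fin n => Finset.univ.image φ)]
  · refine Finset.sum_congr rfl fun s hs => ?_
    have hcard : s.card = k := (Finset.mem_powersetCard.1 hs).2
    have h2 : ∑ φ ∈ Finset.univ.filter (fun φ : Fin k → Fin n => Function.Injective φ) with
        Finset.univ.image φ = s, (G.submatrix φ φ).det =
        ∑ e : Fin k ≃ s, (G.submatrix (Subtype.val : s → Fin n) Subtype.val).det := by
      symm
      refine Finset.sum_bij (fun e _ => fun i => ((e i : s) : Fin n)) ?_ ?_ ?_ ?_
      · intro e _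
        simp only [Finset.mem_filter, Finset.mem_univ, true_and]
        refine ⟨Subtype.val_injective.comp e.injective, ?_⟩
        ext a
        simp only [Finset.mem_image, Finset.mem_univ, true_and]
        constructor
        · rintro ⟨i, rfl⟩; exact (e i).2
        · intro ha; exact ⟨e.symm ⟨a, ha⟩, by simp⟩
      · intro e _ e' _ h
        ext i
        exact congrArg Fin.val (congrFun h i)
      · intro φ hφ
        simp only [Finset.mem_filter, Finset.mem_univ, true_and] at hφ
        obtain ⟨hinj, him⟩ := hφ
        have hmem : ∀ i, φ i ∈ s := fun i => him ▸ Finset.mem_image_of_mem φ (Finset.mem_univ i)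
        refine ⟨Equiv.ofBijective (fun i => (⟨φ i, hmem i⟩ : s)) ⟨?_, ?_⟩, Finset.mem_univ _, ?_⟩
        · intro a b h; exact hinj (congrArg Subtype.val h)
        · rintro ⟨a, ha⟩
          rw [← him] at ha
          obtain ⟨i, _, hi⟩ := Finset.mem_image.1 ha
          exact ⟨i, Subtype.ext hi⟩
        · rfl
      · intro e _
        exact (Matrix.det_submatrix_equiv_self e
          (G.submatrix (Subtype.val : s → Fin n) Subtype.val)).symm
    rw [h2, Finset.sum_const, Finset.card_univ, Fintype.card_equiv
      (Fintype.equivOfCardEq (by simp [hcard])), Fintype.card_fin, nsmul_eq_mul]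
  · intro φ hφ
    simp only [Finset.mem_filter, Finset.mem_univ, true_and] at hφ
    simp [Finset.mem_powersetCard, Finset.card_image_of_injective _ hφ]

/-- The value at `1` of the expansion of the characteristic polynomial in principal minors. -/
theorem sum_principal_minors_eq_det_one_sub {n : ℕ} (G : Matrix (Fin n) (Fin n) ℝ) :
    ∑ k ∈ Finset.range (n + 1), (-1 : ℝ) ^ k * ∑ s ∈ Finset.univ.powersetCard k,
      (G.submatrix (Subtype.val : s → Fin n) (Subtype.val : s → Fin n)).det = (1 - G).det := by
  have h1 : (1 - G).det = G.charpoly.eval 1 := by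
    rw [Matrix.eval_charpoly]; simp
  rw [h1, Polynomial.eval_eq_sum_range, Matrix.charpoly_natDegree_eq_dim, Fintype.card_fin,
    ← Finset.sum_range_reflect (fun i => G.charpoly.coeff i * 1 ^ i)]
  refine Finset.sum_congr rfl fun k hk => ?_
  have hk' : k ≤ n := Nat.lt_succ_iff.1 (Finset.mem_range.1 hk)
  have := Matrix.charpoly_coeff_eq_sum_minors G k (by simpa using hk')
  rw [Fintype.card_fin] at this
  rw [show n + 1 - 1 - k = n - k by omega, this]
  simp

section Fredholm

variable {n : ℕ} (μ : Measure ℝ) (f : Fin n → ℝ → ℝ)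

/-- Expansion of the determinant of a finite rank kernel by multilinearity in the rows. -/
theorem fredholmIntegrand_finite_rank (k : ℕ) (y : Fin k → ℝ) :
    fredholmIntegrand (fun a b => ∑ l, f l a * f l b) k y =
      ∑ φ : Fin k → Fin n, (Matrix.of fun i j : Fin k => f (φ i) (y j) * f (φ j) (y j)).det := by
  have h1 : fredholmIntegrand (fun a b => ∑ l, f l a * f l b) k y =
      Matrix.detRowAlternating (fun i => ∑ l : Fin n, (fun j => f l (y i) * f l (y j))) := by
    unfold fredholmIntegrand
    change Matrix.det _ = Matrix.det _
    congr 1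
    ext i j
    simp
  rw [h1, ← AlternatingMap.coe_multilinearMap, MultilinearMap.map_sum]
  refine Finset.sum_congr rfl fun φ _ => ?_
  change Matrix.det (Matrix.of fun i j => f (φ i) (y i) * f (φ i) (y j)) = _
  have h2 := Matrix.det_mul_column (fun i => f (φ i) (y i)) (Matrix.of fun i j => f (φ i) (y j))
  have h3 := Matrix.det_mul_row (fun i => f (φ i) (y i)) (Matrix.of fun i j => f (φ i) (y j))
  simp only [Matrix.of_apply] at h2 h3
  rw [h2, ← h3]
  congr 1
  ext i j
  simp [mul_comm]


theorem integrable_fredholmIntegrand_finite_rank [SigmaFinite μ]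
    (hf : ∀ i j, Integrable (fun x => f i x * f j x) μ) (k : ℕ) :
    Integrable (fredholmIntegrand (fun a b => ∑ l, f l a * f l b) k)
      (Measure.pi fun _ : Fin k => μ) := by
  have : fredholmIntegrand (fun a b => ∑ l, f l a * f l b) k = fun y : Fin k → ℝ =>
      ∑ φ : Fin k → Fin n, (Matrix.of fun i j : Fin k => f (φ i) (y j) * f (φ j) (y j)).det :=
    funext (fredholmIntegrand_finite_rank f k)
  rw [this]
  refine integrable_finsetSum _ fun φ _ => ?_
  exact integrable_det_columns (fun _ => μ) (fun i j x => f (φ i) x * f (φ j) x)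
    fun i j => hf _ _

theorem fredholmTerm_finite_rank [SigmaFinite μ]
    (hf : ∀ i j, Integrable (fun x => f i x * f j x) μ) (k : ℕ) :
    fredholmTerm μ (fun a b => ∑ l, f l a * f l b) k =
      (-1) ^ k * ∑ s ∈ Finset.univ.powersetCard k,
        ((Matrix.of fun i j => ∫ x, f i x * f j x ∂μ).submatrix
          (Subtype.val : s → Fin n) (Subtype.val : s → Fin n)).det := by
  unfold fredholmTerm
  simp only [fredholmIntegrand_finite_rank]
  rw [integral_finsetSum]
  · have h : ∀ φ : Fin k → Fin n,
        ∫ y : Fin k → ℝ, (Matrix.of fun i j : Fin k => f (φ i) (y j) * f (φ j) (y j)).det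
          ∂(Measure.pi fun _ => μ) =
        ((Matrix.of fun i j => ∫ x, f i x * f j x ∂μ).submatrix φ φ).det := fun φ =>
      integral_det_columns (fun _ => μ) (fun i j x => f (φ i) x * f (φ j) x) fun i j => hf _ _
    rw [Finset.sum_congr rfl fun φ _ => h φ, sum_det_submatrix_eq_factorial_mul, ← mul_assoc,
      div_mul_cancel₀ _ (by positivity)]
  · intro φ _
    exact integrable_det_columns (fun _ => μ) (fun i j x => f (φ i) x * f (φ j) x)
      fun i j => hf _ _

theorem fredholmTerm_finite_rank_eq_zero [SigmaFinite μ]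
    (hf : ∀ i j, Integrable (fun x => f i x * f j x) μ) {k : ℕ} (hk : n < k) :
    fredholmTerm μ (fun a b => ∑ l, f l a * f l b) k = 0 := by
  rw [fredholmTerm_finite_rank μ f hf, Finset.powersetCard_eq_empty.2 (by simpa using hk)]
  simp

theorem fredholmConverges_finite_rank [SigmaFinite μ]
    (hf : ∀ i j, Integrable (fun x => f i x * f j x) μ) :
    FredholmConverges μ (fun a b => ∑ l, f l a * f l b) := by
  refine ⟨integrable_fredholmIntegrand_finite_rank μ f hf, ?_⟩
  refine summable_of_ne_finset_zero (s := Finset.range (n + 1)) fun k hk => ?_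
  exact fredholmTerm_finite_rank_eq_zero μ f hf (by simpa using hk)

/-- The Fredholm determinant of a kernel of finite rank is the determinant of `1` minus the Gram
matrix: its series is the expansion of the latter in principal minors. -/
theorem fredholmDet_finite_rank [SigmaFinite μ]
    (hf : ∀ i j, Integrable (fun x => f i x * f j x) μ) :
    fredholmDet μ (fun a b => ∑ l, f l a * f l b) =
      (1 - Matrix.of fun i j => ∫ x, f i x * f j x ∂μ).det := by
  unfold fredholmDet
  rw [tsum_eq_sum (s := Finset.range (n + 1)), ← sum_principal_minors_eq_det_one_sub]
  · exact Finset.sum_congr rfl fun k _ => fredholmTerm_finite_rank μ f hf k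
  · intro k hk
    exact fredholmTerm_finite_rank_eq_zero μ f hf (by simpa using hk)

end Fredholm

/-! ### Gaussian integrals of Hermite polynomials -/

/-- The standard Gaussian density. -/
noncomputable def normalDensity (x : ℝ) : ℝ := Real.exp (-(x ^ 2 / 2)) / √(2 * Real.pi)

/-- The probabilists' Hermite polynomials with real coefficients. -/
noncomputable def realHermite (n : ℕ) : Polynomial ℝ :=
  (Polynomial.hermite n).map (Int.castRingHom ℝ)

theorem aeval_hermite (n : ℕ) (x : ℝ) :
    Polynomial.aeval x (Polynomial.hermite n) = (realHermite n).eval x := by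
  rw [realHermite, Polynomial.eval_map, Polynomial.aeval_def]
  rfl

theorem realHermite_zero : realHermite 0 = 1 := by simp [realHermite]

theorem realHermite_succ (n : ℕ) :
    realHermite (n + 1) =
      Polynomial.X * realHermite n - Polynomial.derivative (realHermite n) := by
  simp [realHermite, Polynomial.hermite_succ, Polynomial.derivative_map]

theorem derivative_realHermite_succ (n : ℕ) :
    Polynomial.derivative (realHermite (n + 1)) = (n + 1 : ℕ) • realHermite n := by
  induction n with
  | zero => simp [realHermite_succ, realHermite_zero]
  | succ n ih =>
    rw [realHermite_succ (n + 1), Polynomial.derivative_sub, Polynomial.derivative_mul,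
      Polynomial.derivative_X, ih, Polynomial.derivative_smul, realHermite_succ n]
    simp only [nsmul_eq_mul]
    push_cast
    ring

theorem realHermite_succ_succ (n : ℕ) :
    realHermite (n + 2) =
      Polynomial.X * realHermite (n + 1) - (n + 1 : ℕ) • realHermite n := by
  rw [realHermite_succ (n + 1), derivative_realHermite_succ]

theorem natDegree_realHermite_le (n : ℕ) : (realHermite n).natDegree ≤ n :=
  (Polynomial.natDegree_map_le).trans Polynomial.natDegree_hermite.le

theorem coeff_realHermite_self (n : ℕ) : (realHermite n).coeff n = 1 := by
  simp [realHermite, Polynomial.coeff_hermite_self]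

theorem continuous_normalDensity : Continuous normalDensity := by
  unfold normalDensity; fun_prop

theorem normalDensity_pos (x : ℝ) : 0 < normalDensity x := by
  unfold normalDensity; positivity

theorem hasDerivAt_normalDensity (x : ℝ) :
    HasDerivAt normalDensity (-(x * normalDensity x)) x := by
  have h1 : HasDerivAt (fun x : ℝ => -(x ^ 2 / 2)) (-x) x := by
    exact (((hasDerivAt_pow 2 x).div_const 2).neg).congr_deriv (by simp)
  refine ((h1.exp).div_const (√(2 * Real.pi))).congr_deriv ?_
  unfold normalDensity
  ring

theorem integrable_pow_mul_normalDensity (k : ℕ) :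
    Integrable (fun x : ℝ => x ^ k * normalDensity x) := by
  have h := integrable_rpow_mul_exp_neg_mul_sq (b := 1 / 2) (by norm_num) (s := (k : ℝ))
    (by have : (0 : ℝ) ≤ k := k.cast_nonneg
        linarith)
  refine (h.div_const (√(2 * Real.pi))).congr (Eventually.of_forall fun x => ?_)
  simp only [Real.rpow_natCast, normalDensity]
  rw [mul_div_assoc]
  ring_nf

theorem integrable_eval_mul_normalDensity (P : Polynomial ℝ) :
    Integrable (fun x : ℝ => P.eval x * normalDensity x) := by
  simp only [Polynomial.eval_eq_sum_range, Finset.sum_mul]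
  refine integrable_finsetSum _ fun i _ => ?_
  simpa only [mul_assoc] using (integrable_pow_mul_normalDensity i).const_mul (P.coeff i)

theorem integral_normalDensity : ∫ x : ℝ, normalDensity x = 1 := by
  have h := integral_gaussian (1 / 2)
  unfold normalDensity
  rw [integral_div, show (fun x : ℝ => Real.exp (-(x ^ 2 / 2))) =
    fun x : ℝ => Real.exp (-(1 / 2) * x ^ 2) by ext x; ring_nf, h]
  rw [show Real.pi / (1 / 2) = 2 * Real.pi by ring, div_self (by positivity)]

theorem hasDerivAt_realHermite_mul_normalDensity (n : ℕ) (x : ℝ) :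
    HasDerivAt (fun x => (realHermite n).eval x * normalDensity x)
      (-((realHermite (n + 1)).eval x * normalDensity x)) x := by
  refine (((realHermite n).hasDerivAt x).mul (hasDerivAt_normalDensity x)).congr_deriv ?_
  rw [realHermite_succ]
  simp
  ring

/-- Integration by parts: `He_{j+1} φ = -(He_j φ)'`. -/
theorem integral_eval_mul_realHermite_succ (P : Polynomial ℝ) (j : ℕ) :
    ∫ x : ℝ, P.eval x * (realHermite (j + 1)).eval x * normalDensity x =
      ∫ x : ℝ, P.derivative.eval x * (realHermite j).eval x * normalDensity x := by
  have hd : ∀ x, HasDerivAt (fun x => P.eval x * ((realHermite j).eval x * normalDensity x))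
      (P.derivative.eval x * (realHermite j).eval x * normalDensity x -
        P.eval x * (realHermite (j + 1)).eval x * normalDensity x) x := by
    intro x
    refine ((P.hasDerivAt x).mul
      (hasDerivAt_realHermite_mul_normalDensity j x)).congr_deriv ?_
    ring
  have i1 : Integrable fun x => P.derivative.eval x * (realHermite j).eval x *
      normalDensity x := by
    simpa using integrable_eval_mul_normalDensity (P.derivative * realHermite j)
  have i2 : Integrable fun x => P.eval x * (realHermite (j + 1)).eval x * normalDensity x := by
    simpa using integrable_eval_mul_normalDensity (P * realHermite (j + 1))
  have i3 : Integrable fun x => P.eval x * ((realHermite j).eval x * normalDensity x) := by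
    simpa [mul_assoc] using integrable_eval_mul_normalDensity (P * realHermite j)
  have h := integral_eq_zero_of_hasDerivAt_of_integrable hd (i1.sub i2) i3
  rw [integral_sub i1 i2] at h
  linarith

theorem integral_realHermite_mul_realHermite (i j : ℕ) :
    ∫ x : ℝ, (realHermite i).eval x * (realHermite j).eval x * normalDensity x =
      if i = j then (i.factorial : ℝ) else 0 := by
  induction j generalizing i with
  | zero =>
    cases i with
    | zero => simp [realHermite_zero, integral_normalDensity]
    | succ i =>
      have h := integral_eval_mul_realHermite_succ 1 i
      simp only [Polynomial.eval_one, Polynomial.derivative_one, Polynomial.eval_zero, zero_mul,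
        one_mul, integral_zero] at h
      simp [realHermite_zero, h]
  | succ j ih =>
    rw [integral_eval_mul_realHermite_succ]
    cases i with
    | zero => simp [realHermite_zero]
    | succ i =>
      rw [derivative_realHermite_succ]
      have : ∀ x : ℝ, ((i + 1 : ℕ) • realHermite i).eval x * (realHermite j).eval x *
          normalDensity x =
          ((i + 1 : ℕ) : ℝ) * ((realHermite i).eval x * (realHermite j).eval x *
            normalDensity x) := by
        intro x; simp [mul_assoc]
      simp only [this]
      rw [integral_const_mul, ih]
      by_cases h : i = j
      · simp [h, Nat.factorial_succ]
      · simp [h]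

/-! ### The truncated Gram matrix of the Hermite polynomials -/

/-- The matrix with entries `∫_{x ≤ s} He_i He_j φ / i!`, whose determinant is the common value of
all the distribution functions considered. -/
noncomputable def truncatedGram (n : ℕ) (s : ℝ) : Matrix (Fin n) (Fin n) ℝ :=
  Matrix.of fun i j => (∫ x in Set.Iic s,
    (realHermite i).eval x * ((realHermite j).eval x * normalDensity x)) / ((i : ℕ).factorial : ℝ)

/-- Row operations replace the powers `x ^ i` by polynomials `P i` of degree at most `i`. -/
theorem det_integral_eval_mul {n : ℕ} (μ : Measure ℝ) (P : Fin n → Polynomial ℝ)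
    (hP : ∀ i, (P i).natDegree ≤ i) (ψ : Fin n → ℝ → ℝ)
    (hψ : ∀ (k : ℕ) j, Integrable (fun x => x ^ k * ψ j x) μ) :
    (Matrix.of fun i j => ∫ x, (P i).eval x * ψ j x ∂μ).det =
      (∏ i : Fin n, (P i).coeff i) *
        (Matrix.of fun i j : Fin n => ∫ x, x ^ (i : ℕ) * ψ j x ∂μ).det := by
  have h : (Matrix.of fun i j => ∫ x, (P i).eval x * ψ j x ∂μ) =
      (Matrix.of fun i k : Fin n => (P i).coeff k) *
        (Matrix.of fun i j : Fin n => ∫ x, x ^ (i : ℕ) * ψ j x ∂μ) := by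
    ext i j
    rw [Matrix.mul_apply]
    simp only [Matrix.of_apply]
    have : ∀ x, (P i).eval x * ψ j x = ∑ k : Fin n, (P i).coeff k * (x ^ (k : ℕ) * ψ j x) := by
      intro x
      rw [Polynomial.eval_eq_sum_range' (n := n) ((hP i).trans_lt i.2), Finset.sum_mul,
        ← Fin.sum_univ_eq_sum_range (fun k => (P i).coeff k * x ^ k * ψ j x)]
      simp [mul_assoc]
    simp only [this]
    rw [integral_finsetSum]
    · simp only [integral_const_mul]
    · intro k _
      exact (hψ k j).const_mul _
  rw [h, Matrix.det_mul]
  congr 1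
  rw [Matrix.det_of_isLowerTriangular]
  · rfl
  · intro i k hik
    exact Polynomial.coeff_eq_zero_of_natDegree_lt ((hP i).trans_lt hik)

theorem integrable_pow_mul_realHermite (k j : ℕ) (s : Set ℝ) :
    Integrable (fun x => x ^ k * ((realHermite j).eval x * normalDensity x))
      (volume.restrict s) := by
  have := (integrable_eval_mul_normalDensity (Polynomial.X ^ k * realHermite j)).restrict (s := s)
  simpa [mul_assoc] using this

theorem det_truncatedGram_eq_moments (n : ℕ) (s : ℝ) :
    (truncatedGram n s).det =
      (∏ i : Fin n, ((i : ℕ).factorial : ℝ)⁻¹) *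
        (Matrix.of fun i j : Fin n => ∫ x in Set.Iic s,
          x ^ (i : ℕ) * ((realHermite j).eval x * normalDensity x)).det := by
  have h : truncatedGram n s = Matrix.of fun i j : Fin n => ((i : ℕ).factorial : ℝ)⁻¹ *
      (Matrix.of fun i j : Fin n => ∫ x in Set.Iic s,
        (realHermite i).eval x * ((realHermite j).eval x * normalDensity x)) i j := by
    ext i j
    simp [truncatedGram, div_eq_inv_mul]
  rw [h, Matrix.det_mul_column (fun i : Fin n => ((i : ℕ).factorial : ℝ)⁻¹),
    det_integral_eval_mul _ (fun i : Fin n => realHermite i)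
    (fun i => natDegree_realHermite_le i)
    (fun (j : Fin n) x => (realHermite j).eval x * normalDensity x)
    (fun k j => integrable_pow_mul_realHermite k j _)]
  simp [coeff_realHermite_self]

/-- The truncated Gram determinant as a Hankel determinant of Gaussian moments; this is the form in
which it arises from the eigenvalue density. -/
theorem det_truncatedGram_eq_hankel (n : ℕ) (s : ℝ) :
    (truncatedGram n s).det =
      (∏ i : Fin n, ((i : ℕ).factorial : ℝ)⁻¹) *
        (Matrix.of fun i j : Fin n => ∫ x in Set.Iic s,
          x ^ (i : ℕ) * (x ^ (j : ℕ) * normalDensity x)).det := by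
  rw [det_truncatedGram_eq_moments]
  congr 1
  rw [← Matrix.det_transpose]
  have h := det_integral_eval_mul (volume.restrict (Set.Iic s)) (fun i : Fin n => realHermite i)
    (fun i => natDegree_realHermite_le i) (fun (j : Fin n) x => x ^ (j : ℕ) * normalDensity x) ?_
  · simp only [coeff_realHermite_self, Finset.prod_const_one, one_mul] at h
    rw [← h]
    congr 1
    ext i j
    simp only [Matrix.transpose_apply, Matrix.of_apply]
    congr 1
    ext x
    ring
  · intro k j
    simpa [pow_add, mul_assoc] using
      (integrable_pow_mul_normalDensity (k + j)).restrict (s := Set.Iic s)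

/-- The truncated Gram determinant in terms of the repeated integrals and derivatives of the
Gaussian distribution function. -/
theorem det_truncatedGram_eq_sub_pow (n : ℕ) (s : ℝ) :
    (truncatedGram n s).det =
      (Matrix.of fun i j : Fin n => ∫ x in Set.Iic s,
        (s - x) ^ (i : ℕ) / ((i : ℕ).factorial : ℝ) *
          ((-1) ^ (j : ℕ) * (realHermite j).eval x * normalDensity x)).det := by
  have hdeg : ∀ i : Fin n, ((Polynomial.C s - Polynomial.X) ^ (i : ℕ)).natDegree ≤ (i : ℕ) := by
    intro i
    refine Polynomial.natDegree_pow_le.trans ?_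
    have : (Polynomial.C s - Polynomial.X).natDegree ≤ 1 := by compute_degree
    nlinarith
  have hcoeff : ∀ i : Fin n,
      ((Polynomial.C s - Polynomial.X) ^ (i : ℕ)).coeff (i : ℕ) = (-1) ^ (i : ℕ) := by
    intro i
    have h1 : (Polynomial.C s - Polynomial.X).natDegree ≤ 1 := by compute_degree
    have := Polynomial.coeff_pow_of_natDegree_le (m := (i : ℕ)) h1
    simpa using this
  have h := det_integral_eval_mul (volume.restrict (Set.Iic s))
    (fun i : Fin n => (Polynomial.C s - Polynomial.X) ^ (i : ℕ)) hdeg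
    (fun (j : Fin n) x => (realHermite j).eval x * normalDensity x)
    (fun k j => integrable_pow_mul_realHermite k j _)
  simp only [hcoeff] at h
  have h2 : (Matrix.of fun i j : Fin n => ∫ x in Set.Iic s,
        (s - x) ^ (i : ℕ) / ((i : ℕ).factorial : ℝ) *
          ((-1) ^ (j : ℕ) * (realHermite j).eval x * normalDensity x)) =
      Matrix.of fun i j : Fin n => ((i : ℕ).factorial : ℝ)⁻¹ * (Matrix.of fun i j : Fin n =>
        (-1) ^ (j : ℕ) * (Matrix.of fun i j : Fin n => ∫ x in Set.Iic s,
          ((Polynomial.C s - Polynomial.X) ^ (i : ℕ)).eval x *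
            ((realHermite j).eval x * normalDensity x)) i j) i j := by
    ext i j
    simp only [Matrix.of_apply]
    rw [← integral_const_mul, ← integral_const_mul]
    congr 1
    ext x
    simp only [Polynomial.eval_pow, Polynomial.eval_sub, Polynomial.eval_C, Polynomial.eval_X]
    ring
  rw [h2, Matrix.det_mul_column, Matrix.det_mul_row, h, det_truncatedGram_eq_moments,
    ← mul_assoc (∏ i : Fin n, (-1 : ℝ) ^ (i : ℕ)), ← Finset.prod_mul_distrib]
  simp [← mul_pow]

/-- The truncated Gram determinant in terms of the complementary half-line, by orthogonality of the
Hermite polynomials; this is the form in which it arises from the Hermite kernel. -/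
theorem det_truncatedGram_eq_one_sub (n : ℕ) (s : ℝ) :
    (truncatedGram n s).det =
      (1 - Matrix.of fun i j : Fin n => (∫ x in Set.Ioi s,
        (realHermite i).eval x * (realHermite j).eval x * normalDensity x) /
          ((i : ℕ).factorial : ℝ)).det := by
  congr 1
  ext i j
  have hint : Integrable fun x => (realHermite i).eval x * (realHermite j).eval x *
      normalDensity x := by
    simpa using integrable_eval_mul_normalDensity (realHermite i * realHermite j)
  have h := integral_add_compl (measurableSet_Iic (a := s)) hint
  rw [Set.compl_Iic, integral_realHermite_mul_realHermite] at h
  simp only [truncatedGram, Matrix.of_apply, Matrix.sub_apply, ← mul_assoc]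
  rw [eq_sub_iff_add_eq, ← add_div, h, Matrix.one_apply]
  have hi : ((i : ℕ).factorial : ℝ) ≠ 0 := by positivity
  by_cases hij : i = j
  · subst hij
    simp [hi]
  · simp [hij, Fin.val_injective.ne hij]

/-! ### The Hermite kernel -/

theorem oscillator_eq (k : ℕ) (y : ℝ) :
    oscillator k y = (realHermite k).eval (√2 * y) * Real.exp (-y ^ 2 / 2) /
      √((k.factorial : ℝ) * √Real.pi) := by
  unfold oscillator physHermite
  rw [aeval_hermite, mul_assoc ((2 : ℝ) ^ k), Real.sqrt_mul (by positivity),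
    Real.sqrt_eq_rpow (2 ^ k), ← Real.rpow_natCast 2 k, ← Real.rpow_mul (by norm_num),
    mul_comm (k : ℝ), Real.rpow_mul (by norm_num), Real.rpow_natCast, ← Real.sqrt_eq_rpow]
  have : √2 ^ k ≠ 0 := by positivity
  field_simp

theorem oscillator_mul_oscillator (i j : ℕ) (y : ℝ) :
    oscillator i y * oscillator j y =
      (√(i.factorial : ℝ) * √(j.factorial : ℝ))⁻¹ * (√2 * ((realHermite i).eval (√2 * y) *
        (realHermite j).eval (√2 * y) * normalDensity (√2 * y))) := by
  rw [oscillator_eq, oscillator_eq, normalDensity, Real.sqrt_mul (by positivity),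
    Real.sqrt_mul (by positivity), Real.sqrt_mul (by positivity), mul_pow,
    Real.sq_sqrt (by norm_num)]
  have h1 : Real.exp (-(2 * y ^ 2 / 2)) = Real.exp (-y ^ 2 / 2) * Real.exp (-y ^ 2 / 2) := by
    rw [← Real.exp_add]; ring_nf
  rw [h1]
  have h2 : √(√Real.pi) * √(√Real.pi) = √Real.pi := Real.mul_self_sqrt (by positivity)
  have h3 : √(√Real.pi) ≠ 0 := by positivity
  have h4 : √(i.factorial : ℝ) ≠ 0 := by positivity
  have h5 : √(j.factorial : ℝ) ≠ 0 := by positivity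
  have h6 : √(2 : ℝ) ≠ 0 := by positivity
  generalize √(√Real.pi) = a at *
  rw [← h2]
  field_simp

theorem integrable_oscillator_mul_oscillator (i j : ℕ) :
    Integrable fun y => oscillator i y * oscillator j y := by
  simp only [oscillator_mul_oscillator]
  have hint : Integrable fun x => (realHermite i).eval x * (realHermite j).eval x *
      normalDensity x := by
    simpa using integrable_eval_mul_normalDensity (realHermite i * realHermite j)
  exact ((hint.comp_mul_left' (by positivity : √(2 : ℝ) ≠ 0)).const_mul _).const_mul _

theorem integral_oscillator_mul_oscillator (i j : ℕ) (s : ℝ) :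
    ∫ y in Set.Ioi (s / √2), oscillator i y * oscillator j y =
      (√(i.factorial : ℝ) * √(j.factorial : ℝ))⁻¹ * ∫ x in Set.Ioi s,
        (realHermite i).eval x * (realHermite j).eval x * normalDensity x := by
  simp only [oscillator_mul_oscillator]
  rw [integral_const_mul, integral_const_mul,
    integral_comp_mul_left_Ioi (fun x => (realHermite i).eval x * (realHermite j).eval x *
      normalDensity x) _ (by positivity : (0 : ℝ) < √2), mul_div_cancel₀ _ (by positivity)]
  simp

theorem hermiteKernel_eq_sum_fin (n : ℕ) :
    hermiteKernel n = fun a b => ∑ l : Fin n, oscillator l a * oscillator l b := by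
  funext a b
  rw [hermiteKernel, Fin.sum_univ_eq_sum_range (fun l => oscillator l a * oscillator l b)]

theorem fredholmConverges_hermiteKernel (n : ℕ) (s : ℝ) :
    FredholmConverges (volume.restrict (Set.Ioi s)) (hermiteKernel n) := by
  rw [hermiteKernel_eq_sum_fin]
  exact fredholmConverges_finite_rank _ (fun l : Fin n => oscillator l)
    fun i j => (integrable_oscillator_mul_oscillator i j).restrict

theorem fredholmDet_hermiteKernel (n : ℕ) (s : ℝ) :
    fredholmDet (volume.restrict (Set.Ioi (s / √2))) (hermiteKernel n) =
      (truncatedGram n s).det := by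
  rw [hermiteKernel_eq_sum_fin, fredholmDet_finite_rank _ (fun l : Fin n => oscillator l)
    fun i j => (integrable_oscillator_mul_oscillator i j).restrict, det_truncatedGram_eq_one_sub]
  simp only [integral_oscillator_mul_oscillator]
  -- the two matrices are conjugate by the diagonal matrix with entries `√(i!)`
  have hne : ∀ i : Fin n, √((i : ℕ).factorial : ℝ) ≠ 0 := fun i => by positivity
  have hpr : (∏ i : Fin n, √((i : ℕ).factorial : ℝ)) ≠ 0 :=
    Finset.prod_ne_zero_iff.2 fun i _ => hne i
  refine mul_left_cancel₀ hpr ?_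
  rw [← Matrix.det_mul_row, ← Matrix.det_mul_column]
  congr 1
  ext i j
  have hsq : √((i : ℕ).factorial : ℝ) * √((i : ℕ).factorial : ℝ) = ((i : ℕ).factorial : ℝ) :=
    Real.mul_self_sqrt (by positivity)
  simp only [Matrix.of_apply, Matrix.sub_apply, Matrix.one_apply]
  have h1 := hne i
  have h2 := hne j
  by_cases hij : i = j
  · subst hij
    generalize √((i : ℕ).factorial : ℝ) = a at *
    rw [← hsq]
    simp only [if_true]
    field_simp
  · simp only [hij, if_false, zero_sub, mul_neg]
    generalize √((i : ℕ).factorial : ℝ) = a at *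
    rw [← hsq]
    field_simp

/-! ### Bordered Hermitian matrices -/

section Border

variable {n : ℕ}

/-- The coordinates of the diagonal matrix with diagonal `d`. -/
def diagonalCoords (d : Fin n → ℝ) : Fin n × Fin n → ℝ := fun z => if z.1 = z.2 then d z.1 else 0

theorem gueMatrix_diagonalCoords (d : Fin n → ℝ) :
    gueMatrix (diagonalCoords d) = Matrix.diagonal fun i => (d i : ℂ) := by
  ext i j
  by_cases h : i = j
  · subst h; simp [gueMatrix, diagonalCoords]
  · by_cases h' : i < j <;> simp [gueMatrix, diagonalCoords, h, h', Ne.symm h]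

/-- The coordinates of the matrix obtained from the one with coordinates `g` by adding the last
column `(u + i w) / √2` and the corner `a`. -/
def border (g : Fin n × Fin n → ℝ) (v : (Fin n → ℝ) × (Fin n → ℝ)) (a : ℝ) :
    Fin (n + 1) × Fin (n + 1) → ℝ := fun z =>
  Fin.lastCases (motive := fun _ => ℝ) (Fin.lastCases (motive := fun _ => ℝ) a v.2 z.2)
    (fun i => Fin.lastCases (motive := fun _ => ℝ) (v.1 i) (fun j => g (i, j)) z.2) z.1

@[simp] theorem border_castSucc_castSucc (g : Fin n × Fin n → ℝ) (v) (a : ℝ) (i j : Fin n) :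
    border g v a (i.castSucc, j.castSucc) = g (i, j) := by simp [border]

@[simp] theorem border_castSucc_last (g : Fin n × Fin n → ℝ) (v) (a : ℝ) (i : Fin n) :
    border g v a (i.castSucc, Fin.last n) = v.1 i := by simp [border]

@[simp] theorem border_last_castSucc (g : Fin n × Fin n → ℝ) (v) (a : ℝ) (j : Fin n) :
    border g v a (Fin.last n, j.castSucc) = v.2 j := by simp [border]

@[simp] theorem border_last_last (g : Fin n × Fin n → ℝ) (v) (a : ℝ) :
    border g v a (Fin.last n, Fin.last n) = a := by simp [border]

/-- The complex vector with real and imaginary parts `v.1 / √2` and `v.2 / √2`. -/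
noncomputable def borderVec (v : (Fin n → ℝ) × (Fin n → ℝ)) : Fin n → ℂ := fun i =>
  ((v.1 i : ℂ) + Complex.I * (v.2 i : ℂ)) / (√2 : ℝ)

theorem normSq_borderVec (v : (Fin n → ℝ) × (Fin n → ℝ)) (i : Fin n) :
    Complex.normSq (borderVec v i) = (v.1 i ^ 2 + v.2 i ^ 2) / 2 := by
  rw [borderVec, Complex.normSq_div, Complex.normSq_ofReal, Real.mul_self_sqrt (by norm_num)]
  simp [Complex.normSq_apply]
  ring

/-- The bordered matrix in block form. -/
noncomputable def blockBorder (B : Matrix (Fin n) (Fin n) ℂ) (v : Fin n → ℂ) (a : ℝ) :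
    Matrix (Fin n ⊕ Fin 1) (Fin n ⊕ Fin 1) ℂ :=
  Matrix.fromBlocks B (Matrix.of fun i _ => v i) (Matrix.of fun _ j => star (v j))
    (Matrix.of fun _ _ => (a : ℂ))

theorem gueMatrix_border (g : Fin n × Fin n → ℝ) (v) (a : ℝ) :
    gueMatrix (border g v a) =
      Matrix.reindex finSumFinEquiv finSumFinEquiv (blockBorder (gueMatrix g) (borderVec v) a) := by
  have hc : ∀ i : Fin n, i.castSucc ≠ Fin.last n := fun i => (Fin.castSucc_lt_last i).ne
  have e1 : ∀ i : Fin n, finSumFinEquiv.symm i.castSucc = (Sum.inl i : Fin n ⊕ Fin 1) := fun i =>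
    finSumFinEquiv_symm_apply_castAdd i
  have e2 : finSumFinEquiv.symm (Fin.last n) = (Sum.inr 0 : Fin n ⊕ Fin 1) :=
    finSumFinEquiv_symm_last
  ext i j
  induction i using Fin.lastCases with
  | last =>
    induction j using Fin.lastCases with
    | last => simp [gueMatrix, blockBorder, e2]
    | cast j =>
      have h2 : ¬ Fin.last n < j.castSucc := not_lt.2 (Fin.le_last _)
      simp [gueMatrix, blockBorder, e1, e2, (hc j).symm, h2, borderVec, sub_eq_add_neg]
  | cast i =>
    induction j using Fin.lastCases with
    | last =>
      simp [gueMatrix, blockBorder, e1, e2, hc i, Fin.castSucc_lt_last, borderVec]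
    | cast j => simp [gueMatrix, blockBorder, e1, Fin.castSucc_inj]

theorem charpoly_gueMatrix_border (g : Fin n × Fin n → ℝ) (v) (a : ℝ) :
    (gueMatrix (border g v a)).charpoly =
      (blockBorder (gueMatrix g) (borderVec v) a).charpoly := by
  rw [gueMatrix_border, Matrix.charpoly_reindex]

/-- Conjugation of the old block by a unitary matrix rotates the border. -/
theorem charpoly_blockBorder_conj (U B : Matrix (Fin n) (Fin n) ℂ) (hU : star U * U = 1)
    (v : Fin n → ℂ) (a : ℝ) :
    (blockBorder (U * B * star U) (U.mulVec v) a).charpoly = (blockBorder B v a).charpoly := by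
  have hmul : ∀ (A : Matrix (Fin n) (Fin n) ℂ) (w : Fin n → ℂ),
      A * (Matrix.of fun i (_ : Fin 1) => w i) = Matrix.of fun i (_ : Fin 1) => (A.mulVec w) i := by
    intro A w; ext i j; simp [Matrix.mul_apply, Matrix.mulVec, dotProduct]
  have hmul' : ∀ (A : Matrix (Fin n) (Fin n) ℂ) (w : Fin n → ℂ),
      (Matrix.of fun (_ : Fin 1) j => star (w j)) * star A =
        Matrix.of fun (_ : Fin 1) j => star ((A.mulVec w) j) := by
    intro A w; ext i j
    simp [Matrix.mul_apply, Matrix.mulVec, dotProduct, mul_comm]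
  have h : blockBorder (U * B * star U) (U.mulVec v) a =
      Matrix.fromBlocks U 0 0 1 * (blockBorder B v a * Matrix.fromBlocks (star U) 0 0 1) := by
    rw [blockBorder, blockBorder, Matrix.fromBlocks_multiply, Matrix.fromBlocks_multiply]
    simp only [hmul, hmul', mul_assoc, Matrix.zero_mul, Matrix.mul_zero, Matrix.mul_one,
      Matrix.one_mul, add_zero, zero_add]
  rw [h, Matrix.charpoly_mul_comm, mul_assoc, Matrix.fromBlocks_multiply]
  simp [hU]

open Polynomial in
/-- The characteristic polynomial of the diagonal matrix `d`, bordered by a vector whose entries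
have squared absolute values `r i`, with corner `a`. -/
noncomputable def secularPoly (d r : Fin n → ℝ) (a : ℝ) : ℝ[X] :=
  (X - C a) * ∏ i, (X - C (d i)) - ∑ i, C (r i) * ∏ k ∈ Finset.univ.erase i, (X - C (d k))

theorem eval_secularPoly (d r : Fin n → ℝ) (a z : ℝ) :
    (secularPoly d r a).eval z = (z - a) * ∏ i, (z - d i) -
      ∑ i, r i * ∏ k ∈ Finset.univ.erase i, (z - d k) := by
  simp [secularPoly, Polynomial.eval_prod, Polynomial.eval_finsetSum]

theorem charpoly_blockBorder_diagonal (d : Fin n → ℝ) (v : Fin n → ℂ) (a : ℝ) :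
    (blockBorder (Matrix.diagonal fun i => (d i : ℂ)) v a).charpoly =
      (secularPoly d (fun i => Complex.normSq (v i)) a).map Complex.ofRealHom := by
  refine Polynomial.eq_of_infinite_eval_eq _ _ ?_
  have hfin : (Set.range fun i => (d i : ℂ)).Finite := Set.finite_range _
  refine hfin.infinite_compl.mono fun z hz => ?_
  have hz' : ∀ i, z - (d i : ℂ) ≠ 0 := fun i h => hz ⟨i, (sub_eq_zero.1 h).symm⟩
  simp only [Set.mem_ofPred_eq]
  rw [Matrix.eval_charpoly]
  have h1 : Matrix.scalar (Fin n ⊕ Fin 1) z -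
      blockBorder (Matrix.diagonal fun i => (d i : ℂ)) v a =
      Matrix.fromBlocks (Matrix.diagonal fun i => z - (d i : ℂ)) (-(Matrix.of fun i _ => v i))
        (-(Matrix.of fun _ j => star (v j))) (Matrix.of fun _ _ => z - (a : ℂ)) := by
    ext i j
    rcases i with i | i <;> rcases j with j | j
    · by_cases hij : i = j
      · subst hij; simp [blockBorder]
      · simp [blockBorder, hij]
    · simp [blockBorder]
    · simp [blockBorder]
    · simp [blockBorder, Subsingleton.elim i j]
  have hinv : IsUnit (Matrix.diagonal fun i => z - (d i : ℂ)).det := by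
    rw [Matrix.det_diagonal, isUnit_iff_ne_zero]
    exact Finset.prod_ne_zero_iff.2 fun i _ => hz' i
  let _ : Invertible (Matrix.diagonal fun i => z - (d i : ℂ)) :=
    Matrix.invertibleOfIsUnitDet _ hinv
  have hinveq : ⅟(Matrix.diagonal fun i => z - (d i : ℂ)) =
      Matrix.diagonal fun i => (z - (d i : ℂ))⁻¹ := by
    refine invOf_eq_right_inv ?_
    rw [Matrix.diagonal_mul_diagonal]
    simp [hz']
  have h4 : ∀ i, star (v i) * v i = (Complex.normSq (v i) : ℂ) := fun i =>
    Complex.normSq_eq_conj_mul_self.symm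
  have h5 : -(Matrix.of fun (_ : Fin 1) j => star (v j)) *
      (Matrix.diagonal fun i => (z - (d i : ℂ))⁻¹) * -(Matrix.of fun i (_ : Fin 1) => v i) =
      Matrix.of fun _ _ => ∑ i, (Complex.normSq (v i) : ℂ) * (z - (d i : ℂ))⁻¹ := by
    ext i j
    rw [Matrix.mul_apply]
    simp only [Matrix.mul_diagonal, Matrix.neg_apply, Matrix.of_apply, ← h4]
    exact Finset.sum_congr rfl fun k _ => by ring
  rw [h1, Matrix.det_fromBlocks₁₁, hinveq, h5, Matrix.det_diagonal, Matrix.det_fin_one]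
  simp only [secularPoly, Polynomial.map_sub, Polynomial.map_mul, Polynomial.map_X,
    Polynomial.map_C, Polynomial.map_prod, Polynomial.map_sum, Polynomial.eval_sub,
    Polynomial.eval_mul, Polynomial.eval_prod, Polynomial.eval_X, Polynomial.eval_C,
    Polynomial.eval_finsetSum, Complex.ofRealHom_eq_coe, Matrix.sub_apply, Matrix.of_apply]
  rw [mul_sub, mul_comm _ (z - (a : ℂ)), Finset.mul_sum]
  congr 1
  refine Finset.sum_congr rfl fun i _ => ?_
  rw [← Finset.mul_prod_erase Finset.univ (fun i => z - (d i : ℂ)) (Finset.mem_univ i)]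
  have h3 := hz' i
  field_simp

theorem charpoly_border_diagonalCoords (d : Fin n → ℝ) (v) (a : ℝ) :
    (gueMatrix (border (diagonalCoords d) v a)).charpoly =
      (secularPoly d (fun i => (v.1 i ^ 2 + v.2 i ^ 2) / 2) a).map Complex.ofRealHom := by
  rw [charpoly_gueMatrix_border, gueMatrix_diagonalCoords, charpoly_blockBorder_diagonal]
  simp only [normSq_borderVec]

theorem charpoly_diagonalCoords (d : Fin n → ℝ) :
    (gueMatrix (diagonalCoords d)).charpoly =
      (∏ i, (Polynomial.X - Polynomial.C (d i))).map Complex.ofRealHom := by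
  rw [gueMatrix_diagonalCoords, Matrix.charpoly_diagonal]
  simp [Polynomial.map_prod]

/-- The coordinates are normalized such that `tr M² = ∑ g²`; this is a function of the
eigenvalues. -/
theorem sum_sq_eq_of_charpoly_eq {g g' : Fin n × Fin n → ℝ}
    (h : (gueMatrix g).charpoly = (gueMatrix g').charpoly) :
    ∑ z, g z ^ 2 = ∑ z, g' z ^ 2 := by
  have htr : ∀ g : Fin n × Fin n → ℝ,
      ((∑ z, g z ^ 2 : ℝ) : ℂ) = (gueMatrix g * gueMatrix g).trace := by
    intro g
    have hentry : ∀ i j : Fin n, gueMatrix g i j * gueMatrix g j i +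
        gueMatrix g j i * gueMatrix g i j = ((g (i, j) ^ 2 + g (j, i) ^ 2 : ℝ) : ℂ) := by
      have h2 : ((√2 : ℝ) : ℂ) * ((√2 : ℝ) : ℂ) = 2 := by
        rw [← Complex.ofReal_mul, Real.mul_self_sqrt (by norm_num)]; simp
      have h0 : ((√2 : ℝ) : ℂ) ≠ 0 := by
        intro h; rw [h] at h2; norm_num at h2
      intro i j
      rcases lt_trichotomy i j with h | h | h
      · simp only [gueMatrix, Matrix.of_apply, h.ne, h.ne', h, h.not_gt, if_true, if_false]
        push_cast
        rw [div_mul_div_comm, div_mul_div_comm, h2]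
        linear_combination (-((g (j, i) : ℂ)) ^ 2) * Complex.I_sq
      · subst h; simp [gueMatrix]; ring
      · simp only [gueMatrix, Matrix.of_apply, h.ne, h.ne', h, h.not_gt, if_true, if_false]
        push_cast
        rw [div_mul_div_comm, div_mul_div_comm, h2]
        linear_combination (-((g (i, j) : ℂ)) ^ 2) * Complex.I_sq
    have hsum : (gueMatrix g * gueMatrix g).trace =
        ∑ i, ∑ j, gueMatrix g i j * gueMatrix g j i := by
      simp [Matrix.trace, Matrix.mul_apply]
    have e1 : ∑ i, ∑ j, gueMatrix g i j * gueMatrix g j i =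
        ∑ i, ∑ j, gueMatrix g j i * gueMatrix g i j := Finset.sum_comm
    have e2 : ∑ i, ∑ j, ((g (i, j) : ℂ) ^ 2) = ∑ i, ∑ j, ((g (j, i) : ℂ) ^ 2) :=
      Finset.sum_comm
    have e3 : ∑ i, ∑ j, (gueMatrix g i j * gueMatrix g j i + gueMatrix g j i * gueMatrix g i j) =
        ∑ i, ∑ j, ((g (i, j) : ℂ) ^ 2 + (g (j, i) : ℂ) ^ 2) :=
      Finset.sum_congr rfl fun i _ => Finset.sum_congr rfl fun j _ => by
        rw [hentry]; push_cast; rfl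
    simp only [Finset.sum_add_distrib] at e3
    rw [← e1, ← e2] at e3
    rw [hsum, Fintype.sum_prod_type]
    push_cast
    linear_combination (-1 / 2 : ℂ) * e3
  have htr2 : ∀ g : Fin n × Fin n → ℝ, (gueMatrix g * gueMatrix g).trace =
      ∑ i, ((gueMatrix_isHermitian g).eigenvalues i : ℂ) ^ 2 := by
    intro g
    have hsp := (gueMatrix_isHermitian g).spectral_theorem
    set U := (gueMatrix_isHermitian g).eigenvectorUnitary with hU
    rw [Unitary.conjStarAlgAut_apply] at hsp
    set D := Matrix.diagonal (RCLike.ofReal ∘ (gueMatrix_isHermitian g).eigenvalues : Fin n → ℂ)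
    have hUU : (star U : Matrix (Fin n) (Fin n) ℂ) * (U : Matrix (Fin n) (Fin n) ℂ) = 1 :=
      Unitary.coe_star_mul_self U
    have hcongr : (gueMatrix g * gueMatrix g).trace =
        ((U : Matrix (Fin n) (Fin n) ℂ) * D * (star U : Matrix (Fin n) (Fin n) ℂ) *
        ((U : Matrix (Fin n) (Fin n) ℂ) * D * (star U : Matrix (Fin n) (Fin n) ℂ))).trace :=
      congrArg (fun A => (A * A).trace) hsp
    rw [hcongr]
    have : (U : Matrix (Fin n) (Fin n) ℂ) * D * (star U : Matrix (Fin n) (Fin n) ℂ) *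
        ((U : Matrix (Fin n) (Fin n) ℂ) * D * (star U : Matrix (Fin n) (Fin n) ℂ)) =
        (U : Matrix (Fin n) (Fin n) ℂ) * (D * D * (star U : Matrix (Fin n) (Fin n) ℂ)) := by
      simp only [mul_assoc]
      rw [← mul_assoc (star U : Matrix (Fin n) (Fin n) ℂ) (U : Matrix (Fin n) (Fin n) ℂ), hUU,
        one_mul]
    rw [this, Matrix.trace_mul_comm, mul_assoc, hUU, mul_one, Matrix.diagonal_mul_diagonal,
      Matrix.trace_diagonal]
    simp [sq]
  have heig := (Matrix.IsHermitian.eigenvalues_eq_eigenvalues_iff (gueMatrix_isHermitian g)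
    (gueMatrix_isHermitian g')).2 h
  have := htr g
  rw [htr2 g, heig, ← htr2 g', ← htr g'] at this
  exact_mod_cast this

end Border

/-! ### Interlacing sequences and secular equations -/

section Interlacing

open Polynomial in
theorem degree_sub_lt_of_monic_of_nextCoeff_eq {p q : ℝ[X]} {n : ℕ} (hp : p.Monic) (hq : q.Monic)
    (hpn : p.natDegree = n + 1) (hqn : q.natDegree = n + 1) (h : p.nextCoeff = q.nextCoeff) :
    (p - q).degree < n := by
  rw [degree_lt_iff_coeff_zero]
  intro m hm
  rw [coeff_sub, sub_eq_zero]
  rcases hm.eq_or_lt with rfl | hm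
  · rwa [nextCoeff_of_natDegree_pos (by omega), nextCoeff_of_natDegree_pos (by omega), hpn, hqn]
      at h
  · rcases (Nat.succ_le_of_lt hm).eq_or_lt with rfl | hm
    · have h1 := hp.coeff_natDegree
      have h2 := hq.coeff_natDegree
      rw [hpn] at h1
      rw [hqn] at h2
      rw [Nat.succ_eq_add_one, h1, h2]
    · rw [coeff_eq_zero_of_natDegree_lt (by omega), coeff_eq_zero_of_natDegree_lt (by omega)]

theorem exists_root_Ioo_of_mul_neg {f : ℝ → ℝ} (hf : Continuous f) {a b : ℝ} (hab : a < b)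
    (h : f a * f b < 0) : ∃ c ∈ Set.Ioo a b, f c = 0 := by
  rcases mul_neg_iff.1 h with ⟨h1, h2⟩ | ⟨h1, h2⟩
  · obtain ⟨c, hc, hc0⟩ := intermediate_value_Ioo' hab.le hf.continuousOn ⟨h2, h1⟩
    exact ⟨c, hc, hc0⟩
  · obtain ⟨c, hc, hc0⟩ := intermediate_value_Ioo hab.le hf.continuousOn ⟨h1, h2⟩
    exact ⟨c, hc, hc0⟩

variable {n : ℕ}

theorem vandermonde_det_pos {x : Fin n → ℝ} (hx : StrictMono x) :
    0 < (Matrix.vandermonde x).det := by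
  rw [Matrix.det_vandermonde]
  exact Finset.prod_pos fun i _ => Finset.prod_pos fun j hj =>
    sub_pos.2 (hx (Finset.mem_Ioi.1 hj))

theorem erase_eq_Iio_union_Ioi (i : Fin n) :
    Finset.univ.erase i = (Finset.Iio i).disjUnion (Finset.Ioi i)
      (Finset.disjoint_left.2 fun _ ha hb =>
        lt_asymm (Finset.mem_Iio.1 ha) (Finset.mem_Ioi.1 hb)) := by
  ext k
  simp [lt_or_lt_iff_ne]

/-- The discriminant is the square of the Vandermonde determinant. -/
theorem abs_prod_prod_erase_sub (x : Fin n → ℝ) :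
    |∏ i, ∏ k ∈ Finset.univ.erase i, (x i - x k)| = (Matrix.vandermonde x).det ^ 2 := by
  simp only [erase_eq_Iio_union_Ioi, Finset.prod_disjUnion, Finset.prod_mul_distrib, abs_mul]
  have h1 : |∏ i, ∏ k ∈ Finset.Ioi i, (x i - x k)| = |(Matrix.vandermonde x).det| := by
    rw [Matrix.det_vandermonde]
    simp only [Finset.abs_prod]
    exact Finset.prod_congr rfl fun i _ => Finset.prod_congr rfl fun k _ => abs_sub_comm _ _
  have h2 : |∏ i, ∏ k ∈ Finset.Iio i, (x i - x k)| = |(Matrix.vandermonde x).det| := by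
    rw [Matrix.det_vandermonde]
    congr 1
    refine Finset.prod_comm' fun a b => ?_
    simp
  rw [h1, h2, abs_mul_abs_self, sq]

theorem sign_prod_erase_sub {d : Fin n → ℝ} (hd : StrictMono d) (i : Fin n) :
    0 < (-1) ^ (n - 1 - (i : ℕ)) * ∏ k ∈ Finset.univ.erase i, (d i - d k) := by
  rw [erase_eq_Iio_union_Ioi, Finset.prod_disjUnion]
  have h1 : ∏ k ∈ Finset.Ioi i, (d i - d k) =
      (-1) ^ (n - 1 - (i : ℕ)) * ∏ k ∈ Finset.Ioi i, (d k - d i) := by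
    rw [← Fin.card_Ioi i, ← Finset.prod_const, ← Finset.prod_mul_distrib]
    exact Finset.prod_congr rfl fun k _ => by ring
  have h2 : 0 < ∏ k ∈ Finset.Ioi i, (d k - d i) :=
    Finset.prod_pos fun k hk => sub_pos.2 (hd (Finset.mem_Ioi.1 hk))
  have h3 : 0 < ∏ k ∈ Finset.Iio i, (d i - d k) :=
    Finset.prod_pos fun k hk => sub_pos.2 (hd (Finset.mem_Iio.1 hk))
  rw [h1, mul_left_comm, ← mul_assoc ((-1 : ℝ) ^ _) ((-1 : ℝ) ^ _), ← mul_pow]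
  simp only [mul_neg, mul_one, neg_neg, one_pow, one_mul]
  positivity

/-- The sequences `μ 0 < d 0 < μ 1 < d 1 < ⋯ < d (n - 1) < μ n` interlacing with `d`. -/
def interlacing (d : Fin n → ℝ) : Set (Fin (n + 1) → ℝ) :=
  {μ | ∀ i : Fin n, μ i.castSucc < d i ∧ d i < μ i.succ}

theorem interlacing.strictMono {d : Fin n → ℝ} {μ : Fin (n + 1) → ℝ} (h : μ ∈ interlacing d) :
    StrictMono μ :=
  Fin.strictMono_iff_lt_succ.2 fun i => (h i).1.trans (h i).2

theorem interlacing.strictMono_inner {d : Fin n → ℝ} {μ : Fin (n + 1) → ℝ}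
    (h : μ ∈ interlacing d) : StrictMono d := by
  intro i j hij
  have h1 : μ i.succ ≤ μ j.castSucc :=
    (interlacing.strictMono h).monotone (Fin.succ_le_castSucc_iff.2 hij)
  exact ((h i).2.trans_le h1).trans (h j).1

theorem measurableSet_interlacing (d : Fin n → ℝ) : MeasurableSet (interlacing d) := by
  have : interlacing d = ⋂ i : Fin n, {μ | μ i.castSucc < d i} ∩ {μ | d i < μ i.succ} := by
    ext μ; simp [interlacing]
  rw [this]
  exact MeasurableSet.iInter fun i =>
    (measurableSet_lt (measurable_pi_apply _) measurable_const).inter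
      (measurableSet_lt measurable_const (measurable_pi_apply _))

/-- The parameters `(r, a)` of the secular polynomial with nodes `d` and roots `μ`; the last
coordinate is `a`. -/
noncomputable def secularCoords (d : Fin n → ℝ) (μ : Fin (n + 1) → ℝ) : Fin (n + 1) → ℝ :=
  Fin.lastCases (motive := fun _ => ℝ) (∑ j, μ j - ∑ i, d i)
    (fun i => -(∏ j, (d i - μ j)) / ∏ k ∈ Finset.univ.erase i, (d i - d k))

@[simp] theorem secularCoords_last (d : Fin n → ℝ) (μ : Fin (n + 1) → ℝ) :
    secularCoords d μ (Fin.last n) = ∑ j, μ j - ∑ i, d i := by simp [secularCoords]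

@[simp] theorem secularCoords_castSucc (d : Fin n → ℝ) (μ : Fin (n + 1) → ℝ) (i : Fin n) :
    secularCoords d μ i.castSucc =
      -(∏ j, (d i - μ j)) / ∏ k ∈ Finset.univ.erase i, (d i - d k) := by simp [secularCoords]

theorem prod_erase_sub_ne_zero {d : Fin n → ℝ} (hd : Function.Injective d) (i : Fin n) :
    ∏ k ∈ Finset.univ.erase i, (d i - d k) ≠ 0 :=
  Finset.prod_ne_zero_iff.2 fun _ hk => sub_ne_zero.2 (hd.ne (Finset.ne_of_mem_erase hk).symm)

open Polynomial in
theorem degree_sum_secular_lt (d r : Fin n → ℝ) :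
    (∑ i, C (r i) * ∏ k ∈ Finset.univ.erase i, (X - C (d k))).degree < n := by
  refine (degree_sum_le _ _).trans_lt ((Finset.sup_lt_iff ?_).2 fun i _ => ?_)
  · exact WithBot.bot_lt_coe n
  · rw [← smul_eq_C_mul]
    refine (degree_smul_le _ _).trans_lt ?_
    rw [degree_prod_of_monic _ _ fun k _ => monic_X_sub_C _]
    simp only [degree_X_sub_C, Finset.sum_const, Finset.card_erase_of_mem (Finset.mem_univ i),
      Finset.card_univ, Fintype.card_fin, nsmul_eq_mul, mul_one]
    have := i.pos
    exact_mod_cast (by omega : n - 1 < n)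

open Polynomial in
/-- Both sides are monic with the same second coefficient, and agree at the nodes by Lagrange
interpolation. -/
theorem secularPoly_secularCoords {d : Fin n → ℝ} (hd : Function.Injective d)
    (μ : Fin (n + 1) → ℝ) :
    secularPoly d (fun i => secularCoords d μ i.castSucc) (secularCoords d μ (Fin.last n)) =
      ∏ j, (X - C (μ j)) := by
  refine eq_of_degree_sub_lt_of_eval_index_eq (Finset.univ : Finset (Fin n))
    (v := d) hd.injOn ?_ ?_
  · rw [Finset.card_univ, Fintype.card_fin, secularPoly, sub_right_comm]
    refine (degree_sub_le _ _).trans_lt (max_lt ?_ (degree_sum_secular_lt _ _))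
    have h1 : (X - C (secularCoords d μ (Fin.last n))) * ∏ i, (X - C (d i)) =
        ∏ j : Fin (n + 1), (X - C (Fin.cons (α := fun _ => ℝ) (secularCoords d μ (Fin.last n))
          d j)) := by
      rw [Fin.prod_univ_succ]
      simp
    rw [h1]
    refine degree_sub_lt_of_monic_of_nextCoeff_eq (monic_prod_of_monic _ _ fun j _ =>
      monic_X_sub_C _) (monic_prod_of_monic _ _ fun j _ => monic_X_sub_C _) ?_ ?_ ?_
    · rw [natDegree_finsetProd_X_sub_C_eq_card, Finset.card_univ, Fintype.card_fin]
    · rw [natDegree_finsetProd_X_sub_C_eq_card, Finset.card_univ, Fintype.card_fin]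
    · rw [prod_X_sub_C_nextCoeff, prod_X_sub_C_nextCoeff, Fin.sum_univ_succ]
      simp
  · intro i _
    rw [eval_secularPoly, eval_prod]
    have h0 : ∏ k, (d i - d k) = 0 := Finset.prod_eq_zero (Finset.mem_univ i) (sub_self _)
    have h1 : ∑ l, secularCoords d μ l.castSucc * ∏ k ∈ Finset.univ.erase l, (d i - d k) =
        secularCoords d μ i.castSucc * ∏ k ∈ Finset.univ.erase i, (d i - d k) := by
      refine Finset.sum_eq_single i (fun l _ hl => ?_) (fun h => absurd (Finset.mem_univ i) h)
      rw [Finset.prod_eq_zero (Finset.mem_erase.2 ⟨hl.symm, Finset.mem_univ i⟩) (sub_self _),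
        mul_zero]
    rw [h0, h1, secularCoords_castSucc, div_mul_cancel₀ _ (prod_erase_sub_ne_zero hd i)]
    simp

open Polynomial in
theorem strictMono_eq_of_prod_eq {m : ℕ} {μ ν : Fin m → ℝ} (hμ : StrictMono μ) (hν : StrictMono ν)
    (h : ∏ j, (X - C (μ j)) = ∏ j, (X - C (ν j))) : μ = ν := by
  refine (StrictMono.range_inj hμ hν).1 (Set.ext fun z => ?_)
  have key : ∀ ξ : Fin m → ℝ, z ∈ Set.range ξ ↔ (∏ j, (X - C (ξ j))).eval z = 0 := by
    intro ξ
    rw [eval_prod, Finset.prod_eq_zero_iff]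
    simp only [Set.mem_range, eval_sub, eval_X, eval_C, sub_eq_zero, Finset.mem_univ, true_and]
    exact exists_congr fun _ => eq_comm
  rw [key, key, h]

theorem injOn_secularCoords {d : Fin n → ℝ} (hd : Function.Injective d) :
    Set.InjOn (secularCoords d) (interlacing d) := by
  intro μ hμ ν hν h
  refine strictMono_eq_of_prod_eq (interlacing.strictMono hμ) (interlacing.strictMono hν) ?_
  rw [← secularPoly_secularCoords hd, ← secularPoly_secularCoords hd, h]

theorem secularCoords_castSucc_pos {d : Fin n → ℝ} {μ : Fin (n + 1) → ℝ} (h : μ ∈ interlacing d)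
    (i : Fin n) : 0 < secularCoords d μ i.castSucc := by
  have hd := interlacing.strictMono_inner h
  have hμ := interlacing.strictMono h
  rw [secularCoords_castSucc, Fin.prod_univ_succAbove _ i.castSucc,
    ← Finset.mul_prod_erase _ _ (Finset.mem_univ i), Fin.succAbove_castSucc_self]
  rw [← mul_assoc, neg_mul_eq_neg_mul, mul_div_assoc, ← Finset.prod_div_distrib]
  refine mul_pos ?_ (Finset.prod_pos fun k hk => ?_)
  · have h1 := (h i).1
    have h2 := (h i).2
    nlinarith
  · rcases lt_or_gt_of_ne (Finset.ne_of_mem_erase hk) with hki | hki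
    · rw [Fin.succAbove_of_castSucc_lt _ _ (Fin.castSucc_lt_castSucc_iff.2 hki)]
      have h1 := (h k).1
      have h2 := hd hki
      exact div_pos (by linarith) (by linarith)
    · rw [Fin.succAbove_of_le_castSucc _ _ (Fin.castSucc_le_castSucc_iff.2 hki.le)]
      have h1 := (h k).2
      have h2 := hd hki
      exact div_pos_of_neg_of_neg (by linarith) (by linarith)

open Polynomial in
theorem monic_secularPoly (d r : Fin n → ℝ) (a : ℝ) :
    (secularPoly d r a).Monic ∧ (secularPoly d r a).natDegree = n + 1 := by
  have hm : ((X - C a) * ∏ i, (X - C (d i))).Monic :=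
    (monic_X_sub_C a).mul (monic_prod_of_monic _ _ fun i _ => monic_X_sub_C _)
  have hdeg : ((X - C a) * ∏ i, (X - C (d i))).natDegree = n + 1 := by
    rw [(monic_X_sub_C a).natDegree_mul (monic_prod_of_monic _ _ fun i _ => monic_X_sub_C _),
      natDegree_prod_of_monic _ _ fun i _ => monic_X_sub_C _]
    simp [add_comm]
  have hlt : (∑ i, C (r i) * ∏ k ∈ Finset.univ.erase i, (X - C (d k))).degree <
      ((X - C a) * ∏ i, (X - C (d i))).degree := by
    rw [degree_eq_natDegree hm.ne_zero, hdeg]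
    exact (degree_sum_secular_lt d r).trans (by exact_mod_cast Nat.lt_succ_self n)
  refine ⟨hm.sub_of_left hlt, ?_⟩
  rw [← hdeg]
  exact natDegree_eq_of_degree_eq (degree_sub_eq_left_of_degree_lt hlt)

open Polynomial in
/-- A monic polynomial of degree `m` has the sign of `z ^ m` far out. -/
theorem exists_eval_pos_and_sign_eval_neg {p : ℝ[X]} {m : ℕ} (hp : p.Monic)
    (hm : p.natDegree = m + 1) (B : ℝ) :
    ∃ R > B, 0 < p.eval R ∧ 0 < (-1) ^ (m + 1) * p.eval (-R) := by
  have h1 : Tendsto (fun x => p.eval x) atTop atTop :=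
    p.tendsto_atTop_of_leadingCoeff_nonneg
      (natDegree_pos_iff_degree_pos.1 (by omega)) (by rw [hp.leadingCoeff]; norm_num)
  have h2 : Tendsto (fun x => (C ((-1) ^ (m + 1)) * p.comp (-X)).eval x) atTop atTop := by
    refine tendsto_atTop_of_leadingCoeff_nonneg _ ?_ ?_
    · refine natDegree_pos_iff_degree_pos.1 ?_
      rw [natDegree_C_mul (by positivity), natDegree_comp, natDegree_neg, natDegree_X]
      omega
    · rw [leadingCoeff_mul, leadingCoeff_C, leadingCoeff_comp (by simp), hp.leadingCoeff, hm,
        leadingCoeff_neg, leadingCoeff_X, one_mul, ← mul_pow]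
      norm_num
  obtain ⟨R, hR⟩ := ((eventually_gt_atTop B).and ((h1.eventually_gt_atTop 0).and
    (h2.eventually_gt_atTop 0))).exists
  refine ⟨R, hR.1, hR.2.1, ?_⟩
  simpa using hR.2.2

open Polynomial in
/-- The secular polynomial changes sign between consecutive nodes. -/
theorem exists_interlacing_secularCoords_eq {d : Fin n → ℝ} (hd : StrictMono d)
    {x : Fin (n + 1) → ℝ} (hx : ∀ i : Fin n, 0 < x i.castSucc) :
    ∃ μ ∈ interlacing d, secularCoords d μ = x := by
  set q := secularPoly d (fun i => x i.castSucc) (x (Fin.last n)) with hq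
  obtain ⟨hqm, hqd⟩ := monic_secularPoly d (fun i => x i.castSucc) (x (Fin.last n))
  obtain ⟨R, hRB, hR1, hR2⟩ := exists_eval_pos_and_sign_eval_neg hqm hqd (∑ i, |d i|)
  have hdR : ∀ i, |d i| < R := fun i =>
    (Finset.single_le_sum (f := fun i => |d i|) (fun i _ => abs_nonneg _)
      (Finset.mem_univ i)).trans_lt hRB
  have hR0 : 0 < R := (Finset.sum_nonneg fun i _ => abs_nonneg _).trans_lt hRB
  have hqi : ∀ i, q.eval (d i) = -(x i.castSucc * ∏ k ∈ Finset.univ.erase i, (d i - d k)) := by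
    intro i
    rw [hq, eval_secularPoly]
    have h0 : ∏ k, (d i - d k) = 0 := Finset.prod_eq_zero (Finset.mem_univ i) (sub_self _)
    have h1 : ∑ l : Fin n, x l.castSucc * ∏ k ∈ Finset.univ.erase l, (d i - d k) =
        x i.castSucc * ∏ k ∈ Finset.univ.erase i, (d i - d k) := by
      refine Finset.sum_eq_single i (fun l _ hl => ?_) (fun h => absurd (Finset.mem_univ i) h)
      rw [Finset.prod_eq_zero (Finset.mem_erase.2 ⟨hl.symm, Finset.mem_univ i⟩) (sub_self _),
        mul_zero]
    rw [h0, h1]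
    ring
  have hsgn : ∀ i : Fin n, 0 < (-1) ^ (n - (i : ℕ)) * q.eval (d i) := by
    intro i
    have h1 := mul_pos (hx i) (sign_prod_erase_sub hd i)
    rw [hqi, show n - (i : ℕ) = n - 1 - (i : ℕ) + 1 by have := i.2; omega, pow_succ]
    nlinarith
  -- the nodes, with a point beyond all the roots added on either side
  let e : Fin (n + 2) → ℝ := Fin.cons (α := fun _ => ℝ) (-R) (Fin.snoc (α := fun _ => ℝ) d R)
  have he0 : e 0 = -R := rfl
  have hes : ∀ i : Fin n, e i.castSucc.succ = d i := fun i => by simp [e]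
  have hes' : ∀ i : Fin n, e i.succ.castSucc = d i := fun i => by
    rw [← Fin.succ_castSucc]; exact hes i
  have hel : e (Fin.last (n + 1)) = R := by
    rw [← Fin.succ_last]; simp [e]
  have hesgn : ∀ j : Fin (n + 2), 0 < (-1) ^ (n + 1 - (j : ℕ)) * q.eval (e j) := by
    intro j
    induction j using Fin.cases with
    | zero => rw [he0]; simpa using hR2
    | succ j =>
      induction j using Fin.lastCases with
      | last =>
        rw [Fin.succ_last, hel]
        simpa using hR1
      | cast i =>
        rw [hes]
        have := hsgn i
        simpa using this
  have helt : ∀ j : Fin (n + 1), e j.castSucc < e j.succ := by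
    intro j
    induction j using Fin.cases with
    | zero =>
      rw [Fin.castSucc_zero, he0]
      rcases Nat.eq_zero_or_pos n with rfl | hn
      · have : e (Fin.succ 0) = R := hel
        rw [this]; linarith
      · have := hes ⟨0, hn⟩
        have h2 : (Fin.castSucc ⟨0, hn⟩ : Fin (n + 1)) = 0 := rfl
        rw [h2] at this
        rw [this]
        exact (abs_lt.1 (hdR _)).1
    | succ j =>
      rw [hes']
      rcases lt_or_eq_of_le (Nat.succ_le_of_lt j.2) with hj | hj
      · have h2 : (j.succ : Fin (n + 1)) = Fin.castSucc ⟨(j : ℕ) + 1, hj⟩ := rfl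
        rw [h2, hes]
        exact hd (Fin.mk_lt_mk.2 (Nat.lt_succ_self _) : j < ⟨(j : ℕ) + 1, hj⟩)
      · have h2 : (j.succ.succ : Fin (n + 2)) = Fin.last (n + 1) := by
          ext; simp; omega
        rw [h2, hel]
        exact (abs_lt.1 (hdR _)).2
  have hroot : ∀ j : Fin (n + 1), ∃ c ∈ Set.Ioo (e j.castSucc) (e j.succ), q.eval c = 0 := by
    intro j
    refine exists_root_Ioo_of_mul_neg q.continuous (helt j) ?_
    have h1 := hesgn j.castSucc
    have h2 := hesgn j.succ
    have h3 : n + 1 - ((j.castSucc : Fin (n + 2)) : ℕ) =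
        n + 1 - ((j.succ : Fin (n + 2)) : ℕ) + 1 := by
      simp only [Fin.val_castSucc, Fin.val_succ]; omega
    rw [h3, pow_succ] at h1
    have h4 := mul_pos h1 h2
    have h5 : ((-1 : ℝ) ^ (n + 1 - ((j.succ : Fin (n + 2)) : ℕ))) ^ 2 = 1 := by
      rw [← pow_mul, mul_comm, pow_mul]; norm_num
    nlinarith
  choose μ hμ hμ0 using hroot
  have hint : μ ∈ interlacing d := by
    intro i
    have h1 := (hμ i.castSucc).2
    have h2 := (hμ i.succ).1
    rw [hes] at h1
    rw [hes'] at h2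
    exact ⟨h1, h2⟩
  refine ⟨μ, hint, ?_⟩
  have hprod : q = ∏ j, (X - C (μ j)) := by
    have hmon : (∏ j, (X - C (μ j))).Monic := monic_prod_of_monic _ _ fun j _ => monic_X_sub_C (μ j)
    have hnd : (∏ j, (X - C (μ j))).natDegree = n + 1 := by
      rw [natDegree_finsetProd_X_sub_C_eq_card, Finset.card_univ, Fintype.card_fin]
    refine eq_of_degree_sub_lt_of_eval_index_eq (Finset.univ : Finset (Fin (n + 1))) (v := μ)
      (interlacing.strictMono hint).injective.injOn ?_ ?_
    · rw [Finset.card_univ, Fintype.card_fin]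
      have := degree_sub_lt_left (p := q) (q := ∏ j, (X - C (μ j)))
        (by rw [degree_eq_natDegree hqm.ne_zero, degree_eq_natDegree hmon.ne_zero, hnd, hqd])
        hqm.ne_zero (by rw [hqm.leadingCoeff, hmon.leadingCoeff])
      rwa [degree_eq_natDegree hqm.ne_zero, hqd] at this
    · intro j _
      rw [hμ0, eval_prod]
      exact (Finset.prod_eq_zero (Finset.mem_univ j) (by simp)).symm
  -- the parameters are determined by the secular polynomial
  have hval : ∀ i : Fin n, secularCoords d μ i.castSucc = x i.castSucc := by
    intro i
    rw [secularCoords_castSucc, div_eq_iff (prod_erase_sub_ne_zero hd.injective i)]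
    have h1 := hqi i
    rw [hprod, eval_prod] at h1
    simp only [eval_sub, eval_X, eval_C] at h1
    rw [h1, neg_neg]
  have hlast : secularCoords d μ (Fin.last n) = x (Fin.last n) := by
    have h1 : secularPoly d (fun i => x i.castSucc) (secularCoords d μ (Fin.last n)) =
        secularPoly d (fun i => x i.castSucc) (x (Fin.last n)) := by
      have h2 := secularPoly_secularCoords hd.injective μ
      simp only [hval] at h2
      rw [h2, ← hprod]
    have h3 := congrArg (fun p => p.eval R) h1
    simp only [eval_secularPoly] at h3
    have h4 : ∏ i, (R - d i) ≠ 0 := Finset.prod_ne_zero_iff.2 fun i _ =>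
      (sub_pos.2 (abs_lt.1 (hdR i)).2).ne'
    have h5 := mul_right_cancel₀ h4 (sub_left_injective h3)
    linarith
  funext j
  induction j using Fin.lastCases with
  | last => exact hlast
  | cast i => exact hval i

/-- The interlacing sequences correspond exactly to the positive weights `r` and arbitrary `a`. -/
theorem image_secularCoords {d : Fin n → ℝ} (hd : StrictMono d) :
    secularCoords d '' interlacing d = {x | ∀ i : Fin n, 0 < x i.castSucc} := by
  ext x
  constructor
  · rintro ⟨μ, hμ, rfl⟩ i
    exact secularCoords_castSucc_pos hμ i
  · intro hx
    exact exists_interlacing_secularCoords_eq hd hx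

end Interlacing

/-! ### The Jacobian of the secular parameters -/

section Jacobian

variable {n : ℕ}

/-- The Jacobian matrix of `secularCoords d`. -/
noncomputable def secularJacobian (d : Fin n → ℝ) (μ : Fin (n + 1) → ℝ) :
    Matrix (Fin (n + 1)) (Fin (n + 1)) ℝ :=
  Matrix.of fun i j => Fin.lastCases (motive := fun _ => ℝ) 1
    (fun i => (∏ l ∈ Finset.univ.erase j, (d i - μ l)) /
      ∏ k ∈ Finset.univ.erase i, (d i - d k)) i

theorem hasFDerivAt_secularCoords (d : Fin n → ℝ) (μ : Fin (n + 1) → ℝ) :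
    HasFDerivAt (secularCoords d)
      (LinearMap.toContinuousLinearMap (Matrix.toLin' (secularJacobian d μ))) μ := by
  rw [hasFDerivAt_pi']
  intro i
  induction i using Fin.lastCases with
  | last =>
    simp only [secularCoords_last]
    have h : HasFDerivAt (fun μ : Fin (n + 1) → ℝ => ∑ j, μ j - ∑ i, d i)
        (∑ j, ContinuousLinearMap.proj (R := ℝ) (φ := fun _ : Fin (n + 1) => ℝ) j) μ :=
      (HasFDerivAt.fun_sum fun j _ => hasFDerivAt_apply j μ).sub_const _
    refine h.congr_fderiv ?_
    ext v
    simp [secularJacobian, Matrix.toLin'_apply, Matrix.mulVec, dotProduct]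
  | cast i =>
    simp only [secularCoords_castSucc, div_eq_mul_inv]
    have h := ((HasFDerivAt.finsetProd (u := (Finset.univ : Finset (Fin (n + 1))))
      (g := fun j (μ : Fin (n + 1) → ℝ) => d i - μ j) (x := μ)
      fun j _ => ((ContinuousLinearMap.proj (R := ℝ)
        (φ := fun _ : Fin (n + 1) => ℝ) j).hasFDerivAt (x := μ)).const_sub (d i)).neg).mul_const
        (∏ k ∈ Finset.univ.erase i, (d i - d k))⁻¹
    refine h.congr_fderiv ?_
    ext v
    simp [secularJacobian, Matrix.toLin'_apply, Matrix.mulVec, dotProduct, div_eq_mul_inv,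
      Finset.mul_sum]
    ring_nf

open Polynomial in
/-- The rows of the Jacobian matrix are evaluations of the polynomials `∏ l ≠ j, (X - μ l)` at the
nodes `d`, so that it factors through the matrix of their coefficients; the latter is evaluated by
a second factorization at the nodes `μ`. -/
theorem abs_det_secularJacobian {d : Fin n → ℝ} {μ : Fin (n + 1) → ℝ} (hd : StrictMono d)
    (hμ : StrictMono μ) :
    |(secularJacobian d μ).det| = (Matrix.vandermonde μ).det / (Matrix.vandermonde d).det := by
  have hDd := vandermonde_det_pos hd
  have hDμ := vandermonde_det_pos hμ
  let L : Fin (n + 1) → ℝ[X] := fun j => ∏ l ∈ Finset.univ.erase j, (X - C (μ l))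
  have hLdeg : ∀ j, (L j).natDegree = n := fun j => by
    simp only [L]
    rw [natDegree_finsetProd_X_sub_C_eq_card, Finset.card_erase_of_mem (Finset.mem_univ j)]
    simp
  have hLmon : ∀ j, (L j).Monic := fun j => monic_prod_X_sub_C _ _
  have hLeval : ∀ j z, (L j).eval z = ∏ l ∈ Finset.univ.erase j, (z - μ l) := fun j z => by
    simp [L, eval_prod]
  have hLsum : ∀ j z, (L j).eval z = ∑ k : Fin (n + 1), z ^ (k : ℕ) * (L j).coeff k := by
    intro j z
    rw [eval_eq_sum_range' (n := n + 1) (by rw [hLdeg]; omega),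
      ← Fin.sum_univ_eq_sum_range (fun k => (L j).coeff k * z ^ k)]
    simp [mul_comm]
  -- the coefficients of the Lagrange polynomials of the nodes `μ`
  let c : Matrix (Fin (n + 1)) (Fin (n + 1)) ℝ := Matrix.of fun k j => (L j).coeff k
  have hc : Matrix.vandermonde μ * c = Matrix.diagonal fun j => (L j).eval (μ j) := by
    ext i j
    rw [Matrix.mul_apply]
    have := hLsum j (μ i)
    simp only [c, Matrix.of_apply, Matrix.vandermonde_apply, ← this]
    by_cases hij : i = j
    · subst hij; simp
    · rw [Matrix.diagonal_apply_ne _ hij, hLeval]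
      exact Finset.prod_eq_zero (Finset.mem_erase.2 ⟨hij, Finset.mem_univ i⟩) (sub_self _)
  have hcdet : |c.det| = (Matrix.vandermonde μ).det := by
    have h1 := congrArg (fun A => |Matrix.det A|) hc
    simp only [Matrix.det_mul, Matrix.det_diagonal, abs_mul, hLeval,
      abs_prod_prod_erase_sub, abs_of_pos hDμ] at h1
    exact mul_left_cancel₀ hDμ.ne' (by rw [h1, sq])
  -- the Jacobian matrix factors into row scalings `w`, evaluation at the nodes `d`, and `c`
  let w : Fin (n + 1) → ℝ := Fin.lastCases (motive := fun _ => ℝ) 1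
    (fun i => (∏ k ∈ Finset.univ.erase i, (d i - d k))⁻¹)
  let V : Matrix (Fin (n + 1)) (Fin (n + 1)) ℝ := Matrix.of fun i k =>
    Fin.lastCases (motive := fun _ => ℝ) (if k = Fin.last n then 1 else 0)
      (fun i => d i ^ (k : ℕ)) i
  have hfac : secularJacobian d μ = Matrix.of fun i j => w i * (V * c) i j := by
    ext i j
    simp only [Matrix.of_apply, Matrix.mul_apply]
    induction i using Fin.lastCases with
    | last =>
      have := (hLmon j).coeff_natDegree
      rw [hLdeg] at this
      simp [secularJacobian, w, V, c, this]
    | cast i =>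
      have := hLsum j (d i)
      rw [hLeval] at this
      simp [secularJacobian, w, V, c, ← this, div_eq_inv_mul]
  have hV : V.det = (Matrix.vandermonde d).det := by
    rw [Matrix.det_succ_row _ (Fin.last n), Finset.sum_eq_single (Fin.last n)]
    · have h1 : V (Fin.last n) (Fin.last n) = 1 := by simp [V]
      have h2 : V.submatrix (Fin.last n).succAbove (Fin.last n).succAbove =
          Matrix.vandermonde d := by
        ext i k
        simp [V, Matrix.vandermonde_apply]
      rw [h1, h2]
      simp [← two_mul]
    · intro k _ hk
      have h1 : V (Fin.last n) k = 0 := by simp [V, hk]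
      rw [h1]; simp
    · intro h; exact absurd (Finset.mem_univ _) h
  have hw : |∏ i, w i| = ((Matrix.vandermonde d).det ^ 2)⁻¹ := by
    rw [Fin.prod_univ_castSucc]
    simp only [w, Fin.lastCases_castSucc, Fin.lastCases_last, mul_one, Finset.prod_inv_distrib,
      abs_inv]
    rw [abs_prod_prod_erase_sub]
  rw [hfac, Matrix.det_mul_column, Matrix.det_mul, abs_mul, abs_mul, hw, hcdet, hV,
    abs_of_pos hDd]
  field_simp

theorem lintegral_secularCoords {d : Fin n → ℝ} (hd : StrictMono d)
    (f : (Fin (n + 1) → ℝ) → ENNReal) :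
    ∫⁻ x in {x : Fin (n + 1) → ℝ | ∀ i : Fin n, 0 < x i.castSucc}, f x =
      ∫⁻ μ in interlacing d, ENNReal.ofReal ((Matrix.vandermonde μ).det /
        (Matrix.vandermonde d).det) * f (secularCoords d μ) := by
  rw [← image_secularCoords hd, lintegral_image_eq_lintegral_abs_det_fderiv_mul volume
    (measurableSet_interlacing d) (fun μ _ => (hasFDerivAt_secularCoords d μ).hasFDerivWithinAt)
    (injOn_secularCoords hd.injective)]
  refine setLIntegral_congr_fun (measurableSet_interlacing d) fun μ hμ => ?_
  rw [ContinuousLinearMap.det, LinearMap.coe_toContinuousLinearMap, LinearMap.det_toLin',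
    abs_det_secularJacobian hd (interlacing.strictMono hμ)]

/-! ### Integrating the Vandermonde determinant over an interlacing box -/

/-- Subtraction of consecutive rows of a Vandermonde matrix. -/
theorem det_pow_succ_sub_pow_succ (μ : Fin (n + 1) → ℝ) :
    (Matrix.of fun i j : Fin n => μ i.succ ^ ((j : ℕ) + 1) - μ i.castSucc ^ ((j : ℕ) + 1)).det =
      (Matrix.vandermonde μ).det := by
  let A : Matrix (Fin (n + 1)) (Fin (n + 1)) ℝ := Matrix.of fun i j =>
    Fin.cases (motive := fun _ => ℝ) (μ 0 ^ (j : ℕ))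
      (fun i => μ i.succ ^ (j : ℕ) - μ i.castSucc ^ (j : ℕ)) i
  have h1 : (Matrix.vandermonde μ).det = A.det := by
    refine Matrix.det_eq_of_forall_row_eq_smul_add_pred (fun _ => 1) ?_ ?_
    · intro j; simp [A, Matrix.vandermonde_apply]
    · intro i j; simp [A, Matrix.vandermonde_apply]
  rw [h1, Matrix.det_succ_column_zero, Fin.sum_univ_succ]
  have h2 : ∀ i : Fin n, A i.succ 0 = 0 := fun i => by simp [A]
  have h3 : A 0 0 = 1 := by simp [A]
  simp only [h2, h3]
  simp only [Fin.val_zero, pow_zero, mul_one, one_mul, mul_zero, zero_mul, Finset.sum_const_zero,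
    add_zero]
  congr 1

/-- The sequences `d` interlacing with `μ` form a box, over which the Vandermonde determinant is
integrated columnwise. -/
theorem lintegral_vandermonde_interlacing {μ : Fin (n + 1) → ℝ} (hμ : StrictMono μ) :
    ∫⁻ d in {d : Fin n → ℝ | μ ∈ interlacing d}, ENNReal.ofReal (Matrix.vandermonde d).det =
      ENNReal.ofReal ((Matrix.vandermonde μ).det / (n.factorial : ℝ)) := by
  have hset : {d : Fin n → ℝ | μ ∈ interlacing d} =
      Set.univ.pi fun i : Fin n => Set.Ioo (μ i.castSucc) (μ i.succ) := by
    ext d; simp [interlacing]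
  have hmeas : MeasurableSet {d : Fin n → ℝ | μ ∈ interlacing d} := by
    rw [hset]; exact MeasurableSet.univ_pi fun i => measurableSet_Ioo
  have hint : ∀ i j : Fin n, Integrable (fun x : ℝ => x ^ (i : ℕ))
      (volume.restrict (Set.Ioo (μ j.castSucc) (μ j.succ))) := fun i j =>
    ((continuous_pow _).continuousOn.integrableOn_Icc).mono_set Set.Ioo_subset_Icc_self
  have hdet : ∀ d : Fin n → ℝ, (Matrix.vandermonde d).det =
      (Matrix.of fun i j : Fin n => d j ^ (i : ℕ)).det := fun d =>
    (Matrix.det_transpose _).symm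
  have hvol : (volume : Measure (Fin n → ℝ)).restrict {d : Fin n → ℝ | μ ∈ interlacing d} =
      Measure.pi fun i : Fin n => volume.restrict (Set.Ioo (μ i.castSucc) (μ i.succ)) := by
    rw [hset, volume_pi, Measure.restrict_pi_pi]
  rw [← ofReal_integral_eq_lintegral_ofReal]
  · congr 1
    rw [hvol]
    simp only [hdet]
    rw [integral_det_columns _ (fun (i _ : Fin n) x => x ^ (i : ℕ)) hint]
    have hval : ∀ i j : Fin n, ∫ x in Set.Ioo (μ j.castSucc) (μ j.succ), x ^ (i : ℕ) =
        ((i : ℕ) + 1 : ℝ)⁻¹ * (μ j.succ ^ ((i : ℕ) + 1) - μ j.castSucc ^ ((i : ℕ) + 1)) := by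
      intro i j
      rw [← integral_Ioc_eq_integral_Ioo, ← intervalIntegral.integral_of_le
        (hμ.monotone (Fin.castSucc_le_succ j)), integral_pow]
      ring
    simp only [hval]
    have hcol := Matrix.det_mul_column (fun i : Fin n => ((i : ℕ) + 1 : ℝ)⁻¹)
      (Matrix.of fun i j : Fin n => μ j.succ ^ ((i : ℕ) + 1) - μ j.castSucc ^ ((i : ℕ) + 1))
    simp only [Matrix.of_apply] at hcol
    rw [hcol, ← Matrix.det_transpose, div_eq_inv_mul]
    congr 1
    · rw [Finset.prod_inv_distrib, Fin.prod_univ_eq_prod_range (fun i : ℕ => (i + 1 : ℝ)) n,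
        ← Finset.prod_range_add_one_eq_factorial]
      push_cast
      rfl
    · rw [← det_pow_succ_sub_pow_succ]
      rfl
  · rw [hvol]
    simp only [hdet]
    exact integrable_det_columns _ (fun (i _ : Fin n) x => x ^ (i : ℕ)) hint
  · filter_upwards [ae_restrict_mem hmeas] with d hd
    exact (vandermonde_det_pos (interlacing.strictMono_inner hd)).le

end Jacobian

/-! ### Lebesgue measure on Hermitian matrices under bordering -/

section BorderMeasure

variable {n : ℕ}

theorem measurable_border :
    Measurable fun p : (Fin n × Fin n → ℝ) × (((Fin n → ℝ) × (Fin n → ℝ)) × ℝ) =>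
      border p.1 p.2.1 p.2.2 := by
  rw [measurable_pi_iff]
  rintro ⟨i, j⟩
  induction i using Fin.lastCases with
  | last =>
    induction j using Fin.lastCases with
    | last => simp only [border_last_last]; fun_prop
    | cast j => simp only [border_last_castSucc]; fun_prop
  | cast i =>
    induction j using Fin.lastCases with
    | last => simp only [border_castSucc_last]; fun_prop
    | cast j => simp only [border_castSucc_castSucc]; fun_prop

/-- Bordering only rearranges the coordinates. -/
theorem measurePreserving_border :
    MeasurePreserving
      (fun p : (Fin n × Fin n → ℝ) × (((Fin n → ℝ) × (Fin n → ℝ)) × ℝ) =>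
        border p.1 p.2.1 p.2.2) volume volume := by
  refine ⟨measurable_border, (Measure.pi_eq fun s hs => ?_).symm⟩
  rw [Measure.map_apply measurable_border (MeasurableSet.univ_pi hs)]
  have hpre : (fun p : (Fin n × Fin n → ℝ) × (((Fin n → ℝ) × (Fin n → ℝ)) × ℝ) =>
      border p.1 p.2.1 p.2.2) ⁻¹' (Set.univ.pi s) =
      (Set.univ.pi fun z : Fin n × Fin n => s (z.1.castSucc, z.2.castSucc)) ×ˢ
        (((Set.univ.pi fun i : Fin n => s (i.castSucc, Fin.last n)) ×ˢ
          (Set.univ.pi fun i : Fin n => s (Fin.last n, i.castSucc))) ×ˢ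
            s (Fin.last n, Fin.last n)) := by
    ext p
    simp only [Set.mem_preimage, Set.mem_univ_pi, Set.mem_prod, Prod.forall]
    constructor
    · intro h
      exact ⟨fun i j => by simpa using h i.castSucc j.castSucc,
        ⟨fun i => by simpa using h i.castSucc (Fin.last n),
          fun i => by simpa using h (Fin.last n) i.castSucc⟩,
        by simpa using h (Fin.last n) (Fin.last n)⟩
    · rintro ⟨h1, ⟨h2, h3⟩, h4⟩ i j
      induction i using Fin.lastCases with
      | last =>
        induction j using Fin.lastCases with
        | last => simpa using h4
        | cast j => simpa using h3 j
      | cast i =>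
        induction j using Fin.lastCases with
        | last => simpa using h2 i
        | cast j => simpa using h1 i j
  rw [hpre, Measure.volume_eq_prod, Measure.prod_prod, Measure.volume_eq_prod, Measure.prod_prod,
    Measure.volume_eq_prod, Measure.prod_prod, volume_pi_pi, volume_pi_pi, volume_pi_pi,
    Fintype.prod_prod_type, Fintype.prod_prod_type, Fin.prod_univ_castSucc]
  simp only [Fin.prod_univ_castSucc, Finset.prod_mul_distrib]
  ring

theorem lintegral_border {F : (Fin (n + 1) × Fin (n + 1) → ℝ) → ENNReal} (hF : Measurable F) :
    ∫⁻ g, F g = ∫⁻ g : Fin n × Fin n → ℝ, ∫⁻ v : (Fin n → ℝ) × (Fin n → ℝ), ∫⁻ a : ℝ,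
      F (border g v a) := by
  have hm : Measurable fun p : (Fin n × Fin n → ℝ) × (((Fin n → ℝ) × (Fin n → ℝ)) × ℝ) =>
      F (border p.1 p.2.1 p.2.2) := hF.comp measurable_border
  rw [← measurePreserving_border.lintegral_comp hF, Measure.volume_eq_prod,
    lintegral_prod _ hm.aemeasurable]
  refine lintegral_congr fun g => ?_
  have hg : Measurable fun q : ((Fin n → ℝ) × (Fin n → ℝ)) × ℝ => F (border g q.1 q.2) :=
    hm.comp measurable_prodMk_left
  rw [Measure.volume_eq_prod, lintegral_prod _ hg.aemeasurable]

/-! ### Rotations of the border -/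

/-- The real linear map given by a complex matrix, in terms of real and imaginary parts. -/
noncomputable def rotateBorder (U : Matrix (Fin n) (Fin n) ℂ) :
    ((Fin n → ℝ) × (Fin n → ℝ)) →ₗ[ℝ] ((Fin n → ℝ) × (Fin n → ℝ)) where
  toFun v := (fun i => ∑ j, ((U i j).re * v.1 j - (U i j).im * v.2 j),
    fun i => ∑ j, ((U i j).re * v.2 j + (U i j).im * v.1 j))
  map_add' v w := by
    ext i <;> simp only [Prod.fst_add, Prod.snd_add, Pi.add_apply, ← Finset.sum_add_distrib] <;>
      exact Finset.sum_congr rfl fun j _ => by ring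
  map_smul' c v := by
    ext i <;> simp only [Prod.smul_fst, Prod.smul_snd, Pi.smul_apply, smul_eq_mul,
      Finset.mul_sum, RingHom.id_apply] <;>
      exact Finset.sum_congr rfl fun j _ => by ring

theorem borderVec_rotateBorder (U : Matrix (Fin n) (Fin n) ℂ) (v) :
    borderVec (rotateBorder U v) = U.mulVec (borderVec v) := by
  ext i
  simp only [borderVec, rotateBorder, LinearMap.coe_mk, AddHom.coe_mk, Matrix.mulVec, dotProduct,
    mul_div_assoc', ← Finset.sum_div]
  congr 1
  push_cast
  rw [Finset.mul_sum, ← Finset.sum_add_distrib]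
  refine Finset.sum_congr rfl fun j _ => ?_
  apply Complex.ext <;> simp

theorem sum_sq_rotateBorder {U : Matrix (Fin n) (Fin n) ℂ} (hU : star U * U = 1) (v) :
    ∑ i, ((rotateBorder U v).1 i ^ 2 + (rotateBorder U v).2 i ^ 2) =
      ∑ i, (v.1 i ^ 2 + v.2 i ^ 2) := by
  have h1 : ∀ w : (Fin n → ℝ) × (Fin n → ℝ), ((∑ i, (w.1 i ^ 2 + w.2 i ^ 2) : ℝ) : ℂ) =
      2 * dotProduct (star (borderVec w)) (borderVec w) := by
    intro w
    rw [dotProduct, Finset.mul_sum]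
    push_cast
    refine Finset.sum_congr rfl fun i _ => ?_
    have h2 : star (borderVec w) i * borderVec w i = (Complex.normSq (borderVec w i) : ℂ) :=
      Complex.normSq_eq_conj_mul_self.symm
    rw [h2, normSq_borderVec]
    push_cast
    ring
  have h3 := h1 (rotateBorder U v)
  rw [borderVec_rotateBorder, Matrix.star_mulVec, Matrix.dotProduct_mulVec, Matrix.vecMul_vecMul,
    ← Matrix.star_eq_conjTranspose, hU, Matrix.vecMul_one, ← h1] at h3
  exact_mod_cast h3

theorem measurePreserving_rotateBorder {U : Matrix (Fin n) (Fin n) ℂ} (hU : star U * U = 1) :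
    MeasurePreserving (rotateBorder U) volume volume := by
  let e := MeasurableEquiv.sumPiEquivProdPi (fun _ : Fin n ⊕ Fin n => ℝ)
  let T : EuclideanSpace ℝ (Fin n ⊕ Fin n) →ₗ[ℝ] EuclideanSpace ℝ (Fin n ⊕ Fin n) :=
    (WithLp.linearEquiv 2 ℝ (Fin n ⊕ Fin n → ℝ)).symm.toLinearMap ∘ₗ
      (LinearEquiv.sumArrowLequivProdArrow (Fin n) (Fin n) ℝ ℝ).symm.toLinearMap ∘ₗ
      rotateBorder U ∘ₗ (LinearEquiv.sumArrowLequivProdArrow (Fin n) (Fin n) ℝ ℝ).toLinearMap ∘ₗ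
      (WithLp.linearEquiv 2 ℝ (Fin n ⊕ Fin n → ℝ)).toLinearMap
  let T' : EuclideanSpace ℝ (Fin n ⊕ Fin n) →ₗᵢ[ℝ] EuclideanSpace ℝ (Fin n ⊕ Fin n) :=
    { T with
      norm_map' := by
        intro x
        rw [← sq_eq_sq₀ (norm_nonneg _) (norm_nonneg _), EuclideanSpace.real_norm_sq_eq,
          EuclideanSpace.real_norm_sq_eq, Fintype.sum_sum_type, Fintype.sum_sum_type,
          ← Finset.sum_add_distrib, ← Finset.sum_add_distrib]
        exact sum_sq_rotateBorder hU (fun i => x (Sum.inl i), fun i => x (Sum.inr i)) }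
  have hT := (T'.toLinearIsometryEquiv rfl).measurePreserving
  have h1 := (PiLp.volume_preserving_ofLp (Fin n ⊕ Fin n)).comp
    (hT.comp (PiLp.volume_preserving_toLp (Fin n ⊕ Fin n)))
  have h2 := (volume_measurePreserving_sumPiEquivProdPi (fun _ : Fin n ⊕ Fin n => ℝ)).comp
    (h1.comp (volume_measurePreserving_sumPiEquivProdPi_symm (fun _ : Fin n ⊕ Fin n => ℝ)))
  exact h2

/-! ### Squared absolute values of the border -/

theorem lintegral_half_sum_sq {f : ℝ → ENNReal} (hf : Measurable f) :
    ∫⁻ p : ℝ × ℝ, f ((p.1 ^ 2 + p.2 ^ 2) / 2) =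
      ENNReal.ofReal (2 * Real.pi) * ∫⁻ r in Set.Ioi 0, f r := by
  have h1 : ∫⁻ r in Set.Ioi (0 : ℝ), f r =
      ∫⁻ ρ in Set.Ioi (0 : ℝ), ENNReal.ofReal ρ * f (ρ ^ 2 / 2) := by
    have himg : (fun ρ : ℝ => ρ ^ 2 / 2) '' Set.Ioi 0 = Set.Ioi 0 := by
      ext r
      simp only [Set.mem_image, Set.mem_Ioi]
      constructor
      · rintro ⟨ρ, hρ, rfl⟩; positivity
      · intro hr
        refine ⟨√(2 * r), by positivity, ?_⟩
        rw [Real.sq_sqrt (by positivity)]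
        ring
    have hinj : Set.InjOn (fun ρ : ℝ => ρ ^ 2 / 2) (Set.Ioi 0) := by
      intro a ha b hb hab
      simp only at hab
      exact (sq_eq_sq₀ (le_of_lt ha) (le_of_lt hb)).1 (by linarith)
    have hder : ∀ ρ ∈ Set.Ioi (0 : ℝ),
        HasDerivWithinAt (fun ρ : ℝ => ρ ^ 2 / 2) ρ (Set.Ioi 0) ρ := fun ρ _ =>
      (((hasDerivAt_pow 2 ρ).div_const 2).congr_deriv (by simp)).hasDerivWithinAt
    conv_lhs => rw [← himg]
    rw [lintegral_image_eq_lintegral_abs_deriv_mul measurableSet_Ioi hder hinj]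
    refine setLIntegral_congr_fun measurableSet_Ioi fun ρ hρ => ?_
    rw [abs_of_pos hρ]
  have htar : polarCoord.target = Set.Ioi (0 : ℝ) ×ˢ Set.Ioo (-Real.pi) Real.pi := rfl
  rw [← lintegral_comp_polarCoord_symm, htar, Measure.volume_eq_prod, ← Measure.prod_restrict]
  have h2 : ∀ p : ℝ × ℝ, ENNReal.ofReal p.1 •
      f (((polarCoord.symm p).1 ^ 2 + (polarCoord.symm p).2 ^ 2) / 2) =
      ENNReal.ofReal p.1 * f (p.1 ^ 2 / 2) := by
    intro p
    rw [smul_eq_mul]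
    congr 2
    simp only [polarCoord_symm_apply, mul_pow, ← mul_add, Real.cos_sq_add_sin_sq, mul_one]
  simp only [h2]
  rw [lintegral_prod _ (by fun_prop), h1]
  simp only [lintegral_const, Measure.restrict_apply MeasurableSet.univ, Set.univ_inter,
    Real.volume_Ioo]
  rw [lintegral_mul_const _ (by fun_prop), mul_comm]
  congr 2
  ring

theorem map_half_sum_sq :
    Measure.map (fun p : ℝ × ℝ => (p.1 ^ 2 + p.2 ^ 2) / 2) volume =
      (2 * Real.pi).toNNReal • (volume.restrict (Set.Ioi 0)) := by
  have hm : Measurable fun p : ℝ × ℝ => (p.1 ^ 2 + p.2 ^ 2) / 2 := by fun_prop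
  refine Measure.ext_of_lintegral _ fun f hf => ?_
  rw [lintegral_map hf hm, lintegral_half_sum_sq hf]
  rw [lintegral_smul_measure]
  rfl

theorem lintegral_border_half_sum_sq {f : (Fin n → ℝ) → ENNReal} (hf : Measurable f) :
    ∫⁻ v : (Fin n → ℝ) × (Fin n → ℝ), f (fun i => (v.1 i ^ 2 + v.2 i ^ 2) / 2) =
      ENNReal.ofReal (2 * Real.pi) ^ n * ∫⁻ r in {r : Fin n → ℝ | ∀ i, 0 < r i}, f r := by
  have hm : Measurable fun p : ℝ × ℝ => (p.1 ^ 2 + p.2 ^ 2) / 2 := by fun_prop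
  have hm2 : Measurable fun (p : Fin n → ℝ × ℝ) (i : Fin n) =>
      ((p i).1 ^ 2 + (p i).2 ^ 2) / 2 := by fun_prop
  have hm3 : Measurable fun v : (Fin n → ℝ) × (Fin n → ℝ) =>
      f (fun i => (v.1 i ^ 2 + v.2 i ^ 2) / 2) := hf.comp (by fun_prop)
  rw [← (volume_measurePreserving_arrowProdEquivProdArrow ℝ ℝ (Fin n)).lintegral_comp hm3]
  have hpi : Measure.map (fun (p : Fin n → ℝ × ℝ) (i : Fin n) =>
      ((p i).1 ^ 2 + (p i).2 ^ 2) / 2) volume =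
      ENNReal.ofReal (2 * Real.pi) ^ n • volume.restrict {r : Fin n → ℝ | ∀ i, 0 < r i} := by
    have hset : {r : Fin n → ℝ | ∀ i, 0 < r i} = Set.univ.pi fun _ => Set.Ioi 0 := by
      ext r; simp
    have : ∀ _ : Fin n, SigmaFinite (Measure.map (fun p : ℝ × ℝ => (p.1 ^ 2 + p.2 ^ 2) / 2)
        volume) := by
      intro _
      rw [map_half_sum_sq]
      infer_instance
    rw [volume_pi, Measure.pi_map_pi (hμ := this) (fun _ => hm.aemeasurable), hset, volume_pi,
      Measure.restrict_pi_pi]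
    simp only [map_half_sum_sq]
    refine Measure.pi_eq fun s hs => ?_
    rw [Measure.smul_apply, Measure.pi_pi, smul_eq_mul]
    simp only [Measure.smul_apply, ENNReal.smul_def, smul_eq_mul,
      Finset.prod_mul_distrib, Finset.prod_const, Finset.card_univ, Fintype.card_fin]
    rfl
  have h3 := lintegral_map hf hm2 (μ := volume)
  rw [hpi, lintegral_smul_measure] at h3
  rw [← smul_eq_mul, h3]
  rfl

end BorderMeasure

/-! ### The eigenvalue density of Hermitian matrices -/

section EigenvalueDensity

variable {n : ℕ}

theorem measurableSet_strictMono : MeasurableSet {μ : Fin n → ℝ | StrictMono μ} := by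
  have : {μ : Fin n → ℝ | StrictMono μ} = ⋂ i, ⋂ j, ⋂ (_ : i < j), {μ | μ i < μ j} := by
    ext μ; simp [StrictMono]
  rw [this]
  exact MeasurableSet.iInter fun i => MeasurableSet.iInter fun j => MeasurableSet.iInter fun _ =>
    measurableSet_lt (measurable_pi_apply i) (measurable_pi_apply j)

theorem continuous_vandermonde_det :
    Continuous fun μ : Fin n → ℝ => (Matrix.vandermonde μ).det := by
  simp only [Matrix.det_vandermonde]
  fun_prop

theorem measurable_diagonalCoords : Measurable (diagonalCoords : (Fin n → ℝ) → _) := by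
  rw [measurable_pi_iff]
  intro z
  unfold diagonalCoords
  split_ifs <;> fun_prop

/-- The normalizing constant of the eigenvalue density with respect to Lebesgue measure. -/
noncomputable def weylConst (n : ℕ) : ℝ :=
  ∏ k ∈ Finset.range n, (2 * Real.pi) ^ k / (k.factorial : ℝ)

/-- By invariance under rotation, averaging over the border depends on the eigenvalues of the old
block only. -/
theorem lintegral_border_eq_diagonal {F : (Fin (n + 1) × Fin (n + 1) → ℝ) → ENNReal}
    (hF : Measurable F)
    (hinv : ∀ g g', (gueMatrix g).charpoly = (gueMatrix g').charpoly → F g = F g')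
    (g : Fin n × Fin n → ℝ) :
    ∫⁻ v : (Fin n → ℝ) × (Fin n → ℝ), ∫⁻ a : ℝ, F (border g v a) =
      ∫⁻ v : (Fin n → ℝ) × (Fin n → ℝ), ∫⁻ a : ℝ,
        F (border (diagonalCoords (gueMatrix_isHermitian g).eigenvalues) v a) := by
  set d := (gueMatrix_isHermitian g).eigenvalues with hd
  set U : Matrix (Fin n) (Fin n) ℂ := ((gueMatrix_isHermitian g).eigenvectorUnitary :
    Matrix (Fin n) (Fin n) ℂ) with hU
  have hUU : star U * U = 1 := Unitary.coe_star_mul_self _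
  have hsp : gueMatrix g = U * (Matrix.diagonal fun i => (d i : ℂ)) * star U := by
    have h := (gueMatrix_isHermitian g).spectral_theorem
    rw [Unitary.conjStarAlgAut_apply] at h
    exact h
  have hm : Measurable fun p : (Fin n × Fin n → ℝ) × (((Fin n → ℝ) × (Fin n → ℝ)) × ℝ) =>
      F (border p.1 p.2.1 p.2.2) := hF.comp measurable_border
  have hg : Measurable fun q : ((Fin n → ℝ) × (Fin n → ℝ)) × ℝ => F (border g q.1 q.2) :=
    hm.comp measurable_prodMk_left
  rw [← (measurePreserving_rotateBorder hUU).lintegral_comp hg.lintegral_prod_right']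
  refine lintegral_congr fun v => lintegral_congr fun a => hinv _ _ ?_
  rw [charpoly_gueMatrix_border, charpoly_gueMatrix_border, borderVec_rotateBorder,
    gueMatrix_diagonalCoords, hsp, charpoly_blockBorder_conj _ _ hUU]

/-- The change of variables from the border of a diagonal matrix to the eigenvalues of the bordered
matrix. -/
theorem lintegral_border_diagonalCoords {F : (Fin (n + 1) × Fin (n + 1) → ℝ) → ENNReal}
    (hF : Measurable F)
    (hinv : ∀ g g', (gueMatrix g).charpoly = (gueMatrix g').charpoly → F g = F g')
    {d : Fin n → ℝ} (hd : StrictMono d) :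
    ∫⁻ v : (Fin n → ℝ) × (Fin n → ℝ), ∫⁻ a : ℝ, F (border (diagonalCoords d) v a) =
      ENNReal.ofReal (2 * Real.pi) ^ n * ∫⁻ μ in interlacing d,
        ENNReal.ofReal ((Matrix.vandermonde μ).det / (Matrix.vandermonde d).det) *
          F (diagonalCoords μ) := by
  let G : ℝ × (Fin n → ℝ) → ENNReal := fun q =>
    F (border (diagonalCoords d) (fun i => √(2 * q.2 i), 0) q.1)
  have hm : Measurable fun p : (Fin n × Fin n → ℝ) × (((Fin n → ℝ) × (Fin n → ℝ)) × ℝ) =>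
      F (border p.1 p.2.1 p.2.2) := hF.comp measurable_border
  have hG : Measurable G := by
    have : Measurable fun q : ℝ × (Fin n → ℝ) =>
        ((diagonalCoords d, ((fun i => √(2 * q.2 i), 0), q.1)) :
          (Fin n × Fin n → ℝ) × (((Fin n → ℝ) × (Fin n → ℝ)) × ℝ)) := by fun_prop
    exact hm.comp this
  have h1 : ∀ (v : (Fin n → ℝ) × (Fin n → ℝ)) (a : ℝ), F (border (diagonalCoords d) v a) =
      G (a, fun i => (v.1 i ^ 2 + v.2 i ^ 2) / 2) := by
    intro v a
    refine hinv _ _ ?_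
    rw [charpoly_border_diagonalCoords, charpoly_border_diagonalCoords]
    congr 2
    funext i
    simp only [Pi.zero_apply]
    rw [Real.sq_sqrt (by positivity)]
    ring
  simp only [h1]
  have hG' : Measurable fun r : Fin n → ℝ => ∫⁻ a : ℝ, G (a, r) := hG.lintegral_prod_left'
  rw [lintegral_border_half_sum_sq hG']
  congr 1
  have hset : MeasurableSet {r : Fin n → ℝ | ∀ i, 0 < r i} := by
    have : {r : Fin n → ℝ | ∀ i, 0 < r i} = Set.univ.pi fun _ => Set.Ioi 0 := by ext r; simp
    rw [this]; exact MeasurableSet.univ_pi fun _ => measurableSet_Ioi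
  have hset' : MeasurableSet {x : Fin (n + 1) → ℝ | ∀ i : Fin n, 0 < x i.castSucc} := by
    have : {x : Fin (n + 1) → ℝ | ∀ i : Fin n, 0 < x i.castSucc} =
        ⋂ i : Fin n, {x | 0 < x i.castSucc} := by ext r; simp
    rw [this]
    exact MeasurableSet.iInter fun i => measurableSet_lt measurable_const (measurable_pi_apply _)
  have h2 : ∫⁻ r in {r : Fin n → ℝ | ∀ i, 0 < r i}, ∫⁻ a : ℝ, G (a, r) =
      ∫⁻ x in {x : Fin (n + 1) → ℝ | ∀ i : Fin n, 0 < x i.castSucc},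
        G (x (Fin.last n), fun i => x i.castSucc) := by
    have hmp := volume_preserving_piFinSuccAbove (fun _ : Fin (n + 1) => ℝ) (Fin.last n)
    rw [← lintegral_indicator hset, ← lintegral_indicator hset']
    have hmeas : Measurable fun q : ℝ × (Fin n → ℝ) =>
        {r : Fin n → ℝ | ∀ i, 0 < r i}.indicator (fun r => G (q.1, r)) q.2 := by
      have : (fun q : ℝ × (Fin n → ℝ) =>
          {r : Fin n → ℝ | ∀ i, 0 < r i}.indicator (fun r => G (q.1, r)) q.2) =
          (Prod.snd ⁻¹' {r : Fin n → ℝ | ∀ i, 0 < r i}).indicator G := by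
        ext q; simp [Set.indicator]
      rw [this]
      exact hG.indicator (measurable_snd hset)
    have h3 := hmp.lintegral_comp hmeas
    rw [Measure.volume_eq_prod, lintegral_prod_symm _ hmeas.aemeasurable] at h3
    have h4 : ∀ r : Fin n → ℝ, ∫⁻ a : ℝ,
        {r : Fin n → ℝ | ∀ i, 0 < r i}.indicator (fun r => G (a, r)) r =
        {r : Fin n → ℝ | ∀ i, 0 < r i}.indicator (fun r => ∫⁻ a : ℝ, G (a, r)) r := by
      intro r
      by_cases hr : r ∈ {r : Fin n → ℝ | ∀ i, 0 < r i}
      · simp only [Set.indicator_of_mem hr]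
      · simp only [Set.indicator_of_notMem hr, lintegral_zero]
    simp only [h4] at h3
    rw [← h3]
    refine lintegral_congr fun x => ?_
    simp only [MeasurableEquiv.piFinSuccAbove_apply, Fin.insertNthEquiv_symm_apply]
    simp only [Set.indicator, Fin.removeNth_last, Set.mem_ofPred_eq]
    rfl
  rw [h2, lintegral_secularCoords hd]
  refine setLIntegral_congr_fun (measurableSet_interlacing d) fun μ hμ => ?_
  congr 1
  refine hinv _ _ ?_
  rw [charpoly_border_diagonalCoords, charpoly_diagonalCoords,
    ← secularPoly_secularCoords hd.injective]
  congr 2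
  funext i
  simp only [Pi.zero_apply]
  rw [Real.sq_sqrt (by have := secularCoords_castSucc_pos hμ i; positivity)]
  ring

/-- The density of the eigenvalues is obtained from the one for the old block by integrating over
all spectra of the old block interlacing with the given one. -/
theorem lintegral_strictMono_interlacing {f : (Fin (n + 1) → ℝ) → ENNReal} (hf : Measurable f) :
    ∫⁻ d in {d : Fin n → ℝ | StrictMono d}, (∫⁻ μ in interlacing d,
        ENNReal.ofReal ((Matrix.vandermonde μ).det / (Matrix.vandermonde d).det) * f μ) *
          ENNReal.ofReal ((Matrix.vandermonde d).det ^ 2) =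
      ENNReal.ofReal (n.factorial : ℝ)⁻¹ * ∫⁻ μ in {μ : Fin (n + 1) → ℝ | StrictMono μ},
        f μ * ENNReal.ofReal ((Matrix.vandermonde μ).det ^ 2) := by
  let S : Set ((Fin n → ℝ) × (Fin (n + 1) → ℝ)) := {q | q.2 ∈ interlacing q.1}
  have hS : MeasurableSet S := by
    have : S = ⋂ i : Fin n, {q | q.2 i.castSucc < q.1 i} ∩ {q | q.1 i < q.2 i.succ} := by
      ext q; simp [S, interlacing]
    rw [this]
    exact MeasurableSet.iInter fun i =>
      (measurableSet_lt (by fun_prop) (by fun_prop)).inter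
        (measurableSet_lt (by fun_prop) (by fun_prop))
  have hv : ∀ m : ℕ, Measurable fun μ : Fin m → ℝ => ENNReal.ofReal (Matrix.vandermonde μ).det :=
    fun m => continuous_vandermonde_det.measurable.ennreal_ofReal
  let k : (Fin n → ℝ) × (Fin (n + 1) → ℝ) → ENNReal := fun q =>
    S.indicator (fun q => f q.2 * ENNReal.ofReal (Matrix.vandermonde q.2).det *
      ENNReal.ofReal (Matrix.vandermonde q.1).det) q
  have hk : Measurable k := Measurable.indicator (((hf.comp measurable_snd).mul
    ((hv _).comp measurable_snd)).mul ((hv _).comp measurable_fst)) hS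
  have hleft : ∫⁻ d in {d : Fin n → ℝ | StrictMono d}, (∫⁻ μ in interlacing d,
        ENNReal.ofReal ((Matrix.vandermonde μ).det / (Matrix.vandermonde d).det) * f μ) *
          ENNReal.ofReal ((Matrix.vandermonde d).det ^ 2) = ∫⁻ d, ∫⁻ μ, k (d, μ) := by
    rw [← lintegral_indicator measurableSet_strictMono]
    refine lintegral_congr fun d => ?_
    by_cases hd : StrictMono d
    · rw [Set.indicator_of_mem (show d ∈ {d : Fin n → ℝ | StrictMono d} from hd),
        ← lintegral_mul_const' _ _ ENNReal.ofReal_ne_top,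
        ← lintegral_indicator (measurableSet_interlacing d)]
      refine lintegral_congr fun μ => ?_
      by_cases hμ : μ ∈ interlacing d
      · have hpos := vandermonde_det_pos hd
        rw [Set.indicator_of_mem hμ]
        simp only [k]
        rw [Set.indicator_of_mem (show (d, μ) ∈ S from hμ), mul_comm _ (f μ), mul_assoc, mul_assoc,
          ← ENNReal.ofReal_mul' (by positivity), ← ENNReal.ofReal_mul' hpos.le]
        congr 2
        field_simp
      · rw [Set.indicator_of_notMem hμ]
        exact (Set.indicator_of_notMem (show (d, μ) ∉ S from hμ) _).symm
    · rw [Set.indicator_of_notMem (show d ∉ {d : Fin n → ℝ | StrictMono d} from hd)]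
      symm
      have : ∀ μ, k (d, μ) = 0 := fun μ => Set.indicator_of_notMem
        (show (d, μ) ∉ S from fun h => hd (interlacing.strictMono_inner h)) _
      simp [this]
  rw [hleft, lintegral_lintegral_swap hk.aemeasurable, ← lintegral_indicator
    measurableSet_strictMono, ← lintegral_const_mul' _ _ ENNReal.ofReal_ne_top]
  refine lintegral_congr fun μ => ?_
  by_cases hμ : StrictMono μ
  · have hmeasd : MeasurableSet {d : Fin n → ℝ | μ ∈ interlacing d} :=
      measurable_prodMk_right hS
    have h1 : ∀ d, k (d, μ) = {d : Fin n → ℝ | μ ∈ interlacing d}.indicator (fun d =>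
        f μ * ENNReal.ofReal (Matrix.vandermonde μ).det *
          ENNReal.ofReal (Matrix.vandermonde d).det) d := by
      intro d
      simp only [k, S, Set.indicator, Set.mem_ofPred_eq]
    simp only [h1]
    rw [lintegral_indicator hmeasd, lintegral_const_mul _ (hv n),
      lintegral_vandermonde_interlacing hμ,
      Set.indicator_of_mem (show μ ∈ {μ : Fin (n + 1) → ℝ | StrictMono μ} from hμ)]
    have hpos := vandermonde_det_pos hμ
    rw [mul_assoc, ← ENNReal.ofReal_mul hpos.le, mul_left_comm,
      ← ENNReal.ofReal_mul (by positivity)]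
    congr 2
    field_simp
  · rw [Set.indicator_of_notMem (show μ ∉ {μ : Fin (n + 1) → ℝ | StrictMono μ} from hμ), mul_zero]
    have : ∀ d, k (d, μ) = 0 := fun d => Set.indicator_of_notMem
      (show (d, μ) ∉ S from fun h => hμ (interlacing.strictMono h)) _
    simp [this]

/-- Weyl's integration formula: the integral over all Hermitian matrices of a function of the
eigenvalues. -/
theorem lintegral_gueMatrix (n : ℕ) {F : (Fin n × Fin n → ℝ) → ENNReal} (hF : Measurable F)
    (hinv : ∀ g g', (gueMatrix g).charpoly = (gueMatrix g').charpoly → F g = F g') :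
    ∫⁻ g, F g = ENNReal.ofReal (weylConst n) * ∫⁻ μ in {μ : Fin n → ℝ | StrictMono μ},
      F (diagonalCoords μ) * ENNReal.ofReal ((Matrix.vandermonde μ).det ^ 2) := by
  induction n with
  | zero =>
    have hset : {μ : Fin 0 → ℝ | StrictMono μ} = Set.univ := by
      ext μ; simp [Subsingleton.strictMono]
    rw [hset, Measure.restrict_univ, volume_pi, volume_pi, Measure.pi_of_empty _ 0,
      Measure.pi_of_empty _ 0, lintegral_dirac, lintegral_dirac]
    simp only [weylConst, Finset.range_zero, Finset.prod_empty, ENNReal.ofReal_one, one_mul,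
      Matrix.det_isEmpty, one_pow, mul_one]
    congr 1
    exact Subsingleton.elim _ _
  | succ n ih =>
    have hm : Measurable fun p : (Fin n × Fin n → ℝ) × (((Fin n → ℝ) × (Fin n → ℝ)) × ℝ) =>
        F (border p.1 p.2.1 p.2.2) := hF.comp measurable_border
    have hm1 : Measurable fun q : ((Fin n × Fin n → ℝ) × ((Fin n → ℝ) × (Fin n → ℝ))) × ℝ =>
        F (border q.1.1 q.1.2 q.2) :=
      hm.comp (by fun_prop : Measurable fun q : ((Fin n × Fin n → ℝ) ×
        ((Fin n → ℝ) × (Fin n → ℝ))) × ℝ => (q.1.1, (q.1.2, q.2)))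
    have hm2 : Measurable fun q : (Fin n × Fin n → ℝ) × ((Fin n → ℝ) × (Fin n → ℝ)) =>
        ∫⁻ a : ℝ, F (border q.1 q.2 a) := hm1.lintegral_prod_right'
    have hm3 : Measurable fun g : Fin n × Fin n → ℝ =>
        ∫⁻ v : (Fin n → ℝ) × (Fin n → ℝ), ∫⁻ a : ℝ, F (border g v a) :=
      hm2.lintegral_prod_right'
    rw [lintegral_border hF, ih hm3]
    · have h1 : ∫⁻ d in {d : Fin n → ℝ | StrictMono d},
          (∫⁻ v : (Fin n → ℝ) × (Fin n → ℝ), ∫⁻ a : ℝ, F (border (diagonalCoords d) v a)) *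
            ENNReal.ofReal ((Matrix.vandermonde d).det ^ 2) =
          ENNReal.ofReal (2 * Real.pi) ^ n * ∫⁻ d in {d : Fin n → ℝ | StrictMono d},
            (∫⁻ μ in interlacing d, ENNReal.ofReal ((Matrix.vandermonde μ).det /
              (Matrix.vandermonde d).det) * F (diagonalCoords μ)) *
                ENNReal.ofReal ((Matrix.vandermonde d).det ^ 2) := by
        rw [← lintegral_const_mul' _ _ (by finiteness)]
        refine setLIntegral_congr_fun measurableSet_strictMono fun d hd => ?_
        rw [lintegral_border_diagonalCoords hF hinv hd, mul_assoc]
      have h2 := lintegral_strictMono_interlacing (hF.comp measurable_diagonalCoords)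
      simp only [Function.comp_apply] at h2
      rw [h1, h2, ← mul_assoc,
        ← mul_assoc]
      congr 1
      have hw : 0 ≤ weylConst n := Finset.prod_nonneg fun k _ => by positivity
      rw [← ENNReal.ofReal_pow (by positivity), ← ENNReal.ofReal_mul hw,
        ← ENNReal.ofReal_mul (by positivity), weylConst, weylConst, Finset.prod_range_succ]
      congr 1
      rw [mul_assoc, div_eq_mul_inv]
    · intro g g' hgg
      rw [lintegral_border_eq_diagonal hF hinv g, lintegral_border_eq_diagonal hF hinv g',
        (Matrix.IsHermitian.eigenvalues_eq_eigenvalues_iff (gueMatrix_isHermitian g)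
          (gueMatrix_isHermitian g')).2 hgg]

end EigenvalueDensity

/-! ### The largest eigenvalue of the GUE -/

section LargestEigenvalue

variable {n : ℕ}

theorem measurePreserving_comp_perm (σ : Equiv.Perm (Fin n)) :
    MeasurePreserving (fun x : Fin n → ℝ => x ∘ σ) volume volume := by
  refine ⟨by fun_prop, (Measure.pi_eq fun s hs => ?_).symm⟩
  rw [Measure.map_apply (by fun_prop) (MeasurableSet.univ_pi hs)]
  have : (fun x : Fin n → ℝ => x ∘ σ) ⁻¹' Set.univ.pi s =
      Set.univ.pi fun i => s (σ.symm i) := by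
    ext x
    simp only [Set.mem_preimage, Set.mem_univ_pi, Function.comp_apply]
    exact ⟨fun h i => by simpa using h (σ.symm i), fun h i => by simpa using h (σ i)⟩
  rw [this, volume_pi_pi]
  exact Equiv.prod_comp σ.symm fun i => volume (s i)

/-- A symmetric function vanishing on the diagonals is integrated over the ordered sequences. -/
theorem lintegral_eq_factorial_mul_strictMono {f : (Fin n → ℝ) → ENNReal} (hf : Measurable f)
    (hsymm : ∀ (σ : Equiv.Perm (Fin n)) x, f (x ∘ σ) = f x)
    (hdiag : ∀ x, ¬ Function.Injective x → f x = 0) :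
    ∫⁻ x, f x = (n.factorial : ENNReal) * ∫⁻ x in {x : Fin n → ℝ | StrictMono x}, f x := by
  classical
  let S : Set (Fin n → ℝ) := {x | StrictMono x}
  have h1 : ∀ x, f x = ∑ σ : Equiv.Perm (Fin n), S.indicator f (x ∘ σ) := by
    intro x
    by_cases hx : Function.Injective x
    · have hσ : x ∘ Tuple.sort x ∈ S :=
        (Tuple.monotone_sort x).strictMono_of_injective (hx.comp (Tuple.sort x).injective)
      rw [Finset.sum_eq_single (Tuple.sort x), Set.indicator_of_mem hσ, hsymm]
      · intro τ _ hτ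
        refine Set.indicator_of_notMem (fun hτS => hτ ?_) _
        have hcomp : x ∘ τ = x ∘ Tuple.sort x :=
          (StrictMono.range_inj hτS hσ).1 (by
            rw [Set.range_comp, Set.range_comp, τ.surjective.range_eq,
              (Tuple.sort x).surjective.range_eq])
        exact Equiv.ext fun i => hx (congrFun hcomp i)
      · exact fun h => absurd (Finset.mem_univ _) h
    · rw [hdiag x hx]
      refine (Finset.sum_eq_zero fun σ _ => Set.indicator_of_notMem (fun h => hx ?_) _).symm
      have h2 : Function.Injective (x ∘ σ) := StrictMono.injective h
      exact (Function.Injective.of_comp_iff' x σ.bijective).1 h2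
  have hm : Measurable (S.indicator f) := hf.indicator measurableSet_strictMono
  calc ∫⁻ x, f x = ∫⁻ x, ∑ σ : Equiv.Perm (Fin n), S.indicator f (x ∘ σ) := by simp only [← h1]
    _ = ∑ σ : Equiv.Perm (Fin n), ∫⁻ x : Fin n → ℝ, S.indicator f (x ∘ σ) :=
        lintegral_finsetSum _ fun σ _ => hm.comp (by fun_prop)
    _ = ∑ _σ : Equiv.Perm (Fin n), ∫⁻ x in S, f x := by
        refine Finset.sum_congr rfl fun σ _ => ?_
        rw [(measurePreserving_comp_perm σ).lintegral_comp hm,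
          lintegral_indicator measurableSet_strictMono]
    _ = _ := by
        rw [Finset.sum_const, Finset.card_univ, Fintype.card_perm, Fintype.card_fin, nsmul_eq_mul]

theorem gaussianPDFReal_eq_normalDensity (x : ℝ) : gaussianPDFReal 0 1 x = normalDensity x := by
  unfold gaussianPDFReal normalDensity
  simp only [NNReal.coe_one, mul_one, sub_zero]
  rw [neg_div, mul_comm, ← div_eq_mul_inv]

theorem pi_gaussianReal_eq_withDensity {ι : Type*} [Fintype ι] :
    Measure.pi (fun _ : ι => gaussianReal 0 1) =
      (volume : Measure (ι → ℝ)).withDensity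
        fun g => ENNReal.ofReal (∏ z, normalDensity (g z)) := by
  have hint : Integrable normalDensity := by
    simpa using integrable_pow_mul_normalDensity 0
  refine Measure.pi_eq fun s hs => ?_
  rw [withDensity_apply _ (MeasurableSet.univ_pi hs), volume_pi, Measure.restrict_pi_pi,
    ← ofReal_integral_eq_lintegral_ofReal]
  · rw [integral_fintype_prod_eq_prod (fun _ => normalDensity), ENNReal.ofReal_prod_of_nonneg
      fun z _ => integral_nonneg fun x => (normalDensity_pos x).le]
    refine Finset.prod_congr rfl fun z _ => ?_
    rw [gaussianReal_apply_eq_integral _ one_ne_zero]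
    simp only [gaussianPDFReal_eq_normalDensity]
  · exact Integrable.fintype_prod fun z => hint.restrict
  · exact Eventually.of_forall fun g => Finset.prod_nonneg fun z _ => (normalDensity_pos _).le

theorem iSup_eigenvalues_le_iff (g : Fin (n + 1) × Fin (n + 1) → ℝ) (s : ℝ) :
    (⨆ i, (gueMatrix_isHermitian g).eigenvalues i) ≤ s ↔
      ∀ i, (gueMatrix_isHermitian g).eigenvalues i ≤ s :=
  ciSup_le_iff (Set.finite_range _).bddAbove

/-- The quadratic form of `s - M` gives a description of the event by closed conditions on the
entries, hence its measurability. -/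
theorem eigenvalues_le_iff_quadratic_form (g : Fin n × Fin n → ℝ) (s : ℝ) :
    (∀ i, (gueMatrix_isHermitian g).eigenvalues i ≤ s) ↔
      ∀ v : Fin n → ℂ, 0 ≤
        (dotProduct (star v) ((((s : ℂ) • (1 : Matrix (Fin n) (Fin n) ℂ)) -
          gueMatrix g).mulVec v)).re := by
  set d := (gueMatrix_isHermitian g).eigenvalues with hd
  set U : Matrix (Fin n) (Fin n) ℂ := ((gueMatrix_isHermitian g).eigenvectorUnitary :
    Matrix (Fin n) (Fin n) ℂ) with hU
  have hUU : star U * U = 1 := Unitary.coe_star_mul_self _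
  have hUU' : U * star U = 1 := Unitary.coe_mul_star_self _
  have hsp : gueMatrix g = U * (Matrix.diagonal fun i => (d i : ℂ)) * star U := by
    have h := (gueMatrix_isHermitian g).spectral_theorem
    rw [Unitary.conjStarAlgAut_apply] at h
    exact h
  have hM : ((s : ℂ) • (1 : Matrix (Fin n) (Fin n) ℂ)) - gueMatrix g =
      U * (Matrix.diagonal fun i => ((s - d i : ℝ) : ℂ)) * star U := by
    have h1 : (Matrix.diagonal fun i => ((s - d i : ℝ) : ℂ)) =
        (s : ℂ) • (1 : Matrix (Fin n) (Fin n) ℂ) - Matrix.diagonal fun i => (d i : ℂ) := by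
      ext i j
      by_cases hij : i = j
      · subst hij; simp
      · simp [hij]
    rw [h1, hsp, mul_sub, sub_mul, mul_smul_comm, mul_one, smul_mul_assoc, hUU']
  have hquad : ∀ v : Fin n → ℂ, (dotProduct (star v) ((((s : ℂ) •
      (1 : Matrix (Fin n) (Fin n) ℂ)) - gueMatrix g).mulVec v)).re =
      ∑ i, (s - d i) * Complex.normSq ((star U).mulVec v i) := by
    intro v
    rw [hM, ← Matrix.mulVec_mulVec, ← Matrix.mulVec_mulVec, Matrix.dotProduct_mulVec]
    have h2 : Matrix.vecMul (star v) U = star ((star U).mulVec v) := by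
      rw [Matrix.star_mulVec, Matrix.star_eq_conjTranspose, Matrix.conjTranspose_conjTranspose]
    rw [h2]
    simp only [dotProduct, Matrix.mulVec_diagonal, Pi.star_apply, Complex.re_sum]
    refine Finset.sum_congr rfl fun i _ => ?_
    have h3 : star ((star U).mulVec v i) * (((s - d i : ℝ) : ℂ) * (star U).mulVec v i) =
        (((s - d i) * Complex.normSq ((star U).mulVec v i) : ℝ) : ℂ) := by
      rw [Complex.ofReal_mul, Complex.normSq_eq_conj_mul_self, mul_left_comm]
      rfl
    rw [h3, Complex.ofReal_re]
  constructor
  · intro h v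
    rw [hquad]
    exact Finset.sum_nonneg fun i _ => mul_nonneg (sub_nonneg.2 (h i)) (Complex.normSq_nonneg _)
  · intro h i
    have h1 := h (U.mulVec (Pi.single i 1))
    rw [hquad, Matrix.mulVec_mulVec, hUU, Matrix.one_mulVec, Finset.sum_eq_single i] at h1
    · simpa using h1
    · intro j _ hj; simp [hj]
    · exact fun h => absurd (Finset.mem_univ _) h

theorem continuous_gueMatrix : Continuous (gueMatrix : (Fin n × Fin n → ℝ) → _) := by
  refine continuous_matrix fun i j => ?_
  unfold gueMatrix
  simp only [Matrix.of_apply]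
  split_ifs <;> fun_prop

theorem measurableSet_iSup_eigenvalues_le (s : ℝ) :
    MeasurableSet {g : Fin (n + 1) × Fin (n + 1) → ℝ |
      (⨆ i, (gueMatrix_isHermitian g).eigenvalues i) ≤ s} := by
  simp only [iSup_eigenvalues_le_iff, eigenvalues_le_iff_quadratic_form]
  refine IsClosed.measurableSet ?_
  rw [Set.ofPred_forall]
  refine isClosed_iInter fun v => isClosed_le continuous_const ?_
  refine Complex.continuous_re.comp (continuous_const.dotProduct ?_)
  exact (continuous_const.sub continuous_gueMatrix).matrix_mulVec continuous_const

theorem iSup_eigenvalues_diagonalCoords_le_iff (μ : Fin (n + 1) → ℝ) (s : ℝ) :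
    (⨆ i, (gueMatrix_isHermitian (diagonalCoords μ)).eigenvalues i) ≤ s ↔ ∀ i, μ i ≤ s := by
  rw [iSup_eigenvalues_le_iff, eigenvalues_le_iff_quadratic_form]
  have hquad : ∀ v : Fin (n + 1) → ℂ, (dotProduct (star v) ((((s : ℂ) •
      (1 : Matrix (Fin (n + 1)) (Fin (n + 1)) ℂ)) -
        gueMatrix (diagonalCoords μ)).mulVec v)).re =
      ∑ i, (s - μ i) * Complex.normSq (v i) := by
    intro v
    rw [gueMatrix_diagonalCoords]
    have h1 : (s : ℂ) • (1 : Matrix (Fin (n + 1)) (Fin (n + 1)) ℂ) -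
        (Matrix.diagonal fun i => (μ i : ℂ)) = Matrix.diagonal fun i => ((s - μ i : ℝ) : ℂ) := by
      ext i j
      by_cases hij : i = j
      · subst hij; simp
      · simp [hij]
    rw [h1]
    simp only [dotProduct, Matrix.mulVec_diagonal, Pi.star_apply, Complex.re_sum]
    refine Finset.sum_congr rfl fun i _ => ?_
    have h3 : star (v i) * (((s - μ i : ℝ) : ℂ) * v i) =
        (((s - μ i) * Complex.normSq (v i) : ℝ) : ℂ) := by
      rw [Complex.ofReal_mul, Complex.normSq_eq_conj_mul_self, mul_left_comm]
      rfl
    rw [h3, Complex.ofReal_re]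
  simp only [hquad]
  constructor
  · intro h i
    have h1 := h (Pi.single i 1)
    rw [Finset.sum_eq_single i] at h1
    · simpa using h1
    · intro j _ hj; simp [hj]
    · exact fun h => absurd (Finset.mem_univ _) h
  · intro h v
    exact Finset.sum_nonneg fun i _ => mul_nonneg (sub_nonneg.2 (h i)) (Complex.normSq_nonneg _)

theorem prod_normalDensity {ι : Type*} [Fintype ι] (g : ι → ℝ) :
    ∏ z, normalDensity (g z) =
      (√(2 * Real.pi) ^ Fintype.card ι)⁻¹ * Real.exp (-((∑ z, g z ^ 2) / 2)) := by
  simp only [normalDensity, div_eq_mul_inv, Finset.prod_mul_distrib, Finset.prod_const,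
    Finset.card_univ, ← Real.exp_sum, Finset.sum_neg_distrib, ← Finset.sum_mul, inv_pow]
  rw [mul_comm]

theorem sum_sq_diagonalCoords (μ : Fin n → ℝ) : ∑ z, diagonalCoords μ z ^ 2 = ∑ i, μ i ^ 2 := by
  rw [Fintype.sum_prod_type]
  refine Finset.sum_congr rfl fun i _ => ?_
  simp [diagonalCoords, ite_pow]

/-- The powers of `2 π` in the Weyl constant cancel against the normalization of the off-diagonal
Gaussian coordinates. -/
theorem weylConst_mul_inv (n : ℕ) :
    weylConst n * (√(2 * Real.pi) ^ (n * n))⁻¹ =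
      (∏ k ∈ Finset.range n, (k.factorial : ℝ)⁻¹) * (√(2 * Real.pi) ^ n)⁻¹ := by
  have h2 : √(2 * Real.pi) ^ 2 = 2 * Real.pi := Real.sq_sqrt (by positivity)
  have h1 : ∏ k ∈ Finset.range n, (2 * Real.pi) ^ k = √(2 * Real.pi) ^ (n * (n - 1)) := by
    rw [Finset.prod_pow_eq_pow_sum, ← Finset.sum_range_id_mul_two, mul_comm (Finset.sum _ _) 2,
      pow_mul, h2]
  have h3 : √(2 * Real.pi) ^ (n * n) = √(2 * Real.pi) ^ (n * (n - 1)) * √(2 * Real.pi) ^ n := by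
    rw [← pow_add]
    congr 1
    cases n with
    | zero => rfl
    | succ n => simp only [Nat.add_sub_cancel]; ring
  have h0 : √(2 * Real.pi) ≠ 0 := by positivity
  rw [weylConst, Finset.prod_div_distrib, h1, h3, Finset.prod_inv_distrib]
  field_simp

theorem gueLargestEigenvalueCDF_eq_det (n : ℕ) (s : ℝ) :
    gueLargestEigenvalueCDF (n + 1) s = (truncatedGram (n + 1) s).det := by
  set N := n + 1 with hN
  let A : Set (Fin N × Fin N → ℝ) :=
    {g | (⨆ i, (gueMatrix_isHermitian g).eigenvalues i) ≤ s}
  have hA : MeasurableSet A := measurableSet_iSup_eigenvalues_le s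
  let F : (Fin N × Fin N → ℝ) → ENNReal :=
    A.indicator fun g => ENNReal.ofReal (∏ z, normalDensity (g z))
  have hcont : Continuous fun g : Fin N × Fin N → ℝ => ∏ z, normalDensity (g z) :=
    continuous_finsetProd _ fun z _ => continuous_normalDensity.comp (continuous_apply z)
  have hF : Measurable F := (hcont.measurable.ennreal_ofReal).indicator hA
  have hinv : ∀ g g', (gueMatrix g).charpoly = (gueMatrix g').charpoly → F g = F g' := by
    intro g g' h
    have hmem : g ∈ A ↔ g' ∈ A := by
      have heig := (Matrix.IsHermitian.eigenvalues_eq_eigenvalues_iff (gueMatrix_isHermitian g)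
        (gueMatrix_isHermitian g')).2 h
      simp only [A, Set.mem_ofPred_eq, heig]
    have hval : ∏ z, normalDensity (g z) = ∏ z, normalDensity (g' z) := by
      rw [prod_normalDensity, prod_normalDensity, sum_sq_eq_of_charpoly_eq h]
    by_cases hg : g ∈ A
    · simp only [F, Set.indicator_of_mem hg, Set.indicator_of_mem (hmem.1 hg), hval]
    · simp only [F, Set.indicator_of_notMem hg, Set.indicator_of_notMem (mt hmem.2 hg)]
  have hcdf : gueLargestEigenvalueCDF N s = (∫⁻ g, F g).toReal := by
    rw [gueLargestEigenvalueCDF, Measure.real, pi_gaussianReal_eq_withDensity,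
      withDensity_apply _ hA, lintegral_indicator hA]
  rw [hcdf, lintegral_gueMatrix N hF hinv]
  let B : Set (Fin N → ℝ) := Set.univ.pi fun _ => Set.Iic s
  have hB : MeasurableSet B := MeasurableSet.univ_pi fun _ => measurableSet_Iic
  -- the eigenvalue density up to a constant, as a product of two determinants
  let D : (Fin N → ℝ) → ℝ := fun μ =>
    (Matrix.of fun i j : Fin N => μ j ^ (i : ℕ)).det *
      (Matrix.of fun i j : Fin N => μ j ^ (i : ℕ) * normalDensity (μ j)).det
  have hD : ∀ μ, D μ = (Matrix.vandermonde μ).det ^ 2 * ∏ i, normalDensity (μ i) := by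
    intro μ
    have h1 : (Matrix.of fun i j : Fin N => μ j ^ (i : ℕ)).det = (Matrix.vandermonde μ).det :=
      Matrix.det_transpose _
    have h2 := Matrix.det_mul_row (fun j => normalDensity (μ j))
      (Matrix.of fun i j : Fin N => μ j ^ (i : ℕ))
    simp only [Matrix.of_apply] at h2
    simp only [D, mul_comm (_ ^ _) (normalDensity _)]
    rw [h2, h1]
    ring
  have hDnn : ∀ μ, 0 ≤ D μ := fun μ => by
    rw [hD]
    exact mul_nonneg (sq_nonneg _) (Finset.prod_nonneg fun i _ => (normalDensity_pos _).le)
  have hDmeas : Measurable D := by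
    have : D = fun μ => (Matrix.vandermonde μ).det ^ 2 * ∏ i, normalDensity (μ i) := funext hD
    rw [this]
    exact ((continuous_vandermonde_det.pow 2).mul (continuous_finsetProd _ fun z _ =>
      continuous_normalDensity.comp (continuous_apply z))).measurable
  have h0 : √(2 * Real.pi) ≠ 0 := by positivity
  let c : ℝ := (√(2 * Real.pi) ^ (N * N))⁻¹ * √(2 * Real.pi) ^ N
  have hc : 0 ≤ c := by positivity
  have hFD : ∀ μ : Fin N → ℝ, F (diagonalCoords μ) *
      ENNReal.ofReal ((Matrix.vandermonde μ).det ^ 2) =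
      ENNReal.ofReal c * B.indicator (fun μ => ENNReal.ofReal (D μ)) μ := by
    intro μ
    have hmem : diagonalCoords μ ∈ A ↔ μ ∈ B := by
      simp only [A, B, Set.mem_ofPred_eq, Set.mem_univ_pi, Set.mem_Iic]
      exact iSup_eigenvalues_diagonalCoords_le_iff μ s
    by_cases hμ : μ ∈ B
    · simp only [F, Set.indicator_of_mem (hmem.2 hμ), Set.indicator_of_mem hμ]
      rw [← ENNReal.ofReal_mul' (sq_nonneg _), ← ENNReal.ofReal_mul hc, hD, prod_normalDensity,
        prod_normalDensity, sum_sq_diagonalCoords, Fintype.card_prod, Fintype.card_fin]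
      congr 1
      simp only [c]
      field_simp
    · simp only [F, Set.indicator_of_notMem (mt hmem.1 hμ), Set.indicator_of_notMem hμ, zero_mul,
        mul_zero]
  simp only [hFD]
  rw [lintegral_const_mul' _ _ ENNReal.ofReal_ne_top]
  have hsym := lintegral_eq_factorial_mul_strictMono
    (f := B.indicator fun μ => ENNReal.ofReal (D μ)) (hDmeas.ennreal_ofReal.indicator hB) ?_ ?_
  · have hint : ∀ i j : Fin N, Integrable (fun x : ℝ => x ^ (i : ℕ) *
        (x ^ (j : ℕ) * normalDensity x)) (volume.restrict (Set.Iic s)) := by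
      intro i j
      simpa [pow_add, mul_assoc] using
        (integrable_pow_mul_normalDensity ((i : ℕ) + j)).restrict (s := Set.Iic s)
    have hpi : (volume : Measure (Fin N → ℝ)).restrict B =
        Measure.pi fun _ => volume.restrict (Set.Iic s) := by
      rw [volume_pi, Measure.restrict_pi_pi]
    have hand := integral_det_mul_det (volume.restrict (Set.Iic s))
      (fun (i : Fin N) x => x ^ (i : ℕ)) (fun (j : Fin N) x => x ^ (j : ℕ) * normalDensity x) hint
    have handi := integrable_det_mul_det (volume.restrict (Set.Iic s))
      (fun (i : Fin N) x => x ^ (i : ℕ)) (fun (j : Fin N) x => x ^ (j : ℕ) * normalDensity x) hint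
    rw [lintegral_indicator hB, ← ofReal_integral_eq_lintegral_ofReal (by rw [hpi]; exact handi)
      (Eventually.of_forall hDnn), hpi, hand, Fintype.card_fin] at hsym
    have hfac : (N.factorial : ENNReal) = ENNReal.ofReal (N.factorial : ℝ) := by simp
    rw [hfac, ENNReal.ofReal_mul (by positivity)] at hsym
    have hne : ENNReal.ofReal (N.factorial : ℝ) ≠ 0 := by
      rw [← hfac]; exact_mod_cast N.factorial_ne_zero
    rw [← (ENNReal.mul_right_inj hne ENNReal.ofReal_ne_top).1 hsym]
    have hw : 0 ≤ weylConst N := Finset.prod_nonneg fun k _ => by positivity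
    rw [ENNReal.toReal_mul, ENNReal.toReal_mul, ENNReal.toReal_ofReal hw, ENNReal.toReal_ofReal hc,
      ENNReal.toReal_ofReal, ← mul_assoc, det_truncatedGram_eq_hankel]
    · congr 1
      simp only [c]
      rw [← mul_assoc, weylConst_mul_inv, mul_assoc, inv_mul_cancel₀ (by positivity), mul_one,
        Fin.prod_univ_eq_prod_range (fun k => ((k.factorial : ℝ))⁻¹) N]
    · have h1 : (0 : ℝ) ≤ (N.factorial : ℝ) * (Matrix.of fun i j : Fin N =>
          ∫ x in Set.Iic s, x ^ (i : ℕ) * (x ^ (j : ℕ) * normalDensity x)).det := by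
        have h2 := le_of_le_of_eq (integral_nonneg hDnn) hand
        rwa [Fintype.card_fin] at h2
      exact nonneg_of_mul_nonneg_right h1 (by positivity)
  · intro σ x
    have hmem : x ∘ σ ∈ B ↔ x ∈ B := by
      simp only [B, Set.mem_univ_pi, Function.comp_apply]
      exact ⟨fun h i => by simpa using h (σ.symm i), fun h i => h (σ i)⟩
    have hval : D (x ∘ σ) = D x := by
      rw [hD, hD]
      have h1 : (Matrix.vandermonde (x ∘ σ)).det ^ 2 = (Matrix.vandermonde x).det ^ 2 := by
        have h2 : Matrix.vandermonde (x ∘ σ) = (Matrix.vandermonde x).submatrix σ id := rfl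
        rw [h2, Matrix.det_permute, mul_pow]
        rcases Int.units_eq_one_or (Equiv.Perm.sign σ) with h | h <;> simp [h]
      rw [h1]
      congr 1
      exact Equiv.prod_comp σ fun i => normalDensity (x i)
    by_cases hx : x ∈ B
    · rw [Set.indicator_of_mem hx, Set.indicator_of_mem (hmem.2 hx), hval]
    · rw [Set.indicator_of_notMem hx, Set.indicator_of_notMem (mt hmem.1 hx)]
  · intro x hx
    have h0 : D x = 0 := by
      rw [hD, Matrix.det_vandermonde_eq_zero_iff.2, zero_pow two_ne_zero, zero_mul]
      simp only [Function.Injective, not_forall] at hx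
      obtain ⟨i, j, hij, hne⟩ := hx
      exact ⟨i, j, hij, hne⟩
    simp [Set.indicator, h0]

end LargestEigenvalue

/-! ### Oriented digital boiling along the characteristics -/

section LagHeight

variable {n : ℕ}

/-- The height at the site `j`, `m` steps after the light cone has reached it. -/
noncomputable def lagHeight (S : Set (ℕ × ℕ)) (m j : ℕ) : ℕ :=
  (odbHeight S (m + j) j).unbotD 0

open Classical in
/-- The indicator of the mark that acts between `lagHeight S m j` and `lagHeight S (m + 1) j`. -/
noncomputable def lagMark (S : Set (ℕ × ℕ)) (m j : ℕ) : ℕ :=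
  if (j, m + j) ∈ S then 1 else 0

theorem coe_lagHeight (S : Set (ℕ × ℕ)) (m j : ℕ) :
    WithBot.some (lagHeight S m j) = odbHeight S (m + j) j := by
  have h : odbHeight S (m + j) j ≠ ⊥ := by
    rw [Ne, odbHeight_eq_bot_iff]; omega
  obtain ⟨a, ha⟩ := WithBot.ne_bot_iff_exists.1 h
  rw [lagHeight, ← ha, WithBot.unbotD_coe]

theorem lagHeight_zero (S : Set (ℕ × ℕ)) (j : ℕ) : lagHeight S 0 j = 0 := by
  induction j with
  | zero => simp [lagHeight, odbHeight]
  | succ j ih =>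
    have h1 : odbHeight S j (j + 1) = ⊥ := (odbHeight_eq_bot_iff S _ _).2 (by omega)
    have h2 := coe_lagHeight S 0 j
    rw [ih, zero_add] at h2
    simp [lagHeight, odbHeight, h1, ← h2]

theorem lagHeight_succ_zero (S : Set (ℕ × ℕ)) (m : ℕ) :
    lagHeight S (m + 1) 0 = lagHeight S m 0 + lagMark S m 0 := by
  have h : WithBot.some (lagHeight S (m + 1) 0) =
      WithBot.some (lagHeight S m 0 + lagMark S m 0) := by
    rw [coe_lagHeight, WithBot.coe_add, coe_lagHeight]
    simp only [add_zero, odbHeight, lagMark, if_true, not_lt_bot, if_false]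
    split_ifs <;> simp_all
  exact WithBot.coe_injective h

/-- Copying a higher left neighbour and growing at a marked site combine into a maximum. -/
theorem lagHeight_succ_succ (S : Set (ℕ × ℕ)) (m j : ℕ) :
    lagHeight S (m + 1) (j + 1) =
      max (lagHeight S (m + 1) j) (lagHeight S m (j + 1) + lagMark S m (j + 1)) := by
  have h1 : odbHeight S (m + 1 + j) j = WithBot.some (lagHeight S (m + 1) j) :=
    (coe_lagHeight _ _ _).symm
  have h2 : odbHeight S (m + 1 + j) (j + 1) = WithBot.some (lagHeight S m (j + 1)) := by
    rw [coe_lagHeight]; congr 1; ring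
  have h : WithBot.some (lagHeight S (m + 1) (j + 1)) =
      WithBot.some
        (max (lagHeight S (m + 1) j) (lagHeight S m (j + 1) + lagMark S m (j + 1))) := by
    rw [coe_lagHeight, ← add_assoc]
    simp only [odbHeight, Nat.succ_ne_zero, if_false, Nat.add_sub_cancel, h1, h2, lagMark]
    have h4 : (j + 1, m + (j + 1)) ∈ S ↔ (j + 1, m + 1 + j) ∈ S := by
      rw [show m + (j + 1) = m + 1 + j by ring]
    by_cases h3 : lagHeight S m (j + 1) < lagHeight S (m + 1) j
    · rw [if_pos (WithBot.coe_lt_coe.2 h3), max_eq_left]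
      split_ifs <;> omega
    · rw [if_neg (mt WithBot.coe_lt_coe.1 h3), max_eq_right (by omega), WithBot.coe_add]
      split_ifs <;> first | (exfalso; tauto) | simp
  exact WithBot.coe_injective h

theorem lagHeight_le_succ_right (S : Set (ℕ × ℕ)) (m j : ℕ) :
    lagHeight S m j ≤ lagHeight S m (j + 1) := by
  cases m with
  | zero => simp [lagHeight_zero]
  | succ m => rw [lagHeight_succ_succ]; exact le_max_left _ _

theorem lagHeight_mono (S : Set (ℕ × ℕ)) (m : ℕ) : Monotone (lagHeight S m) :=
  monotone_nat_of_le_succ (lagHeight_le_succ_right S m)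

theorem lagHeight_add_lagMark_le (S : Set (ℕ × ℕ)) (m j : ℕ) :
    lagHeight S m j + lagMark S m j ≤ lagHeight S (m + 1) j := by
  cases j with
  | zero => rw [lagHeight_succ_zero]
  | succ j => rw [lagHeight_succ_succ]; exact le_max_right _ _

/-- Below a weakly increasing barrier the interaction between the sites is invisible. -/
theorem lagHeight_succ_le_iff (S : Set (ℕ × ℕ)) (m : ℕ) {y : Fin n → ℤ} (hy : Monotone y) :
    (∀ j : Fin n, (lagHeight S (m + 1) j : ℤ) ≤ y j) ↔
      ∀ j : Fin n, (lagHeight S m j : ℤ) + lagMark S m j ≤ y j := by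
  constructor
  · intro h j
    refine le_trans ?_ (h j)
    exact_mod_cast lagHeight_add_lagMark_le S m j
  · intro h
    rintro ⟨j, hj⟩
    induction j with
    | zero =>
      have := h ⟨0, hj⟩
      simp only [lagHeight_succ_zero, Nat.cast_add]
      exact this
    | succ j ih =>
      have h1 := ih (by omega)
      have h2 : y ⟨j, by omega⟩ ≤ y ⟨j + 1, hj⟩ := hy (by simp [Fin.le_def])
      have h3 := h ⟨j + 1, hj⟩
      simp only [lagHeight_succ_succ, Nat.cast_max, Nat.cast_add]
      exact max_le (h1.trans h2) h3

/-! ### Transition probabilities -/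

/-- The barrier `y` lowered by one at the sites of `T`. -/
def lowerOn (T : Finset (Fin n)) (y : Fin n → ℤ) (j : Fin n) : ℤ :=
  if j ∈ T then y j - 1 else y j

/-- The probability that independent marks are present exactly at the sites of `T`. -/
noncomputable def markWeight (p : ℝ) (T : Finset (Fin n)) : ℝ :=
  ∏ j, if j ∈ T then p else 1 - p

variable {Ω : Type*}

/-- The σ-algebra of the marks that act before lag `m`. -/
@[reducible] def lagPast (marks : Ω → Set (ℕ × ℕ)) (m : ℕ) : MeasurableSpace Ω :=
  ⨆ z ∈ {z : ℕ × ℕ | z.2 < m + z.1}, MeasurableSpace.generateFrom {{ω | z ∈ marks ω}}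

theorem lagPast_mono (marks : Ω → Set (ℕ × ℕ)) (m : ℕ) :
    lagPast marks m ≤ lagPast marks (m + 1) := by
  refine biSup_mono fun z hz => ?_
  simp only [Set.mem_ofPred_eq] at hz ⊢
  omega

theorem measurable_lagMark_lagPast (marks : Ω → Set (ℕ × ℕ)) (m j : ℕ) :
    Measurable[lagPast marks (m + 1)] fun ω => lagMark (marks ω) m j := by
  have h : MeasurableSet[lagPast marks (m + 1)] {ω | (j, m + j) ∈ marks ω} := by
    have h1 : MeasurableSpace.generateFrom {{ω | (j, m + j) ∈ marks ω}} ≤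
        lagPast marks (m + 1) :=
      le_biSup (fun z : ℕ × ℕ => MeasurableSpace.generateFrom {{ω | z ∈ marks ω}})
        (show (j, m + j) ∈ {z : ℕ × ℕ | z.2 < m + 1 + z.1} by
          rw [Set.mem_ofPred_eq]; omega)
    exact h1 _ (MeasurableSpace.measurableSet_generateFrom rfl)
  unfold lagMark
  classical
  exact Measurable.ite h measurable_const measurable_const

theorem measurable_lagHeight_lagPast (marks : Ω → Set (ℕ × ℕ)) (m j : ℕ) :
    Measurable[lagPast marks m] fun ω => lagHeight (marks ω) m j := by
  induction m generalizing j with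
  | zero => simp only [lagHeight_zero]; exact measurable_const
  | succ m ihm =>
    have h := fun j => (ihm j).mono (lagPast_mono marks m) le_rfl
    induction j with
    | zero =>
      simp only [lagHeight_succ_zero]
      exact (h 0).add (measurable_lagMark_lagPast marks m 0)
    | succ j ihj =>
      simp only [lagHeight_succ_succ]
      exact ihj.max ((h _).add (measurable_lagMark_lagPast marks m _))

variable [MeasurableSpace Ω] {P : Measure Ω} {p : ℝ} {marks : Ω → Set (ℕ × ℕ)}

theorem lagPast_le (hmeas : ∀ z, MeasurableSet {ω | z ∈ marks ω}) (m : ℕ) :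
    lagPast marks m ≤ ‹MeasurableSpace Ω› := by
  refine iSup₂_le fun z _ => MeasurableSpace.generateFrom_le ?_
  rintro _ rfl
  exact hmeas z

/-- The probability that the heights at the first `n` sites stay below the barrier `y`. -/
noncomputable def barrierProb (P : Measure Ω) (marks : Ω → Set (ℕ × ℕ)) (m : ℕ) (y : Fin n → ℤ) :
    ℝ :=
  P.real {ω | ∀ j : Fin n, (lagHeight (marks ω) m j : ℤ) ≤ y j}

/-- The boundary behaviour of the barrier probabilities where the barrier descends by one, due to
the monotonicity of the heights. -/
theorem barrierProb_eq_of_descent (m : ℕ) (y : Fin n → ℤ) (j j' : Fin n)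
    (hj : (j' : ℕ) = j + 1) (hy : y j' = y j - 1) :
    barrierProb P marks m y = barrierProb P marks m (Function.update y j (y j - 1)) := by
  unfold barrierProb
  congr 1
  ext ω
  simp only [Set.mem_ofPred_eq]
  constructor
  · intro h k
    by_cases hk : k = j
    · subst hk
      rw [Function.update_self, ← hy]
      refine le_trans ?_ (h j')
      rw [hj]
      exact_mod_cast lagHeight_le_succ_right _ _ _
    · rw [Function.update_of_ne hk]; exact h k
  · intro h k
    refine (h k).trans ?_
    by_cases hk : k = j
    · subst hk; rw [Function.update_self]; omega
    · rw [Function.update_of_ne hk]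

/-- The marks acting at lag `m` are independent of the marks acting before. -/
theorem prob_markPattern [IsProbabilityMeasure P]
    (hprob : ∀ z, P {ω | z ∈ marks ω} = ENNReal.ofReal p) (hp0 : 0 < p)
    (hmeas : ∀ z, MeasurableSet {ω | z ∈ marks ω})
    (hindep : iIndepSet (fun z => {ω | z ∈ marks ω}) P) (m : ℕ) (T : Finset (Fin n))
    (A : Set Ω) (hA : MeasurableSet[lagPast marks m] A) :
    P.real (A ∩ {ω | ∀ j : Fin n, ((j : ℕ), m + (j : ℕ)) ∈ marks ω ↔ j ∈ T}) =
      P.real A * markWeight p T := by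
  classical
  let z : Fin n → ℕ × ℕ := fun j => ((j : ℕ), m + (j : ℕ))
  have hz : Function.Injective z := fun i j h => Fin.ext (Prod.ext_iff.1 h).1
  let B : Fin n → Set Ω := fun j =>
    if j ∈ T then {ω | z j ∈ marks ω} else {ω | z j ∈ marks ω}ᶜ
  have hB : {ω | ∀ j : Fin n, ((j : ℕ), m + (j : ℕ)) ∈ marks ω ↔ j ∈ T} = ⋂ j, B j := by
    ext ω
    simp only [Set.mem_ofPred_eq, Set.mem_iInter, B, z]
    refine forall_congr' fun j => ?_
    split_ifs with h <;> simp [h]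
  have hBm : ∀ j, MeasurableSet[MeasurableSpace.generateFrom {{ω | z j ∈ marks ω}}] (B j) := by
    intro j
    have h : MeasurableSet[MeasurableSpace.generateFrom {{ω | z j ∈ marks ω}}]
        {ω | z j ∈ marks ω} := MeasurableSpace.measurableSet_generateFrom rfl
    simp only [B]
    split_ifs
    · exact h
    · exact h.compl
  have hle : ∀ w : ℕ × ℕ, MeasurableSpace.generateFrom {{ω | w ∈ marks ω}} ≤
      ‹MeasurableSpace Ω› := by
    intro w
    refine MeasurableSpace.generateFrom_le ?_
    rintro _ rfl
    exact hmeas w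
  have hind : Indep (lagPast marks m)
      (⨆ w ∈ {w : ℕ × ℕ | w.2 = m + w.1}, MeasurableSpace.generateFrom {{ω | w ∈ marks ω}}) P := by
    refine indep_iSup_of_disjoint hle hindep ?_
    rw [Set.disjoint_left]
    intro w h1 h2
    simp only [Set.mem_ofPred_eq] at h1 h2
    omega
  have hBT : MeasurableSet[⨆ w ∈ {w : ℕ × ℕ | w.2 = m + w.1},
      MeasurableSpace.generateFrom {{ω | w ∈ marks ω}}] (⋂ j, B j) := by
    refine MeasurableSet.iInter fun j => ?_
    exact (le_biSup (fun w : ℕ × ℕ => MeasurableSpace.generateFrom {{ω | w ∈ marks ω}})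
      (show z j ∈ {w : ℕ × ℕ | w.2 = m + w.1} from rfl)) _ (hBm j)
  have h1 := (Indep_iff _ _ P).1 hind A _ hA hBT
  have hind' : iIndep (fun j => MeasurableSpace.generateFrom {{ω | z j ∈ marks ω}}) P :=
    hindep.precomp hz
  have h2 : P (⋂ j, B j) = ∏ j, P (B j) := hind'.meas_iInter hBm
  have hm1 : ∀ w, P.real {ω | w ∈ marks ω} = p := fun w => by
    rw [measureReal_def, hprob, ENNReal.toReal_ofReal hp0.le]
  rw [hB, measureReal_def, h1, ENNReal.toReal_mul, h2, ENNReal.toReal_prod]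
  congr 1
  refine Finset.prod_congr rfl fun j _ => ?_
  change P.real (B j) = _
  simp only [B]
  split_ifs
  · exact hm1 _
  · rw [probReal_compl_eq_one_sub (hmeas _), hm1]

/-- For a weakly increasing barrier the evolution of the barrier probabilities is that of
independent sites. -/
theorem barrierProb_succ [IsProbabilityMeasure P]
    (hprob : ∀ z, P {ω | z ∈ marks ω} = ENNReal.ofReal p) (hp0 : 0 < p)
    (hmeas : ∀ z, MeasurableSet {ω | z ∈ marks ω})
    (hindep : iIndepSet (fun z => {ω | z ∈ marks ω}) P) (m : ℕ) {y : Fin n → ℤ}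
    (hy : Monotone y) :
    barrierProb P marks (m + 1) y =
      ∑ T : Finset (Fin n), markWeight p T * barrierProb P marks m (lowerOn T y) := by
  classical
  let G : Finset (Fin n) → Set Ω := fun T =>
    {ω | ∀ j : Fin n, ((j : ℕ), m + (j : ℕ)) ∈ marks ω ↔ j ∈ T}
  let A : Finset (Fin n) → Set Ω := fun T =>
    {ω | ∀ j : Fin n, (lagHeight (marks ω) m j : ℤ) ≤ lowerOn T y j}
  have hApast : ∀ T, MeasurableSet[lagPast marks m] (A T) := by
    intro T
    have : A T = ⋂ j : Fin n, (fun ω => lagHeight (marks ω) m j) ⁻¹'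
        {k : ℕ | (k : ℤ) ≤ lowerOn T y j} := by
      ext ω; simp [A]
    rw [this]
    refine MeasurableSet.iInter fun j => ?_
    exact measurable_lagHeight_lagPast marks m j (MeasurableSet.of_discrete)
  have hG : ∀ T, MeasurableSet (G T) := by
    intro T
    have : G T = ⋂ j : Fin n, {ω | ((j : ℕ), m + (j : ℕ)) ∈ marks ω ↔ j ∈ T} := by
      ext ω; simp [G]
    rw [this]
    refine MeasurableSet.iInter fun j => ?_
    by_cases h : j ∈ T
    · simpa [h] using hmeas _
    · simp only [h, iff_false]
      exact (hmeas ((j : ℕ), m + (j : ℕ))).compl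
  have hunion : {ω | ∀ j : Fin n, (lagHeight (marks ω) (m + 1) j : ℤ) ≤ y j} =
      ⋃ T, A T ∩ G T := by
    ext ω
    rw [Set.mem_ofPred_eq, lagHeight_succ_le_iff _ _ hy, Set.mem_iUnion]
    have key : ∀ T, ω ∈ G T → ((∀ j : Fin n, (lagHeight (marks ω) m j : ℤ) +
        lagMark (marks ω) m j ≤ y j) ↔ ω ∈ A T) := by
      intro T hT
      refine forall_congr' fun j => ?_
      have := hT j
      simp only [lagMark, lowerOn]
      split_ifs <;> simp_all
    constructor
    · intro h
      let T : Finset (Fin n) := Finset.univ.filter fun j => ((j : ℕ), m + (j : ℕ)) ∈ marks ω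
      have hT : ω ∈ G T := fun j => by simp [T]
      exact ⟨T, (key T hT).1 h, hT⟩
    · rintro ⟨T, hA, hT⟩
      exact (key T hT).2 hA
  have hdisj : Pairwise (Function.onFun Disjoint fun T => A T ∩ G T) := by
    intro T T' hne
    rw [Function.onFun, Set.disjoint_left]
    rintro ω ⟨-, h1⟩ ⟨-, h2⟩
    exact hne (Finset.ext fun j => (h1 j).symm.trans (h2 j))
  rw [barrierProb, hunion, measureReal_iUnion_fintype hdisj
    fun T => ((lagPast_le hmeas m) _ (hApast T)).inter (hG T)]
  refine Finset.sum_congr rfl fun T _ => ?_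
  rw [prob_markPattern hprob hp0 hmeas hindep m T (A T) (hApast T), mul_comm]
  rfl

/-- A function of barriers with the boundary behaviour of the barrier probabilities is determined,
on the barriers reached in one step from a weakly increasing one, by its values on the weakly
increasing ones. -/
theorem eq_lowerOn_of_descent {f g : (Fin n → ℤ) → ℂ}
    (hf : ∀ (y : Fin n → ℤ) (j j' : Fin n), (j' : ℕ) = j + 1 → y j' = y j - 1 →
      f y = f (Function.update y j (y j - 1)))
    (hg : ∀ (y : Fin n → ℤ) (j j' : Fin n), (j' : ℕ) = j + 1 → y j' = y j - 1 →
      g y = g (Function.update y j (y j - 1)))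
    (hfg : ∀ y, Monotone y → f y = g y) {y : Fin n → ℤ} (hy : Monotone y) (T : Finset (Fin n)) :
    f (lowerOn T y) = g (lowerOn T y) := by
  classical
  induction hk : Tᶜ.card using Nat.strong_induction_on generalizing T with
  | _ k ih =>
    by_cases h : ∃ j j' : Fin n, (j' : ℕ) = j + 1 ∧ y j' = y j ∧ j ∉ T ∧ j' ∈ T
    -- where the lowered barrier descends, the boundary behaviour allows the left site to be lowered
    · obtain ⟨j, j', hj, hyj, hjT, hjT'⟩ := h
      have h1 : lowerOn T y j' = lowerOn T y j - 1 := by simp [lowerOn, hjT, hjT', hyj]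
      have h2 : Function.update (lowerOn T y) j (lowerOn T y j - 1) = lowerOn (insert j T) y := by
        ext i
        by_cases hi : i = j
        · subst hi; simp [lowerOn, hjT]
        · simp [lowerOn, hi]
      rw [hf _ j j' hj h1, hg _ j j' hj h1, h2]
      refine ih _ ?_ (insert j T) rfl
      rw [← hk]
      refine Finset.card_lt_card ?_
      rw [Finset.compl_ssubset_compl]
      exact Finset.ssubset_insert hjT
    · push Not at h
      refine hfg _ ?_
      cases n with
      | zero => exact fun i => i.elim0
      | succ n =>
        refine Fin.monotone_iff_le_succ.2 fun i => ?_
        have h1 : y i.castSucc ≤ y i.succ := hy (Fin.castSucc_lt_succ).le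
        have h2 := h i.castSucc i.succ (by simp)
        simp only [lowerOn]
        split_ifs with h3 h4 h4
        · omega
        · omega
        · have : y i.succ ≠ y i.castSucc := fun h5 => h2 h5 h3 h4
          omega
        · exact h1

end LagHeight

/-! ### Determinantal transition probabilities -/

section DetFormula

/-- The integrand of the contour integral for `odbCoeff`. -/
noncomputable def odbIntegrand (p : ℝ) (m : ℕ) (r y : ℤ) (z : ℂ) : ℂ :=
  (1 - p + p * z) ^ m * (1 - z) ^ (-r) * z ^ (-y - 1)

/-- The coefficient of `z ^ y` in the expansion of `(1 - p + p z) ^ m * (1 - z) ^ (-r)` at the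
origin, as a Cauchy integral over the circle of radius `ρ`. -/
noncomputable def odbCoeff (p ρ : ℝ) (m : ℕ) (r y : ℤ) : ℂ :=
  (2 * Real.pi * Complex.I)⁻¹ * ∮ z in C(0, ρ), odbIntegrand p m r y z

variable {p ρ : ℝ}

theorem one_sub_ne_zero_of_norm_lt {z : ℂ} (hz : ‖z‖ < 1) : 1 - z ≠ 0 := by
  intro h
  rw [← sub_eq_zero.1 h] at hz
  simp at hz

theorem one_sub_ne_zero_of_mem_sphere (h1 : ρ < 1) {z : ℂ} (hz : z ∈ Metric.sphere (0 : ℂ) ρ) :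
    1 - z ≠ 0 := by
  rw [mem_sphere_zero_iff_norm] at hz
  exact one_sub_ne_zero_of_norm_lt (by rwa [hz])

theorem circleIntegrable_odbIntegrand (h0 : 0 < ρ) (h1 : ρ < 1) (m : ℕ) (r y : ℤ) :
    CircleIntegrable (odbIntegrand p m r y) 0 ρ := by
  refine ContinuousOn.circleIntegrable h0.le ?_
  unfold odbIntegrand
  refine ContinuousOn.mul (ContinuousOn.mul (by fun_prop) ?_) ?_
  · exact ContinuousOn.zpow₀ (by fun_prop) _ fun z hz =>
      Or.inl (one_sub_ne_zero_of_mem_sphere h1 hz)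
  · exact ContinuousOn.zpow₀ (by fun_prop) _ fun z hz =>
      Or.inl (ne_zero_of_mem_sphere h0.ne' ⟨z, hz⟩)

theorem odbCoeff_succ (h0 : 0 < ρ) (h1 : ρ < 1) (m : ℕ) (r y : ℤ) :
    odbCoeff p ρ (m + 1) r y =
      (p : ℂ) * odbCoeff p ρ m r (y - 1) + (1 - p) * odbCoeff p ρ m r y := by
  have h : ∮ z in C(0, ρ), odbIntegrand p (m + 1) r y z =
      (p : ℂ) * (∮ z in C(0, ρ), odbIntegrand p m r (y - 1) z) +
        (1 - p) * ∮ z in C(0, ρ), odbIntegrand p m r y z := by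
    rw [← circleIntegral.integral_const_mul, ← circleIntegral.integral_const_mul,
      ← circleIntegral.integral_add]
    · refine circleIntegral.integral_congr h0.le fun z hz => ?_
      have hz0 := ne_zero_of_mem_sphere h0.ne' ⟨z, hz⟩
      simp only [odbIntegrand]
      rw [show -(y - 1) - 1 = (-y - 1) + 1 by ring, zpow_add_one₀ hz0]
      ring
    · exact (circleIntegrable_odbIntegrand h0 h1 m r (y - 1)).const_fun_smul (a := (p : ℂ))
    · exact (circleIntegrable_odbIntegrand h0 h1 m r y).const_fun_smul (a := (1 - p : ℂ))
  rw [odbCoeff, h, odbCoeff, odbCoeff]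
  ring

/-- Multiplication of the generating function by `1 - z`. -/
theorem odbCoeff_sub (h0 : 0 < ρ) (h1 : ρ < 1) (m : ℕ) (r y : ℤ) :
    odbCoeff p ρ m r y - odbCoeff p ρ m r (y - 1) = odbCoeff p ρ m (r - 1) y := by
  rw [odbCoeff, odbCoeff, odbCoeff, ← mul_sub, ← circleIntegral.integral_sub
    (circleIntegrable_odbIntegrand h0 h1 m r y) (circleIntegrable_odbIntegrand h0 h1 m r (y - 1))]
  congr 1
  refine circleIntegral.integral_congr h0.le fun z hz => ?_
  have hz0 := ne_zero_of_mem_sphere h0.ne' ⟨z, hz⟩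
  have hz1 := one_sub_ne_zero_of_mem_sphere h1 hz
  simp only [odbIntegrand]
  rw [show -(y - 1) - 1 = (-y - 1) + 1 by ring, zpow_add_one₀ hz0,
    show -(r - 1) = -r + 1 by ring, zpow_add_one₀ hz1]
  ring

/-- By Cauchy's theorem there are no coefficients of negative order. -/
theorem odbCoeff_of_neg (h0 : 0 < ρ) (h1 : ρ < 1) (m : ℕ) (r : ℤ) {y : ℤ} (hy : y < 0) :
    odbCoeff p ρ m r y = 0 := by
  obtain ⟨k, hk⟩ := Int.eq_ofNat_of_zero_le (show 0 ≤ -y - 1 by omega)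
  have hd : ∀ z ∈ Metric.closedBall (0 : ℂ) ρ,
      DifferentiableAt ℂ (odbIntegrand p m r y) z := by
    intro z hz
    have hz1 : 1 - z ≠ 0 := by
      rw [mem_closedBall_zero_iff] at hz
      exact one_sub_ne_zero_of_norm_lt (hz.trans_lt h1)
    unfold odbIntegrand
    rw [hk]
    simp only [zpow_natCast]
    refine DifferentiableAt.mul (DifferentiableAt.mul (by fun_prop) ?_) (by fun_prop)
    exact DifferentiableAt.zpow (by fun_prop) (Or.inl hz1)
  rw [odbCoeff, Complex.circleIntegral_eq_zero_of_differentiable_on_off_countable h0.le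
    Set.countable_empty (fun z hz => (hd z hz).continuousAt.continuousWithinAt)
    fun z hz => hd z (Metric.ball_subset_closedBall hz.1), mul_zero]

theorem odbCoeff_zero_zero (h0 : 0 < ρ) (y : ℤ) :
    odbCoeff p ρ 0 0 y = if y = 0 then 1 else 0 := by
  have hI : (2 * Real.pi * Complex.I : ℂ) ≠ 0 := by simp [Real.pi_ne_zero]
  unfold odbCoeff odbIntegrand
  simp only [pow_zero, neg_zero, zpow_zero, one_mul]
  split_ifs with h
  · subst h
    have := circleIntegral.integral_sub_center_inv (0 : ℂ) h0.ne'
    simp only [sub_zero] at this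
    simp only [neg_zero, zero_sub, zpow_neg_one, this]
    exact inv_mul_cancel₀ hI
  · have := circleIntegral.integral_sub_zpow_of_ne (n := -y - 1) (by omega) (0 : ℂ) 0 ρ
    simp only [sub_zero] at this
    rw [this, mul_zero]

theorem odbCoeff_zero_one (h0 : 0 < ρ) (h1 : ρ < 1) (y : ℕ) : odbCoeff p ρ 0 1 y = 1 := by
  have h : ∀ y : ℤ, odbCoeff p ρ 0 1 y = odbCoeff p ρ 0 1 (y - 1) + if y = 0 then 1 else 0 := by
    intro y
    rw [← odbCoeff_zero_zero (p := p) h0, ← sub_eq_iff_eq_add', odbCoeff_sub h0 h1, sub_self]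
  induction y with
  | zero => rw [h]; simp [odbCoeff_of_neg h0 h1]
  | succ y ih =>
    rw [h, if_neg (by positivity)]
    simpa using ih

theorem odbCoeff_zero_neg (h0 : 0 < ρ) (h1 : ρ < 1) (k : ℕ) {y : ℤ} (hy : (k : ℤ) < y) :
    odbCoeff p ρ 0 (-k) y = 0 := by
  induction k generalizing y with
  | zero =>
    rw [Nat.cast_zero, neg_zero, odbCoeff_zero_zero h0, if_neg (by simpa using hy.ne')]
  | succ k ih =>
    push_cast at hy ⊢
    rw [show -((k : ℤ) + 1) = -k - 1 by ring, ← odbCoeff_sub h0 h1, ih (by omega), ih (by omega),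
      sub_self]

variable {n : ℕ}

/-- The matrix whose determinant is the probability that the heights stay below `y`. -/
noncomputable def barrierMatrix (p ρ : ℝ) (m : ℕ) (y : Fin n → ℤ) : Matrix (Fin n) (Fin n) ℂ :=
  Matrix.of fun j i => odbCoeff p ρ m ((i : ℤ) - j + 1) (y j + j)

/-- The determinants have the boundary behaviour of the barrier probabilities: rows `j` at `y j` and
at `y j - 1` differ by row `j + 1`. -/
theorem det_barrierMatrix_of_descent (h0 : 0 < ρ) (h1 : ρ < 1) (m : ℕ) (y : Fin n → ℤ)
    (j j' : Fin n) (hj : (j' : ℕ) = j + 1) (hy : y j' = y j - 1) :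
    (barrierMatrix p ρ m y).det =
      (barrierMatrix p ρ m (Function.update y j (y j - 1))).det := by
  have hne : j ≠ j' := by rintro rfl; omega
  set M := barrierMatrix p ρ m (Function.update y j (y j - 1)) with hM
  have h : barrierMatrix p ρ m y = M.updateRow j (M j + M j') := by
    ext k i
    by_cases hk : k = j
    · subst hk
      rw [Matrix.updateRow_self, Pi.add_apply]
      simp only [hM, barrierMatrix, Matrix.of_apply, Function.update_self,
        Function.update_of_ne hne.symm, hy, hj]
      rw [← sub_eq_iff_eq_add', show y k - 1 + (k : ℤ) = y k + k - 1 by ring,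
        odbCoeff_sub h0 h1]
      congr 1 <;> push_cast <;> ring
    · rw [Matrix.updateRow_ne hk]
      simp only [hM, barrierMatrix, Matrix.of_apply, Function.update_of_ne hk]
  rw [h, Matrix.det_updateRow_add_self _ hne]

/-- The determinants satisfy the evolution equation of independent sites for every barrier, by
multilinearity in the rows. -/
theorem det_barrierMatrix_succ (h0 : 0 < ρ) (h1 : ρ < 1) (m : ℕ) (y : Fin n → ℤ) :
    (barrierMatrix p ρ (m + 1) y).det =
      ∑ T : Finset (Fin n), (markWeight p T : ℂ) * (barrierMatrix p ρ m (lowerOn T y)).det := by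
  classical
  let A : Matrix (Fin n) (Fin n) ℂ :=
    fun j i => (p : ℂ) * odbCoeff p ρ m ((i : ℤ) - j + 1) (y j + j - 1)
  let B : Matrix (Fin n) (Fin n) ℂ :=
    fun j i => (1 - p : ℂ) * odbCoeff p ρ m ((i : ℤ) - j + 1) (y j + j)
  have hAB : barrierMatrix p ρ (m + 1) y = A + B := by
    ext j i
    exact odbCoeff_succ h0 h1 _ _ _
  have h := (Matrix.detRowAlternating (R := ℂ) (n := Fin n)).toMultilinearMap.map_add_univ A B
  have h' : (barrierMatrix p ρ (m + 1) y).det =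
      ∑ T : Finset (Fin n), Matrix.det (T.piecewise A B) := by
    rw [hAB]; exact h
  rw [h']
  refine Finset.sum_congr rfl fun T _ => ?_
  have hT : (T.piecewise A B : Matrix (Fin n) (Fin n) ℂ) =
      Matrix.of fun j i => (if j ∈ T then (p : ℂ) else 1 - p) *
        barrierMatrix p ρ m (lowerOn T y) j i := by
    ext j i
    simp only [Finset.piecewise, barrierMatrix, lowerOn, Matrix.of_apply, A, B]
    split_ifs
    · rw [show y j - 1 + (j : ℤ) = y j + j - 1 by ring]
    · rfl
  rw [hT, Matrix.det_mul_column]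
  congr 1
  simp only [markWeight, Complex.ofReal_prod]
  refine Finset.prod_congr rfl fun j _ => ?_
  split_ifs <;> simp

/-- At lag zero the heights vanish. For a nonnegative barrier the matrix is upper triangular with
ones on the diagonal, otherwise its first row is zero. -/
theorem det_barrierMatrix_zero (h0 : 0 < ρ) (h1 : ρ < 1) {y : Fin n → ℤ} (hy : Monotone y) :
    (barrierMatrix p ρ 0 y).det = if ∀ j, 0 ≤ y j then 1 else 0 := by
  split_ifs with h
  · rw [Matrix.det_of_isUpperTriangular]
    · refine Finset.prod_eq_one fun j _ => ?_
      obtain ⟨k, hk⟩ := Int.eq_ofNat_of_zero_le (add_nonneg (h j) (Int.natCast_nonneg (j : ℕ)))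
      rw [barrierMatrix, Matrix.of_apply, sub_self, zero_add, hk]
      exact odbCoeff_zero_one h0 h1 k
    · intro j i hij
      have hij' : (i : ℕ) < j := hij
      have h2 := h j
      rw [barrierMatrix, Matrix.of_apply,
        show (i : ℤ) - j + 1 = -((j - 1 - i : ℕ) : ℤ) by omega]
      exact odbCoeff_zero_neg h0 h1 _ (by omega)
  · push Not at h
    obtain ⟨j, hj⟩ := h
    have hn : 0 < n := j.pos
    refine Matrix.det_eq_zero_of_row_eq_zero ⟨0, hn⟩ fun i => ?_
    have h2 : y ⟨0, hn⟩ ≤ y j := hy (by simp [Fin.le_def])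
    rw [barrierMatrix, Matrix.of_apply]
    exact odbCoeff_of_neg h0 h1 _ _ (by simp; omega)

/-- The joint distribution function of the heights along the characteristics, evaluated at a weakly
increasing barrier, is a determinant. -/
theorem barrierProb_eq_det {Ω : Type*} [MeasurableSpace Ω] {P : Measure Ω} [IsProbabilityMeasure P]
    {marks : Ω → Set (ℕ × ℕ)} (hprob : ∀ z, P {ω | z ∈ marks ω} = ENNReal.ofReal p) (hp0 : 0 < p)
    (hmeas : ∀ z, MeasurableSet {ω | z ∈ marks ω})
    (hindep : iIndepSet (fun z => {ω | z ∈ marks ω}) P) (h0 : 0 < ρ) (h1 : ρ < 1) (m : ℕ)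
    {y : Fin n → ℤ} (hy : Monotone y) :
    (barrierProb P marks m y : ℂ) = (barrierMatrix p ρ m y).det := by
  induction m generalizing y with
  | zero =>
    rw [det_barrierMatrix_zero h0 h1 hy, barrierProb]
    simp only [lagHeight_zero, Nat.cast_zero]
    split_ifs with h <;> simp [h]
  | succ m ih =>
    rw [barrierProb_succ hprob hp0 hmeas hindep m hy, det_barrierMatrix_succ h0 h1]
    push_cast
    refine Finset.sum_congr rfl fun T _ => ?_
    rw [eq_lowerOn_of_descent (f := fun y => (barrierProb P marks m y : ℂ))
      (g := fun y => (barrierMatrix p ρ m y).det) (fun y j j' hj hy => by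
        rw [barrierProb_eq_of_descent m y j j' hj hy])
      (fun y j j' hj hy => det_barrierMatrix_of_descent h0 h1 m y j j' hj hy)
      (fun y hy => ih hy) hy T]

end DetFormula

/-! ### Gaussian contour integrals and Hermite polynomials -/

section GaussContour

theorem integrable_one_add_abs_pow_mul_exp (k : ℕ) {b : ℝ} (hb : 0 < b) :
    Integrable fun u : ℝ => (1 + |u|) ^ k * Real.exp (-b * u ^ 2) := by
  refine ((integrable_exp_neg_mul_sq (half_pos hb)).const_mul
    ((k.factorial : ℝ) * Real.exp (1 + 1 / (2 * b)))).mono'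
    (by fun_prop) (Eventually.of_forall fun u => ?_)
  rw [Real.norm_of_nonneg (by positivity), mul_assoc, ← Real.exp_add]
  have h1 : (1 + |u|) ^ k ≤ (k.factorial : ℝ) * Real.exp (1 + |u|) := by
    have := Real.pow_div_factorial_le_exp (1 + |u|) (by positivity) k
    rwa [div_le_iff₀' (by positivity)] at this
  refine (mul_le_mul_of_nonneg_right h1 (Real.exp_pos _).le).trans ?_
  rw [mul_assoc, ← Real.exp_add]
  refine mul_le_mul_of_nonneg_left (Real.exp_le_exp.2 ?_) (by positivity)
  -- complete the square in `|u|`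
  have h2 : 0 ≤ b / 2 * (|u| - 1 / b) ^ 2 := by positivity
  have h3 : b / 2 * (|u| - 1 / b) ^ 2 = b / 2 * u ^ 2 - |u| + 1 / (2 * b) := by
    rw [← sq_abs u]; field_simp; ring
  linarith

/-- The point of the vertical line through `1` with imaginary part `-u`. -/
noncomputable def linePoint (u : ℝ) : ℂ := 1 - u * Complex.I

theorem re_linePoint (u : ℝ) : (linePoint u).re = 1 := by simp [linePoint]

theorem linePoint_ne_zero (u : ℝ) : linePoint u ≠ 0 := by
  intro h
  have := re_linePoint u
  simp [h] at this

@[fun_prop]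
theorem continuous_linePoint : Continuous linePoint := by unfold linePoint; fun_prop

theorem one_le_norm_linePoint (u : ℝ) : 1 ≤ ‖linePoint u‖ := by
  rw [← re_linePoint u]; exact Complex.re_le_norm _

theorem norm_linePoint_le (u : ℝ) : ‖linePoint u‖ ≤ 1 + |u| := by
  unfold linePoint
  refine (norm_sub_le _ _).trans ?_
  simp

theorem zpow_le_pow_natAbs {a x b : ℝ} (ha : 0 < a) (hax : a⁻¹ ≤ x) (hxb : x ≤ b) (hb : 1 ≤ b)
    (ha1 : 1 ≤ a) (r : ℤ) :
    x ^ r ≤ (a * b) ^ r.natAbs := by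
  have hx : 0 < x := (inv_pos.2 ha).trans_le hax
  rcases Int.natAbs_eq r with h | h
  · rw [h, zpow_natCast, Int.natAbs_natCast]
    refine pow_le_pow_left₀ hx.le (hxb.trans ?_) _
    exact le_mul_of_one_le_left (by linarith) ha1
  · rw [h, zpow_neg, zpow_natCast, Int.natAbs_neg, Int.natAbs_natCast, ← inv_pow]
    refine pow_le_pow_left₀ (by positivity) ?_ _
    refine (inv_le_of_inv_le₀ ha hax).trans ?_
    exact le_mul_of_one_le_right ha.le hb

/-- The integrand of `gaussContour`. -/
noncomputable def gaussContourIntegrand (r : ℤ) (s u : ℝ) : ℂ :=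
  linePoint u ^ r * Complex.exp (linePoint u ^ 2 / 2 + s * linePoint u)

/-- The integral of `w ^ r * exp (w ^ 2 / 2 + s w) / (2 π i)` over the vertical line through `1`. -/
noncomputable def gaussContour (r : ℤ) (s : ℝ) : ℂ :=
  (2 * Real.pi : ℂ)⁻¹ * ∫ u : ℝ, gaussContourIntegrand r s u

theorem continuous_gaussContourIntegrand (r : ℤ) (s : ℝ) :
    Continuous (gaussContourIntegrand r s) := by
  unfold gaussContourIntegrand
  refine Continuous.mul ?_ (by fun_prop)
  exact continuous_linePoint.zpow₀ r fun u => Or.inl (linePoint_ne_zero u)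

theorem norm_gaussContourIntegrand (r : ℤ) (s u : ℝ) :
    ‖gaussContourIntegrand r s u‖ =
      ‖linePoint u‖ ^ r * (Real.exp (1 / 2 + s) * Real.exp (-(1 / 2) * u ^ 2)) := by
  rw [gaussContourIntegrand, norm_mul, norm_zpow, Complex.norm_exp, ← Real.exp_add]
  congr 2
  simp [linePoint, pow_two]
  ring

theorem integrable_gaussContourIntegrand (r : ℤ) (s : ℝ) :
    Integrable (gaussContourIntegrand r s) := by
  refine ((integrable_one_add_abs_pow_mul_exp r.natAbs (b := 1 / 2) (by norm_num)).const_mul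
    (Real.exp (1 / 2 + s))).mono' (continuous_gaussContourIntegrand r s).aestronglyMeasurable
    (Eventually.of_forall fun u => ?_)
  rw [norm_gaussContourIntegrand]
  have h : ‖linePoint u‖ ^ r ≤ (1 + |u|) ^ r.natAbs := by
    simpa using zpow_le_pow_natAbs one_pos (by simpa using one_le_norm_linePoint u)
      (norm_linePoint_le u) (by simp) le_rfl r
  calc _ ≤ (1 + |u|) ^ r.natAbs * (Real.exp (1 / 2 + s) * Real.exp (-(1 / 2) * u ^ 2)) := by
        gcongr
    _ = _ := by ring

theorem gaussContour_zero (s : ℝ) : gaussContour 0 s = (normalDensity s : ℂ) := by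
  have h : ∀ u : ℝ, gaussContourIntegrand 0 s u =
      Complex.exp ((-1 / 2 : ℂ) * u ^ 2 + (-(1 + s) * Complex.I) * u + (1 / 2 + s)) := by
    intro u
    rw [gaussContourIntegrand, zpow_zero, one_mul]
    congr 1
    simp only [linePoint]
    ring_nf
    rw [Complex.I_sq]
    ring
  have h2 : (Real.pi : ℂ) / -(-1 / 2 : ℂ) = ((2 * Real.pi : ℝ) : ℂ) := by push_cast; ring
  have h3 : ((2 * Real.pi : ℝ) : ℂ) ^ (1 / 2 : ℂ) = (√(2 * Real.pi) : ℝ) := by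
    rw [Real.sqrt_eq_rpow, Complex.ofReal_cpow (by positivity)]
    simp
  have h4 : (1 / 2 + s : ℂ) - (-(1 + s) * Complex.I) ^ 2 / (4 * (-1 / 2 : ℂ)) =
      ((-(s ^ 2 / 2) : ℝ) : ℂ) := by
    rw [mul_pow, Complex.I_sq]
    push_cast
    ring
  simp only [gaussContour, h]
  rw [integral_cexp_quadratic (by norm_num), h2, h3, h4, ← Complex.ofReal_exp, normalDensity]
  have h5 : √(2 * Real.pi) * √(2 * Real.pi) = 2 * Real.pi :=
    Real.mul_self_sqrt (by positivity)
  have h6 : √(2 * Real.pi) ≠ 0 := by positivity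
  have h7 : ((√(2 * Real.pi) : ℝ) : ℂ) ≠ 0 := Complex.ofReal_ne_zero.2 h6
  have h8 : (2 * Real.pi : ℂ) = ((√(2 * Real.pi) : ℝ) : ℂ) * ((√(2 * Real.pi) : ℝ) : ℂ) := by
    rw [← Complex.ofReal_mul, h5]; push_cast; ring
  rw [h8, Complex.ofReal_div, mul_inv]
  field_simp

theorem hasDerivAt_gaussContourIntegrand (r : ℤ) (s u : ℝ) :
    HasDerivAt (gaussContourIntegrand r s)
      (-Complex.I * (r * gaussContourIntegrand (r - 1) s u + gaussContourIntegrand (r + 1) s u +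
        s * gaussContourIntegrand r s u)) u := by
  have h1 : HasDerivAt linePoint (-Complex.I) u := by
    have := ((Complex.ofRealCLM.hasDerivAt (x := u)).mul_const Complex.I).const_sub 1
    simp only [Complex.ofRealCLM_apply, Complex.ofReal_one, one_mul] at this
    exact this
  have h2 : HasDerivAt (fun u => linePoint u ^ r)
      ((r : ℂ) * linePoint u ^ (r - 1) * -Complex.I) u :=
    (hasDerivAt_zpow r (linePoint u) (Or.inl (linePoint_ne_zero u))).comp u h1
  have h3 := (((h1.pow 2).div_const 2).add (h1.const_mul (s : ℂ))).cexp
  refine (h2.mul h3).congr_deriv ?_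
  simp only [gaussContourIntegrand, zpow_add_one₀ (linePoint_ne_zero u), Pi.add_apply,
    Pi.pow_apply]
  push_cast
  ring

/-- The recursion of the contour integrals, by integration by parts. -/
theorem gaussContour_add_one (r : ℤ) (s : ℝ) :
    gaussContour (r + 1) s = -s * gaussContour r s - r * gaussContour (r - 1) s := by
  have h1 := integrable_gaussContourIntegrand (r - 1) s
  have h2 := integrable_gaussContourIntegrand r s
  have h3 := integrable_gaussContourIntegrand (r + 1) s
  have h := integral_eq_zero_of_hasDerivAt_of_integrable
    (hasDerivAt_gaussContourIntegrand r s)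
    ((((h1.const_mul (r : ℂ)).add h3).add (h2.const_mul (s : ℂ))).const_mul (-Complex.I)) h2
  have h4 : ∫ u, (r * gaussContourIntegrand (r - 1) s u + gaussContourIntegrand (r + 1) s u +
      s * gaussContourIntegrand r s u) = r * (∫ u, gaussContourIntegrand (r - 1) s u) +
      (∫ u, gaussContourIntegrand (r + 1) s u) + s * ∫ u, gaussContourIntegrand r s u := by
    have h5 := integral_add ((h1.const_mul (r : ℂ)).add h3) (h2.const_mul (s : ℂ))
    simp only [Pi.add_apply] at h5
    rw [h5, integral_add (h1.const_mul (r : ℂ)) h3, integral_const_mul, integral_const_mul]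
  rw [integral_const_mul, h4, mul_eq_zero, or_iff_right (by simp)] at h
  simp only [gaussContour]
  linear_combination (2 * Real.pi : ℂ)⁻¹ * h

/-- The contour integrals of nonnegative order satisfy the recursion of the Hermite functions. -/
theorem gaussContour_natCast (j : ℕ) (s : ℝ) :
    gaussContour j s = (((-1) ^ j * (realHermite j).eval s * normalDensity s : ℝ) : ℂ) := by
  induction j using Nat.twoStepInduction with
  | zero => simp [gaussContour_zero, realHermite_zero]
  | one =>
    have := gaussContour_add_one 0 s
    simp only [zero_add, Int.cast_zero, zero_mul, sub_zero, gaussContour_zero] at this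
    simp [this, realHermite_succ, realHermite_zero]
  | more j ih1 ih2 =>
    have := gaussContour_add_one (j + 1 : ℕ) s
    rw [ih2, show ((j + 1 : ℕ) : ℤ) - 1 = j by push_cast; ring, ih1] at this
    rw [show ((j + 2 : ℕ) : ℤ) = (j + 1 : ℕ) + 1 by push_cast; ring, this, realHermite_succ_succ]
    simp only [Polynomial.eval_sub, Polynomial.eval_mul, Polynomial.eval_X,
      nsmul_eq_mul, Polynomial.eval_natCast]
    push_cast
    ring

theorem integrableOn_pow_mul_exp_neg (i : ℕ) :
    IntegrableOn (fun t : ℝ => t ^ i / (i.factorial : ℝ) * Real.exp (-t)) (Set.Ioi 0) := by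
  have h2 := Real.GammaIntegral_convergent (s := (i : ℝ) + 1) (by positivity)
  have h3 : IntegrableOn (fun t : ℝ => (Real.exp (-t) * t ^ ((i : ℝ) + 1 - 1)) /
      (i.factorial : ℝ)) (Set.Ioi 0) := h2.div_const _
  refine h3.congr_fun (fun t _ => ?_) measurableSet_Ioi
  simp only [add_sub_cancel_right, Real.rpow_natCast]
  ring

/-- The integrand of the Laplace transform of `t ^ i / i!` at the point `linePoint u`. -/
noncomputable def laplaceIntegrand (i : ℕ) (u t : ℝ) : ℂ :=
  (t : ℂ) ^ i / (i.factorial : ℂ) * Complex.exp (-(linePoint u * t))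

theorem norm_laplaceIntegrand (i : ℕ) (u t : ℝ) :
    ‖laplaceIntegrand i u t‖ = ‖t ^ i / (i.factorial : ℝ) * Real.exp (-t)‖ := by
  simp only [laplaceIntegrand, norm_mul, norm_div, norm_pow, Complex.norm_exp,
    Complex.norm_real, Complex.norm_natCast, Real.norm_natCast]
  rw [Real.norm_of_nonneg (Real.exp_pos _).le]
  simp [re_linePoint]

theorem integrableOn_laplaceIntegrand (i : ℕ) (u : ℝ) :
    IntegrableOn (laplaceIntegrand i u) (Set.Ioi 0) := by
  refine Integrable.mono (integrableOn_pow_mul_exp_neg i) ?_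
    (Eventually.of_forall fun t => (norm_laplaceIntegrand i u t).le)
  refine Continuous.aestronglyMeasurable ?_
  unfold laplaceIntegrand
  fun_prop

theorem integral_laplaceIntegrand (i : ℕ) (u : ℝ) :
    ∫ t in Set.Ioi (0 : ℝ), laplaceIntegrand i u t = linePoint u ^ (-(i : ℤ) - 1) := by
  have hw := linePoint_ne_zero u
  have he : ∀ t : ℝ, HasDerivAt (fun t : ℝ => Complex.exp (-(linePoint u * t)))
      (Complex.exp (-(linePoint u * t)) * -linePoint u) t := by
    intro t
    have h := (((Complex.ofRealCLM.hasDerivAt (x := t)).const_mul (linePoint u)).neg).cexp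
    simpa using h
  have hlim : ∀ i, Tendsto (laplaceIntegrand i u) atTop (𝓝 0) := by
    intro i
    rw [tendsto_zero_iff_norm_tendsto_zero]
    simp only [norm_laplaceIntegrand]
    have := ((Real.tendsto_pow_mul_exp_neg_atTop_nhds_zero i).div_const (i.factorial : ℝ)).norm
    rw [zero_div, norm_zero] at this
    refine this.congr fun t => ?_
    congr 1
    ring
  induction i with
  | zero =>
    have h := integral_Ioi_of_hasDerivAt_of_tendsto
      (f := laplaceIntegrand 0 u) (f' := fun t => laplaceIntegrand 0 u t * -linePoint u) (a := 0)
      (m := 0) (by unfold laplaceIntegrand; fun_prop)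
      (fun t _ => by
        have h1 : laplaceIntegrand 0 u = fun t : ℝ => Complex.exp (-(linePoint u * t)) := by
          ext t; simp [laplaceIntegrand]
        rw [h1]
        exact he t)
      ((integrableOn_laplaceIntegrand 0 u).mul_const _) (hlim 0)
    rw [integral_mul_const] at h
    have h0 : laplaceIntegrand 0 u 0 = 1 := by simp [laplaceIntegrand]
    rw [h0] at h
    simp only [CharP.cast_eq_zero, neg_zero, zero_sub, zpow_neg_one]
    refine eq_inv_of_mul_eq_one_left ?_
    linear_combination -h
  | succ i ih =>
    have hd : ∀ t : ℝ, HasDerivAt (laplaceIntegrand (i + 1) u)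
        (laplaceIntegrand i u t - linePoint u * laplaceIntegrand (i + 1) u t) t := by
      intro t
      have h1 := ((Complex.ofRealCLM.hasDerivAt (x := t)).pow (i + 1)).div_const
        ((i + 1).factorial : ℂ)
      refine (h1.mul (he t)).congr_deriv ?_
      have h2 : (i.factorial : ℂ) ≠ 0 := by exact_mod_cast i.factorial_ne_zero
      have h3 : (i : ℂ) + 1 ≠ 0 := by exact_mod_cast i.succ_ne_zero
      simp only [laplaceIntegrand, Nat.factorial_succ, Complex.ofRealCLM_apply, Pi.pow_apply,
        Nat.add_sub_cancel]
      push_cast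
      field_simp
      ring
    have h := integral_Ioi_of_hasDerivAt_of_tendsto
      (f := laplaceIntegrand (i + 1) u) (a := 0) (m := 0)
      (by unfold laplaceIntegrand; fun_prop) (fun t _ => hd t)
      ((integrableOn_laplaceIntegrand i u).sub
        ((integrableOn_laplaceIntegrand (i + 1) u).const_mul _)) (hlim (i + 1))
    rw [integral_sub (integrableOn_laplaceIntegrand i u)
      ((integrableOn_laplaceIntegrand (i + 1) u).const_mul _), integral_const_mul, ih] at h
    have h0 : laplaceIntegrand (i + 1) u 0 = 0 := by simp [laplaceIntegrand]
    rw [h0, sub_zero, sub_eq_zero] at h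
    rw [show -((i + 1 : ℕ) : ℤ) - 1 = -(i : ℤ) - 1 - 1 by push_cast; ring, zpow_sub_one₀ hw, h]
    field_simp

/-- The contour integrals that are the limits of the entries of the barrier matrices. -/
theorem gaussContour_eq_integral (i j : ℕ) (s : ℝ) :
    gaussContour ((j : ℤ) - i - 1) s =
      ((∫ x in Set.Iic s, (s - x) ^ i / (i.factorial : ℝ) *
        ((-1) ^ j * (realHermite j).eval x * normalDensity x) : ℝ) : ℂ) := by
  let F : ℝ → ℝ → ℂ := fun u t => gaussContourIntegrand j s u * laplaceIntegrand i u t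
  have hF : ∀ u t, F u t = ((t : ℂ) ^ i / (i.factorial : ℂ)) *
      gaussContourIntegrand j (s - t) u := by
    intro u t
    simp only [F, gaussContourIntegrand, laplaceIntegrand]
    rw [show linePoint u ^ 2 / 2 + ((s - t : ℝ) : ℂ) * linePoint u =
      linePoint u ^ 2 / 2 + s * linePoint u + -(linePoint u * t) by push_cast; ring,
      Complex.exp_add _ (-(linePoint u * t))]
    ring
  have hint : Integrable (Function.uncurry F)
      (volume.prod (volume.restrict (Set.Ioi (0 : ℝ)))) := by
    have h1 := (integrableOn_pow_mul_exp_neg i).ofReal (𝕜 := ℂ)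
    refine Integrable.mono ((integrable_gaussContourIntegrand j s).mul_prod h1) ?_ ?_
    · refine Continuous.aestronglyMeasurable ?_
      have := continuous_gaussContourIntegrand j s
      simp only [F, Function.uncurry_def, laplaceIntegrand]
      fun_prop
    · refine Eventually.of_forall ?_
      rintro ⟨u, t⟩
      simp only [Function.uncurry_apply_pair, F]
      rw [norm_mul, norm_mul, norm_laplaceIntegrand, RCLike.norm_ofReal, Real.norm_eq_abs]
  have hswap := integral_integral_swap hint
  have hleft : ∀ u, ∫ t in Set.Ioi (0 : ℝ), F u t =
      gaussContourIntegrand ((j : ℤ) - i - 1) s u := by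
    intro u
    simp only [F]
    rw [integral_const_mul, integral_laplaceIntegrand]
    simp only [gaussContourIntegrand]
    rw [show (j : ℤ) - i - 1 = j + (-(i : ℤ) - 1) by ring, zpow_add₀ (linePoint_ne_zero u)]
    ring
  have hright : ∀ t : ℝ, (2 * Real.pi : ℂ)⁻¹ * ∫ u, F u t =
      ((t ^ i / (i.factorial : ℝ) * ((-1) ^ j * (realHermite j).eval (s - t) *
        normalDensity (s - t)) : ℝ) : ℂ) := by
    intro t
    simp only [hF]
    rw [integral_const_mul]
    have := gaussContour_natCast j (s - t)
    rw [gaussContour] at this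
    rw [mul_left_comm, this]
    push_cast
    ring
  have hsub : ∫ x in Set.Iic s, (s - x) ^ i / (i.factorial : ℝ) *
      ((-1) ^ j * (realHermite j).eval x * normalDensity x) =
      ∫ t in Set.Ioi (0 : ℝ), t ^ i / (i.factorial : ℝ) * ((-1) ^ j *
        (realHermite j).eval (s - t) * normalDensity (s - t)) := by
    have h := (Measure.measurePreserving_sub_left (volume : Measure ℝ) s).setIntegral_preimage_emb
      (Homeomorph.subLeft s).measurableEmbedding
      (fun x => (s - x) ^ i / (i.factorial : ℝ) *
        ((-1) ^ j * (realHermite j).eval x * normalDensity x)) (Set.Iic s)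
    rw [← h, ← integral_Ici_eq_integral_Ioi]
    have hset : (fun t => s - t) ⁻¹' Set.Iic s = Set.Ici 0 := by ext t; simp
    rw [hset]
    simp
  rw [hsub, ← integral_complex_ofReal, gaussContour]
  simp only [← hleft, ← hright]
  rw [hswap, integral_const_mul]

end GaussContour

/-! ### Asymptotics of the transition determinants -/

section Asymptotics

/-- The point of the circle of radius `exp (-1 / N)` with argument `u / N`. -/
noncomputable def saddlePoint (N u : ℝ) : ℂ := Complex.exp (-(linePoint u / N))

/-- The rescaled integrand of the contour integral for `odbCoeff`. -/
noncomputable def scaledIntegrand (p N : ℝ) (m : ℕ) (r y : ℤ) (u : ℝ) : ℂ :=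
  (1 - p + p * saddlePoint N u) ^ m * saddlePoint N u ^ (-y) * (N * (1 - saddlePoint N u)) ^ (-r)

theorem saddlePoint_eq_circleMap (N u : ℝ) :
    saddlePoint N u = circleMap 0 (Real.exp (-1 / N)) (u / N) := by
  rw [saddlePoint, circleMap_zero, Complex.ofReal_exp, ← Complex.exp_add]
  congr 1
  simp only [linePoint]
  push_cast
  ring

theorem odbCoeff_eq_integral_scaledIntegrand (p : ℝ) {N : ℝ} (hN : 0 < N) (m : ℕ) (r y : ℤ) :
    (N : ℂ) ^ (1 - r) * odbCoeff p (Real.exp (-1 / N)) m r y =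
      (2 * Real.pi : ℂ)⁻¹ * ∫ u, (Set.Ioc (-(Real.pi * N)) (Real.pi * N)).indicator
        (scaledIntegrand p N m r y) u := by
  have hNc : (N : ℂ) ≠ 0 := Complex.ofReal_ne_zero.2 hN.ne'
  set ρ := Real.exp (-1 / N) with hρ
  let g : ℝ → ℂ := fun θ => (1 - p + p * circleMap 0 ρ θ) ^ m * circleMap 0 ρ θ ^ (-y) *
    (1 - circleMap 0 ρ θ) ^ (-r)
  have hg : Function.Periodic g (2 * Real.pi) := fun θ => by
    simp only [g, periodic_circleMap 0 ρ θ]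
  have h1 : ∮ z in C(0, ρ), odbIntegrand p m r y z =
      Complex.I * ∫ θ in (0 : ℝ)..2 * Real.pi, g θ := by
    rw [circleIntegral, ← intervalIntegral.integral_const_mul]
    refine intervalIntegral.integral_congr fun θ _ => ?_
    have hz : circleMap 0 ρ θ ≠ 0 := circleMap_ne_center (Real.exp_pos _).ne'
    simp only [deriv_circleMap, smul_eq_mul, odbIntegrand, g]
    rw [zpow_sub_one₀ hz]
    field_simp
  have h2 : ∫ θ in (0 : ℝ)..2 * Real.pi, g θ = ∫ θ in (-Real.pi)..Real.pi, g θ := by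
    have := hg.intervalIntegral_add_eq 0 (-Real.pi)
    rwa [zero_add, show -Real.pi + 2 * Real.pi = Real.pi by ring] at this
  have h3 : (N : ℂ) * ∫ θ in (-Real.pi)..Real.pi, g θ =
      ∫ u in (-(Real.pi * N))..(Real.pi * N), g (u / N) := by
    rw [intervalIntegral.integral_comp_div _ hN.ne', neg_div,
      mul_div_cancel_right₀ _ hN.ne', Complex.real_smul]
  have h4 : ∀ u, scaledIntegrand p N m r y u = (N : ℂ) ^ (-r) * g (u / N) := by
    intro u
    simp only [scaledIntegrand, g, saddlePoint_eq_circleMap, mul_zpow]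
    ring
  rw [integral_indicator measurableSet_Ioc,
    ← intervalIntegral.integral_of_le (by have := mul_pos Real.pi_pos hN; linarith)]
  simp only [h4]
  rw [intervalIntegral.integral_const_mul, ← h3, odbCoeff, h1, h2,
    show (1 - r : ℤ) = -r + 1 by ring, zpow_add_one₀ hNc]
  have hI := Complex.I_ne_zero
  have hpi : (Real.pi : ℂ) ≠ 0 := Complex.ofReal_ne_zero.2 Real.pi_ne_zero
  field_simp

theorem exp_mul_sub_quadratic_isLittleO (a : ℂ) :
    (fun h : ℂ => Complex.exp (a * h) - (1 + a * h + (a * h) ^ 2 / 2)) =o[𝓝 0]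
      fun h : ℂ => h ^ 2 := by
  have h1 := Complex.exp_sub_sum_range_succ_isLittleO_pow 2
  have h2 : Tendsto (fun h : ℂ => a * h) (𝓝 0) (𝓝 0) := by
    have : Continuous fun h : ℂ => a * h := by fun_prop
    simpa using this.tendsto 0
  have h3 := h1.comp_tendsto h2
  have h4 : ((fun x : ℂ => x ^ 2) ∘ fun h : ℂ => a * h) =O[𝓝 0] fun h : ℂ => h ^ 2 := by
    have : ((fun x : ℂ => x ^ 2) ∘ fun h : ℂ => a * h) = fun h => a ^ 2 * h ^ 2 := by
      ext h; simp [mul_pow]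
    rw [this]
    exact Asymptotics.isBigO_const_mul_self _ _ _
  refine (h3.trans_isBigO h4).congr_left fun h => ?_
  simp [Finset.sum_range_succ, Nat.factorial]

/-- The centered one-step generating function is quadratic at the origin with the variance as its
coefficient. -/
theorem tendsto_bernoulli_div_sq (p : ℝ) :
    Tendsto (fun h : ℂ => ((1 - p) * Complex.exp (p * h) + p * Complex.exp (-(1 - p) * h) - 1) /
      h ^ 2) (𝓝[≠] 0) (𝓝 ((p : ℂ) * (1 - p) / 2)) := by
  have h1 := ((exp_mul_sub_quadratic_isLittleO p).const_mul_left (1 - p : ℂ)).add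
    ((exp_mul_sub_quadratic_isLittleO (-(1 - p))).const_mul_left (p : ℂ))
  have h2 := (h1.tendsto_div_nhds_zero.mono_left (nhdsWithin_le_nhds (s := {0}ᶜ))).add_const
    ((p : ℂ) * (1 - p) / 2)
  rw [zero_add] at h2
  refine h2.congr' ?_
  filter_upwards [self_mem_nhdsWithin] with h hh
  have hh : h ≠ 0 := hh
  field_simp
  ring

theorem tendsto_one_sub_exp_neg_div :
    Tendsto (fun h : ℂ => (1 - Complex.exp (-h)) / h) (𝓝[≠] 0) (𝓝 1) := by
  have h1 : HasDerivAt (fun h : ℂ => 1 - Complex.exp (-h)) 1 0 := by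
    have := ((hasDerivAt_id (0 : ℂ)).neg.cexp).const_sub 1
    simpa using this
  have h2 := h1.tendsto_slope
  refine h2.congr fun h => ?_
  simp [slope_def_field]

/-- Pointwise convergence of the rescaled integrands: a central limit theorem for the generating
function of the steps at complex arguments. -/
theorem tendsto_scaledIntegrand {p : ℝ} (hp0 : 0 < p) (hp1 : p < 1) {N : ℕ → ℝ}
    (hN : ∀ m : ℕ, N m = √(p * (1 - p)) * √(m : ℝ)) {Y : ℕ → ℤ} {s : ℝ}
    (hY : Tendsto (fun m : ℕ => (Y m - p * m) / N m) atTop (𝓝 s)) (r : ℤ) (u : ℝ) :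
    Tendsto (fun m : ℕ => scaledIntegrand p (N m) m r (Y m) u) atTop
      (𝓝 (gaussContourIntegrand (-r) s u)) := by
  have hv : 0 < p * (1 - p) := mul_pos hp0 (by linarith)
  have hNpos : ∀ m : ℕ, 0 < m → 0 < N m := fun m hm => by
    rw [hN]; have : (0 : ℝ) < m := by exact_mod_cast hm
    positivity
  have hNtop : Tendsto N atTop atTop := by
    have : Tendsto (fun m : ℕ => √(p * (1 - p)) * √(m : ℝ)) atTop atTop :=
      (Real.tendsto_sqrt_atTop.comp tendsto_natCast_atTop_atTop).const_mul_atTop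
        (Real.sqrt_pos.2 hv)
    exact this.congr fun m => (hN m).symm
  have hw := linePoint_ne_zero u
  set w := linePoint u with hwdef
  have hh : Tendsto (fun m : ℕ => w / (N m : ℂ)) atTop (𝓝[≠] 0) := by
    refine tendsto_nhdsWithin_iff.2 ⟨?_, ?_⟩
    · have h1 : Tendsto (fun m : ℕ => ((N m)⁻¹ : ℝ)) atTop (𝓝 0) := hNtop.inv_tendsto_atTop
      have h2 := ((Complex.continuous_ofReal.tendsto 0).comp h1).const_mul w
      simp only [Complex.ofReal_zero, mul_zero] at h2
      refine h2.congr fun m => ?_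
      simp [div_eq_mul_inv]
    · filter_upwards [eventually_gt_atTop 0] with m hm
      exact div_ne_zero hw (Complex.ofReal_ne_zero.2 (hNpos m hm).ne')
  -- the last factor
  have h1 : Tendsto (fun m : ℕ => ((N m : ℂ) * (1 - saddlePoint (N m) u)) ^ (-r)) atTop
      (𝓝 (w ^ (-r))) := by
    have h2 := (tendsto_one_sub_exp_neg_div.comp hh).mul_const w
    rw [one_mul] at h2
    have h3 : Tendsto (fun m : ℕ => (N m : ℂ) * (1 - saddlePoint (N m) u)) atTop (𝓝 w) := by
      refine h2.congr' ?_
      filter_upwards [eventually_gt_atTop 0] with m hm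
      have hNc : (N m : ℂ) ≠ 0 := Complex.ofReal_ne_zero.2 (hNpos m hm).ne'
      simp only [Function.comp_apply, saddlePoint, ← hwdef]
      field_simp
    exact (continuousAt_zpow₀ w (-r) (Or.inl hw)).tendsto.comp h3
  -- the centered power converges to the exponential of the square
  have h2 : Tendsto (fun m : ℕ => ((1 - p) * Complex.exp (p * (w / N m)) +
      p * Complex.exp (-(1 - p) * (w / N m))) ^ m) atTop (𝓝 (Complex.exp (w ^ 2 / 2))) := by
    have h3 := ((tendsto_bernoulli_div_sq p).comp hh).mul_const (w ^ 2 / (p * (1 - p)))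
    have hpc : (p : ℂ) ≠ 0 := by exact_mod_cast hp0.ne'
    have hqc : (1 - p : ℂ) ≠ 0 := by exact_mod_cast (sub_pos.2 hp1).ne'
    have h4 := Complex.tendsto_one_add_pow_exp_of_tendsto (g := fun m : ℕ =>
      ((1 - p) * Complex.exp (p * (w / N m)) + p * Complex.exp (-(1 - p) * (w / N m)) - 1))
      (t := w ^ 2 / 2) ?_
    · refine h4.congr fun m => ?_
      congr 1
      ring
    · rw [show (p : ℂ) * (1 - p) / 2 * (w ^ 2 / (p * (1 - p))) = w ^ 2 / 2 by field_simp] at h3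
      refine h3.congr' ?_
      filter_upwards [eventually_gt_atTop 0] with m hm
      have hNc : (N m : ℂ) ≠ 0 := Complex.ofReal_ne_zero.2 (hNpos m hm).ne'
      have hNsq : (N m : ℂ) ^ 2 = p * (1 - p) * m := by
        have : N m ^ 2 = p * (1 - p) * m := by
          rw [hN, mul_pow, Real.sq_sqrt hv.le, Real.sq_sqrt (by positivity)]
        exact_mod_cast this
      simp only [Function.comp_apply]
      rw [div_pow, hNsq]
      have hm' : (m : ℂ) ≠ 0 := by exact_mod_cast hm.ne'
      field_simp
  have h3 : Tendsto (fun m : ℕ => Complex.exp (((Y m - p * m) / N m : ℝ) * w)) atTop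
      (𝓝 (Complex.exp (s * w))) := by
    refine (Complex.continuous_exp.tendsto _).comp ?_
    exact ((Complex.continuous_ofReal.tendsto s).comp hY).mul_const w
  have h4 := (h2.mul h3).mul h1
  rw [← Complex.exp_add, mul_comm] at h4
  refine h4.congr fun m => ?_
  simp only [scaledIntegrand]
  congr 1
  have h5 : (1 - p : ℂ) * Complex.exp (p * (w / N m)) + p * Complex.exp (-(1 - p) * (w / N m)) =
      (1 - p + p * saddlePoint (N m) u) * Complex.exp (p * (w / N m)) := by
    rw [add_mul, mul_assoc (p : ℂ), saddlePoint, ← Complex.exp_add, ← hwdef]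
    congr 3
    ring
  rw [h5, mul_pow, mul_assoc, ← Complex.exp_nat_mul, ← Complex.exp_add, saddlePoint,
    ← Complex.exp_int_mul, ← hwdef]
  congr 2
  push_cast
  ring

theorem cos_le_one_sub_of_abs_le_pi {θ : ℝ} (hθ : |θ| ≤ Real.pi) :
    Real.cos θ ≤ 1 - 2 * θ ^ 2 / Real.pi ^ 2 := by
  have h1 : |θ| / Real.pi ≤ Real.sin (|θ| / 2) := by
    have := Real.mul_le_sin (x := |θ| / 2) (by positivity) (by linarith)
    calc |θ| / Real.pi = 2 / Real.pi * (|θ| / 2) := by ring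
      _ ≤ _ := this
  have h2 : (|θ| / Real.pi) ^ 2 ≤ Real.sin (|θ| / 2) ^ 2 := by gcongr
  have h3 : Real.cos θ = 1 - 2 * Real.sin (|θ| / 2) ^ 2 := by
    rw [← Real.cos_abs, ← Real.cos_sq_add_sin_sq (|θ| / 2)]
    conv_lhs => rw [show |θ| = 2 * (|θ| / 2) by ring, Real.cos_two_mul]
    have := Real.cos_sq_add_sin_sq (|θ| / 2)
    linarith
  rw [h3]
  rw [div_pow, sq_abs] at h2
  have : 2 * θ ^ 2 / Real.pi ^ 2 = 2 * (θ ^ 2 / Real.pi ^ 2) := by ring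
  linarith

/-- On the circle of radius `ρ` the generating function of a step decays like a Gaussian in the
argument. -/
theorem norm_bernoulli_le {p ρ θ : ℝ} (hp0 : 0 < p) (hp1 : p < 1) (h0 : 0 < ρ) (h1 : ρ < 1)
    (hθ : |θ| ≤ Real.pi) :
    ‖(1 - p + p * circleMap 0 ρ θ : ℂ)‖ ≤
      (1 - p + p * ρ) * Real.exp (-(2 * (p * (1 - p)) * ρ * θ ^ 2 / Real.pi ^ 2)) := by
  have hA : 0 < 1 - p + p * ρ := by nlinarith
  have hA1 : (1 - p + p * ρ) ^ 2 ≤ 1 := by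
    rw [sq_le_one_iff₀ hA.le]; nlinarith
  rw [← sq_le_sq₀ (norm_nonneg _) (by positivity), mul_pow, ← Real.exp_nat_mul,
    ← Complex.normSq_eq_norm_sq, Complex.normSq_apply]
  have hre : (1 - p + p * circleMap 0 ρ θ : ℂ).re = 1 - p + p * (ρ * Real.cos θ) := by
    simp [circleMap_zero, Complex.exp_ofReal_mul_I_re]
  have him : (1 - p + p * circleMap 0 ρ θ : ℂ).im = p * (ρ * Real.sin θ) := by
    simp [circleMap_zero, Complex.exp_ofReal_mul_I_im]
  rw [hre, him]
  set B := 4 * (p * (1 - p)) * ρ * θ ^ 2 / Real.pi ^ 2 with hB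
  have hB0 : 0 ≤ B := by have : 0 < 1 - p := by linarith
                         positivity
  have hexp : ((2 : ℕ) : ℝ) * -(2 * (p * (1 - p)) * ρ * θ ^ 2 / Real.pi ^ 2) = -B := by
    rw [hB]; push_cast; ring
  rw [hexp]
  have hcos := cos_le_one_sub_of_abs_le_pi hθ
  have hs := Real.sin_sq_add_cos_sq θ
  have hstep : (1 - p + p * (ρ * Real.cos θ)) * (1 - p + p * (ρ * Real.cos θ)) +
      p * (ρ * Real.sin θ) * (p * (ρ * Real.sin θ)) ≤ (1 - p + p * ρ) ^ 2 - B := by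
    have h2 : 0 ≤ 2 * (p * (1 - p)) * ρ := by
      have : 0 < 1 - p := by linarith
      positivity
    have h3 := mul_le_mul_of_nonneg_left hcos h2
    have h4 : 2 * (p * (1 - p)) * ρ * (1 - 2 * θ ^ 2 / Real.pi ^ 2) =
        2 * (p * (1 - p)) * ρ - B := by rw [hB]; ring
    rw [h4] at h3
    have h5 : (1 - p + p * (ρ * Real.cos θ)) * (1 - p + p * (ρ * Real.cos θ)) +
      p * (ρ * Real.sin θ) * (p * (ρ * Real.sin θ)) = (1 - p) ^ 2 +
        2 * (p * (1 - p)) * ρ * Real.cos θ +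
        p ^ 2 * ρ ^ 2 * (Real.sin θ ^ 2 + Real.cos θ ^ 2) := by ring
    rw [h5, hs]
    nlinarith
  refine hstep.trans ?_
  have h6 : 1 - B ≤ Real.exp (-B) := by have := Real.add_one_le_exp (-B); linarith
  calc (1 - p + p * ρ) ^ 2 - B ≤ (1 - p + p * ρ) ^ 2 * (1 - B) := by nlinarith
    _ ≤ _ := by gcongr

/-- The Gaussian domination of the rescaled integrands. The prefactor is their value at the saddle
point, which converges and is therefore bounded. -/
theorem norm_scaledIntegrand_le {p : ℝ} (hp0 : 0 < p) (hp1 : p < 1) {N : ℝ} (hN : 2 ≤ N) {m : ℕ}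
    (hNm : N ^ 2 = p * (1 - p) * m) (r y : ℤ) {u : ℝ} (hu : |u| ≤ Real.pi * N) :
    ‖scaledIntegrand p N m r y u‖ ≤ ‖scaledIntegrand p N m 0 y 0‖ *
      (2 ^ r.natAbs * ((1 + |u|) ^ r.natAbs * Real.exp (-(1 / Real.pi ^ 2) * u ^ 2))) := by
  have hN0 : 0 < N := by linarith
  set ρ := Real.exp (-1 / N) with hρ
  have hρ0 : 0 < ρ := Real.exp_pos _
  have hρ1 : ρ < 1 := by
    rw [hρ, Real.exp_lt_one_iff]
    exact div_neg_of_neg_of_pos (by norm_num) hN0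
  have hρhalf : 1 / 2 ≤ ρ := by
    have h1 := Real.add_one_le_exp (-1 / N)
    have h2 : -1 / N = -(1 / N) := by ring
    have h3 : 1 / N ≤ 1 / 2 := one_div_le_one_div_of_le (by norm_num) hN
    linarith
  have hA : 0 < 1 - p + p * ρ := by nlinarith
  have hθ : |u / N| ≤ Real.pi := by
    rw [abs_div, abs_of_pos hN0, div_le_iff₀ hN0]; exact hu
  have hz : ∀ u, ‖saddlePoint N u‖ = ρ := fun u => by
    rw [saddlePoint_eq_circleMap, norm_circleMap_zero, abs_of_pos hρ0]
  have h0 : saddlePoint N 0 = (ρ : ℂ) := by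
    rw [saddlePoint_eq_circleMap, zero_div, circleMap_zero]; simp [hρ]
  have hnorm0 : ‖scaledIntegrand p N m 0 y 0‖ = (1 - p + p * ρ) ^ m * ρ ^ (-y) := by
    rw [scaledIntegrand, neg_zero, zpow_zero, mul_one, norm_mul, norm_pow, norm_zpow, hz, h0]
    congr 2
    rw [show (1 - p + p * ρ : ℂ) = ((1 - p + p * ρ : ℝ) : ℂ) by push_cast; ring,
      Complex.norm_real, Real.norm_of_nonneg hA.le]
  have hpow : ‖(1 - p + p * saddlePoint N u : ℂ)‖ ^ m ≤
      (1 - p + p * ρ) ^ m * Real.exp (-(1 / Real.pi ^ 2) * u ^ 2) := by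
    rw [saddlePoint_eq_circleMap]
    refine (pow_le_pow_left₀ (norm_nonneg _) (norm_bernoulli_le hp0 hp1 hρ0 hρ1 hθ) m).trans ?_
    rw [mul_pow, ← Real.exp_nat_mul]
    refine mul_le_mul_of_nonneg_left (Real.exp_le_exp.2 ?_) (by positivity)
    have h2 : (m : ℝ) * -(2 * (p * (1 - p)) * ρ * (u / N) ^ 2 / Real.pi ^ 2) =
        -(2 * ρ * u ^ 2 / Real.pi ^ 2) := by
      have hm : p * (1 - p) * m / N ^ 2 = 1 := by rw [← hNm]; field_simp
      calc _ = -(2 * ρ * u ^ 2 / Real.pi ^ 2) * (p * (1 - p) * m / N ^ 2) := by ring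
        _ = _ := by rw [hm, mul_one]
    rw [h2, show -(1 / Real.pi ^ 2) * u ^ 2 = -(1 * u ^ 2 / Real.pi ^ 2) by ring]
    gcongr
    linarith
  have hN1 : (N : ℝ) * (1 - ρ) ≤ 1 := by
    have h1 := Real.add_one_le_exp (-1 / N)
    have h2 : N * (-1 / N) = -1 := by field_simp
    nlinarith
  have hN2 : (2 : ℝ)⁻¹ ≤ N * (1 - ρ) := by
    have h1 := Real.add_one_le_exp (1 / N)
    have h2 : ρ * Real.exp (1 / N) = 1 := by
      rw [hρ, ← Real.exp_add, show -1 / N + 1 / N = 0 by ring, Real.exp_zero]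
    have h3 : ρ * (1 / N + 1) ≤ 1 := by nlinarith
    have h4 : ρ + N * ρ ≤ N := by
      have := mul_le_mul_of_nonneg_left h3 hN0.le
      have h5 : N * (ρ * (1 / N + 1)) = ρ + N * ρ := by field_simp
      linarith
    linarith
  have hlow : (2 : ℝ)⁻¹ ≤ ‖(N : ℂ) * (1 - saddlePoint N u)‖ := by
    refine hN2.trans ?_
    rw [norm_mul, Complex.norm_real, Real.norm_of_nonneg hN0.le]
    have := norm_sub_norm_le (1 : ℂ) (saddlePoint N u)
    rw [norm_one, hz] at this
    gcongr
  have hupp : ‖(N : ℂ) * (1 - saddlePoint N u)‖ ≤ 1 + |u| := by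
    rw [norm_mul, Complex.norm_real, Real.norm_of_nonneg hN0.le]
    have h1 : (1 - saddlePoint N u : ℂ) =
        ((1 - ρ : ℝ) : ℂ) - ρ * (Complex.exp (Complex.I * (u / N : ℝ)) - 1) := by
      rw [saddlePoint_eq_circleMap, ← hρ, circleMap_zero, mul_comm Complex.I]
      push_cast
      ring
    have h2 : ‖(1 - saddlePoint N u : ℂ)‖ ≤ (1 - ρ) + ρ * |u / N| := by
      rw [h1]
      refine (norm_sub_le _ _).trans ?_
      rw [Complex.norm_real, Real.norm_of_nonneg (by linarith), norm_mul, Complex.norm_real,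
        Real.norm_of_nonneg hρ0.le]
      gcongr
      exact Real.norm_exp_I_mul_ofReal_sub_one_le
    calc N * ‖(1 - saddlePoint N u : ℂ)‖ ≤ N * ((1 - ρ) + ρ * |u / N|) := by gcongr
      _ = N * (1 - ρ) + ρ * |u| := by rw [abs_div, abs_of_pos hN0]; field_simp
      _ ≤ 1 + 1 * |u| := by gcongr
      _ = _ := by ring
  have hlast := zpow_le_pow_natAbs two_pos hlow hupp (by simp) one_le_two (-r)
  rw [Int.natAbs_neg] at hlast
  rw [hnorm0, scaledIntegrand, norm_mul, norm_mul, norm_pow, norm_zpow, norm_zpow, hz]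
  calc _ ≤ (1 - p + p * ρ) ^ m * Real.exp (-(1 / Real.pi ^ 2) * u ^ 2) * ρ ^ (-y) *
        (2 * (1 + |u|)) ^ r.natAbs := by gcongr
    _ = _ := by rw [mul_pow]; ring

/-- The saddle point asymptotics of the coefficients. -/
theorem tendsto_odbCoeff {p : ℝ} (hp0 : 0 < p) (hp1 : p < 1) {N : ℕ → ℝ}
    (hN : ∀ m : ℕ, N m = √(p * (1 - p)) * √(m : ℝ)) {Y : ℕ → ℤ} {s : ℝ}
    (hY : Tendsto (fun m : ℕ => (Y m - p * m) / N m) atTop (𝓝 s)) (r : ℤ) :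
    Tendsto (fun m : ℕ => (N m : ℂ) ^ (1 - r) * odbCoeff p (Real.exp (-1 / N m)) m r (Y m)) atTop
      (𝓝 (gaussContour (-r) s)) := by
  have hv : 0 < p * (1 - p) := mul_pos hp0 (by linarith)
  have hNtop : Tendsto N atTop atTop := by
    have : Tendsto (fun m : ℕ => √(p * (1 - p)) * √(m : ℝ)) atTop atTop :=
      (Real.tendsto_sqrt_atTop.comp tendsto_natCast_atTop_atTop).const_mul_atTop
        (Real.sqrt_pos.2 hv)
    exact this.congr fun m => (hN m).symm
  have hN2 : ∀ᶠ m in atTop, 2 ≤ N m := hNtop.eventually_ge_atTop 2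
  have hNsq : ∀ m, N m ^ 2 = p * (1 - p) * m := fun m => by
    rw [hN, mul_pow, Real.sq_sqrt hv.le, Real.sq_sqrt (by positivity)]
  have hlim0 := (tendsto_scaledIntegrand hp0 hp1 hN hY 0 0).norm
  -- the values at the saddle point are bounded
  have hbdd := hlim0.eventually (gt_mem_nhds (lt_add_one _))
  set C := ‖gaussContourIntegrand (-0) s 0‖ + 1 with hC
  have hmain : Tendsto (fun m : ℕ => ∫ u, (Set.Ioc (-(Real.pi * N m)) (Real.pi * N m)).indicator
      (scaledIntegrand p (N m) m r (Y m)) u) atTop (𝓝 (∫ u, gaussContourIntegrand (-r) s u)) := by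
    refine tendsto_integral_filter_of_dominated_convergence
      (fun u => C * (2 ^ r.natAbs * ((1 + |u|) ^ r.natAbs *
        Real.exp (-(1 / Real.pi ^ 2) * u ^ 2)))) ?_ ?_ ?_ ?_
    · refine Eventually.of_forall fun m => ?_
      refine Measurable.aestronglyMeasurable ?_
      refine Measurable.indicator ?_ measurableSet_Ioc
      unfold scaledIntegrand saddlePoint
      have := continuous_linePoint.measurable
      fun_prop
    · filter_upwards [hN2, hbdd] with m hm hb
      refine Eventually.of_forall fun u => ?_
      by_cases hu : u ∈ Set.Ioc (-(Real.pi * N m)) (Real.pi * N m)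
      · rw [Set.indicator_of_mem hu]
        refine (norm_scaledIntegrand_le hp0 hp1 hm (hNsq m) r (Y m)
          (abs_le.2 ⟨hu.1.le, hu.2⟩)).trans ?_
        gcongr
      · rw [Set.indicator_of_notMem hu, norm_zero]
        positivity
    · exact ((integrable_one_add_abs_pow_mul_exp r.natAbs (by positivity)).const_mul _).const_mul _
    -- the range of integration exhausts the line
    · refine Eventually.of_forall fun u => ?_
      refine (tendsto_scaledIntegrand hp0 hp1 hN hY r u).congr' ?_
      filter_upwards [(hNtop.const_mul_atTop Real.pi_pos).eventually_gt_atTop |u|] with m hm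
      rw [Set.indicator_of_mem]
      have := abs_lt.1 hm
      exact ⟨this.1, this.2.le⟩
  refine (hmain.const_mul (2 * Real.pi : ℂ)⁻¹).congr' ?_
  filter_upwards [hN2] with m hm
  exact (odbCoeff_eq_integral_scaledIntegrand p (by linarith) m r (Y m)).symm

/-- Conjugation by a diagonal matrix of powers does not change the determinant. -/
theorem det_of_zpow_mul {n : ℕ} {a : ℂ} (ha : a ≠ 0) (M : Matrix (Fin n) (Fin n) ℂ) :
    (Matrix.of fun j i : Fin n => a ^ ((j : ℤ) - i) * M j i).det = M.det := by
  have h : (Matrix.of fun j i : Fin n => a ^ ((j : ℤ) - i) * M j i) =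
      Matrix.of fun j i : Fin n => a ^ (j : ℤ) *
        (Matrix.of fun j i : Fin n => a ^ (-(i : ℤ)) * M j i) j i := by
    ext j i
    simp only [Matrix.of_apply]
    rw [sub_eq_add_neg, zpow_add₀ ha, mul_assoc]
  rw [h, Matrix.det_mul_column, Matrix.det_mul_row, ← mul_assoc, ← Finset.prod_mul_distrib,
    Finset.prod_eq_one, one_mul]
  intro j _
  rw [← zpow_add₀ ha, add_neg_cancel, zpow_zero]

/-- The distribution functions of the rescaled heights converge to the determinants of the
truncated Gram matrices. -/
theorem tendsto_barrierProb {p : ℝ} (hp0 : 0 < p) (hp1 : p < 1) {Ω : Type*} [MeasurableSpace Ω]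
    {P : Measure Ω} [IsProbabilityMeasure P] {marks : Ω → Set (ℕ × ℕ)}
    (hprob : ∀ z, P {ω | z ∈ marks ω} = ENNReal.ofReal p)
    (hmeas : ∀ z, MeasurableSet {ω | z ∈ marks ω})
    (hindep : iIndepSet (fun z => {ω | z ∈ marks ω}) P) (n : ℕ) {Y : ℕ → ℤ} {s : ℝ}
    (hY : Tendsto (fun m : ℕ => (Y m - p * m) / (√(p * (1 - p)) * √(m : ℝ))) atTop (𝓝 s)) :
    Tendsto (fun m : ℕ => barrierProb P marks m fun _ : Fin n => Y m) atTop
      (𝓝 (truncatedGram n s).det) := by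
  have hv : 0 < p * (1 - p) := mul_pos hp0 (by linarith)
  let N : ℕ → ℝ := fun m => √(p * (1 - p)) * √(m : ℝ)
  have hNtop : Tendsto N atTop atTop :=
    (Real.tendsto_sqrt_atTop.comp tendsto_natCast_atTop_atTop).const_mul_atTop
      (Real.sqrt_pos.2 hv)
  -- the shifts of the barrier in the matrix do not matter on the scale `N`
  have hYj : ∀ j : ℕ, Tendsto (fun m : ℕ => (((Y m + j : ℤ) : ℝ) - p * m) / N m) atTop (𝓝 s) := by
    intro j
    have h1 := hY.add (hNtop.inv_tendsto_atTop.const_mul (j : ℝ))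
    rw [mul_zero, add_zero] at h1
    refine h1.congr fun m => ?_
    simp only [N, Pi.inv_apply]
    push_cast
    ring
  let L : Matrix (Fin n) (Fin n) ℝ := Matrix.of fun i j : Fin n => ∫ x in Set.Iic s,
        (s - x) ^ (i : ℕ) / ((i : ℕ).factorial : ℝ) *
          ((-1) ^ (j : ℕ) * (realHermite j).eval x * normalDensity x)
  have hlim : Tendsto (fun m : ℕ => (Matrix.of fun j i : Fin n => (N m : ℂ) ^ ((j : ℤ) - i) *
      barrierMatrix p (Real.exp (-1 / N m)) m (fun _ => Y m) j i)) atTop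
      (𝓝 (L.transpose.map Complex.ofReal)) := by
    refine tendsto_pi_nhds.2 fun j => tendsto_pi_nhds.2 fun i => ?_
    have h1 := tendsto_odbCoeff hp0 hp1 (N := N) (fun _ => rfl) (hYj j) ((i : ℤ) - j + 1)
    have h2 : gaussContour (-((i : ℤ) - j + 1)) s = ((L i j : ℝ) : ℂ) := by
      rw [show -((i : ℤ) - j + 1) = (j : ℤ) - i - 1 by ring, gaussContour_eq_integral]
      rfl
    rw [h2] at h1
    refine h1.congr fun m => ?_
    rw [show (1 - ((i : ℤ) - j + 1)) = (j : ℤ) - i by ring]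
    rfl
  have hdet := ((continuous_id.matrix_det (R := ℂ)).tendsto _).comp hlim
  have hLdet : (id (L.transpose.map Complex.ofReal)).det = (((truncatedGram n s).det : ℝ) : ℂ) := by
    have h3 : L.transpose.map Complex.ofReal = Complex.ofRealHom.mapMatrix L.transpose := rfl
    rw [id, h3, ← RingHom.map_det, Matrix.det_transpose, det_truncatedGram_eq_sub_pow]
    rfl
  rw [hLdet] at hdet
  have hre := (Complex.continuous_re.tendsto _).comp hdet
  rw [Complex.ofReal_re] at hre
  refine hre.congr' ?_
  filter_upwards [hNtop.eventually_gt_atTop 0] with m hm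
  have hρ1 : Real.exp (-1 / N m) < 1 := by
    rw [Real.exp_lt_one_iff]
    exact div_neg_of_neg_of_pos (by norm_num) hm
  simp only [Function.comp_apply, id]
  rw [det_of_zpow_mul (Complex.ofReal_ne_zero.2 hm.ne'),
    ← barrierProb_eq_det hprob hp0 hmeas hindep (Real.exp_pos _) hρ1 m monotone_const,
    Complex.ofReal_re]

end Asymptotics

/-! ### The limit theorem -/

theorem tendsto_rescaled_of_abs_sub_le {p : ℝ} (hp0 : 0 < p) (hp1 : p < 1) {Y : ℕ → ℤ} {s C : ℝ}
    (hY : ∀ m : ℕ, |(Y m : ℝ) - (p * m + √(p * (1 - p)) * √(m : ℝ) * s)| ≤ C) :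
    Tendsto (fun m : ℕ => (Y m - p * m) / (√(p * (1 - p)) * √(m : ℝ))) atTop (𝓝 s) := by
  have hσ : 0 < √(p * (1 - p)) := Real.sqrt_pos.2 (mul_pos hp0 (by linarith))
  have hNtop : Tendsto (fun m : ℕ => √(p * (1 - p)) * √(m : ℝ)) atTop atTop :=
    (Real.tendsto_sqrt_atTop.comp tendsto_natCast_atTop_atTop).const_mul_atTop hσ
  refine tendsto_iff_dist_tendsto_zero.2 ?_
  refine squeeze_zero' (Eventually.of_forall fun _ => dist_nonneg) ?_
    (hNtop.const_div_atTop C)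
  filter_upwards [hNtop.eventually_gt_atTop 0] with m hm
  rw [Real.dist_eq, div_sub' hm.ne', abs_div, abs_of_pos hm]
  refine div_le_div_of_nonneg_right ?_ hm.le
  rw [sub_sub]
  exact hY m

theorem barrierProb_const {Ω : Type*} [MeasurableSpace Ω] (P : Measure Ω)
    (marks : Ω → Set (ℕ × ℕ)) (m x : ℕ) (y : ℤ) :
    barrierProb P marks m (fun _ : Fin (x + 1) => y) =
      P.real {ω | (lagHeight (marks ω) m x : ℤ) ≤ y} := by
  rw [barrierProb]
  congr 1
  ext ω
  refine ⟨fun h => h (Fin.last x), fun h j => le_trans ?_ h⟩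
  exact_mod_cast lagHeight_mono _ m (Nat.lt_succ_iff.1 j.2)

theorem odbHeightReal_add (S : Set (ℕ × ℕ)) (m x : ℕ) :
    odbHeightReal S (m + x) x = ((lagHeight S m x : ℤ) : ℝ) := by
  simp [odbHeightReal, lagHeight]

theorem mainTheorem3 {Ω : Type*} [MeasurableSpace Ω] (P : Measure Ω) [IsProbabilityMeasure P]
    (p : ℝ) (hp0 : 0 < p) (hp1 : p < 1)
    -- the random set of marked space-time points `(x, t)`
    (marks : Ω → Set (ℕ × ℕ))
    (hmeas : ∀ z, MeasurableSet {ω | z ∈ marks ω})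
    (hprob : ∀ z, P {ω | z ∈ marks ω} = ENNReal.ofReal p)
    (hindep : iIndepSet (fun z => {ω | z ∈ marks ω}) P)
    (x : ℕ) (s : ℝ) :
    FredholmConverges (volume.restrict (Set.Ioi (s / √2))) (hermiteKernel (x + 1)) ∧
    Tendsto
      (fun t : ℕ => P.real {ω |
        (odbHeightReal (marks ω) t x - p * ((t : ℝ) - x)) / (√(p * (1 - p)) * √((t : ℝ) - x)) ≤ s})
      atTop
      (𝓝 (fredholmDet (volume.restrict (Set.Ioi (s / √2))) (hermiteKernel (x + 1)))) ∧
    Tendsto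
      (fun t : ℕ => P.real {ω |
        (odbHeightReal (marks ω) t x - p * (t : ℝ)) / √(p * (1 - p) * (t : ℝ)) < s})
      atTop
      (𝓝 (fredholmDet (volume.restrict (Set.Ioi (s / √2))) (hermiteKernel (x + 1)))) ∧
    fredholmDet (volume.restrict (Set.Ioi (s / √2))) (hermiteKernel (x + 1)) =
      gueLargestEigenvalueCDF (x + 1) s := by
  have hσ : 0 < √(p * (1 - p)) := Real.sqrt_pos.2 (mul_pos hp0 (by linarith))
  refine ⟨fredholmConverges_hermiteKernel (x + 1) (s / √2), ?_, ?_, ?_⟩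
  · rw [fredholmDet_hermiteKernel, ← tendsto_add_atTop_iff_nat x]
    have hY := tendsto_rescaled_of_abs_sub_le hp0 hp1 (s := s) (C := 1)
      (Y := fun m : ℕ => ⌊p * m + √(p * (1 - p)) * √(m : ℝ) * s⌋) fun m => by
        rw [abs_sub_comm, abs_of_nonneg (sub_nonneg.2 (Int.floor_le _))]
        linarith [Int.lt_floor_add_one (p * m + √(p * (1 - p)) * √(m : ℝ) * s)]
    refine (tendsto_barrierProb hp0 hp1 hprob hmeas hindep (x + 1) hY).congr' ?_
    filter_upwards [eventually_gt_atTop 0] with m hm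
    have hm' : (0 : ℝ) < m := by exact_mod_cast hm
    rw [barrierProb_const]
    congr 1
    ext ω
    rw [Set.mem_ofPred_eq, Set.mem_ofPred_eq, Int.le_floor, odbHeightReal_add, Nat.cast_add,
      add_sub_cancel_right, div_le_iff₀ (by positivity), sub_le_iff_le_add', mul_comm s]
  · rw [fredholmDet_hermiteKernel, ← tendsto_add_atTop_iff_nat x]
    have hY := tendsto_rescaled_of_abs_sub_le hp0 hp1 (s := s)
      (C := 1 + (p * x + √(p * (1 - p)) * √(x : ℝ) * |s|))
      (Y := fun m : ℕ => ⌈p * (m + x : ℝ) + √(p * (1 - p)) * √(m + x : ℝ) * s⌉ - 1) fun m => by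
        set a := p * (m + x : ℝ) + √(p * (1 - p)) * √(m + x : ℝ) * s with ha
        have h1 := Int.ceil_lt_add_one a
        have h2 := Int.le_ceil a
        have h3 : √(m + x : ℝ) - √(m : ℝ) ≤ √(x : ℝ) := by
          have h4 : √(m + x : ℝ) ≤ √(m : ℝ) + √(x : ℝ) := by
            rw [Real.sqrt_le_left (by positivity), add_sq, Real.sq_sqrt (Nat.cast_nonneg m),
              Real.sq_sqrt (Nat.cast_nonneg x)]
            have : 0 ≤ 2 * √(m : ℝ) * √(x : ℝ) := by positivity
            linarith
          linarith
        have h5 : 0 ≤ √(m + x : ℝ) - √(m : ℝ) :=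
          sub_nonneg.2 (Real.sqrt_le_sqrt (le_add_of_nonneg_right (Nat.cast_nonneg x)))
        have h6 : ((⌈a⌉ - 1 : ℤ) : ℝ) - (p * m + √(p * (1 - p)) * √(m : ℝ) * s) =
            (⌈a⌉ - 1 - a) + (p * x + √(p * (1 - p)) * (√(m + x : ℝ) - √(m : ℝ)) * s) := by
          rw [ha]; push_cast; ring
        rw [h6]
        refine (abs_add_le _ _).trans (add_le_add ?_ ((abs_add_le _ _).trans (add_le_add ?_ ?_)))
        · rw [abs_le]; constructor <;> linarith
        · rw [abs_of_nonneg (by positivity)]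
        · rw [abs_mul, abs_of_nonneg (mul_nonneg hσ.le h5)]
          gcongr
    refine (tendsto_barrierProb hp0 hp1 hprob hmeas hindep (x + 1) hY).congr' ?_
    filter_upwards [eventually_gt_atTop 0] with m hm
    have hm' : (0 : ℝ) < m := by exact_mod_cast hm
    have hv : 0 < p * (1 - p) := mul_pos hp0 (by linarith)
    rw [barrierProb_const]
    congr 1
    ext ω
    rw [Set.mem_ofPred_eq, Set.mem_ofPred_eq, Int.le_sub_one_iff, Int.lt_ceil, odbHeightReal_add,
      Nat.cast_add, div_lt_iff₀ (by positivity), sub_lt_iff_lt_add', mul_comm s,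
      Real.sqrt_mul hv.le]
  · rw [fredholmDet_hermiteKernel, gueLargestEigenvalueCDF_eq_det]
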